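/- Let $N\ge 1$ and $\vec\kappa=(\kappa_0,\kappa_1,\kappa_\infty,\theta_1,\dots,\theta_N)\in\mathbb C^{N+3}$, and put $\alpha=-\frac12\left(\kappa_0+\kappa_1+\kappa_\infty+\sum_i\theta_i-1\right)$. The Garnier system $\mathcal H_N(\vec\kappa)$ is the Hamiltonian system $$\frac{\partial q_i}{\partial s_j}=\frac{\partial H_j}{\partial p_i},\qquad \frac{\partial p_i}{\partial s_j}=-\frac{\partial H_j}{\partial q_i}\qquad(i,j=1,\dots,N)$$ on $\{s\in\mathbb C^N: s_i\ne 0,1,\ s_i\neq s_j\ (i\ne j)\}$, where, with $R_{ij}=\frac{s_i(s_j-1)}{s_j-s_i}$ and $S_{ij}=\frac{s_i(s_i-1)}{s_i-s_j}$, $$\begin{aligned}s_i(s_i-1)H_i={}&q_i\Big(\alpha+\sum_jq_jp_j\Big)\Big(\alpha+\kappa_\infty+\sum_jq_jp_j\Big)+s_ip_i(q_ip_i-\theta_i)\\&-\sum_{j\ne i}R_{ji}(q_jp_j-\theta_j)q_ip_j-\sum_{j\neq i}S_{ij}(q_ip_i-\theta_i)q_jp_i-\sum_{j\ne i}R_{ij}q_jp_j(q_ip_i-\theta_i)\\&-\sum_{j\ne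 i}R_{ij}q_ip_i(q_jp_j-\theta_j)-(s_i+1)(q_ip_i-\theta_i)q_ip_i+(\kappa_1s_i+\kappa_0-1)q_ip_i.\end{aligned}$$ An algebraic solution is a solution whose components $q_i,p_i$ are (branches, on some domain, of) algebraic functions of $s$. Let $G$ be the group generated by the following birational transformations $(q,p,s,\vec\kappa)\mapsto(Q,P,S,\vec\kappa')$, where $g_1=\sum_jq_j$, $g_s=\sum_jq_j/s_j$ (and $S=s$ unless stated otherwise): * $\sigma_m$ $(1\le m\le N)$: $\kappa_0\leftrightarrow\theta_m$; $Q_i=q_i/R_{im}$, $P_i=R_{im}\left(p_i-\frac{s_m}{s_i}p_m\right)$, $S_i=\frac{s_m-s_i}{s_m-1}$ for $i\ne m$; $Q_m=\frac{s_m(1-g_s)}{s_m-1}$, $P_m=-(s_m-1)p_m$, $S_m=\frac{s_m}{s_m-1}$; * $\sigma_{N+1}$: $\kappa_0\leftrightarrow\kappa_1$; $Q_i=q_i/s_i$, $P_i=s_ip_i$, $S_i=1/s_i$; * $\sigma_{N+2}$: $\kappa_1\leftrightarrow\kappa_\infty$; $Q_i=\frac{q_i}{g_1-1}$, $P_i=(g_1-1)\left(p_i-\alpha-\sum_jq_jp_j\right)$,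 $S_i=\frac{s_i}{s_i-1}$; * $R_{\kappa_\infty}$: $\kappa_\infty\mapsto-\kappa_\infty$, $(Q,P)=(q,p)$; $R_{\kappa_1}$: $\kappa_1\mapsto-\kappa_1$, $Q_i=q_i$, $P_i=p_i-\frac{\kappa_1}{g_1-1}$; $R_{\kappa_0}$: $\kappa_0\mapsto-\kappa_0$, $Q_i=q_i$, $P_i=p_i-\frac{\kappa_0}{s_i(g_s-1)}$; $R_{\theta_j}$: $\theta_j\mapsto-\theta_j$, $Q_i=q_i$, $P_j=p_j-\frac{\theta_j}{q_j}$, $P_i=p_i$ $(i\ne j)$; * $R_\tau$: $\vec\kappa\mapsto(1-\kappa_0,1-\kappa_1,-\kappa_\infty,-\theta_1,\dots,-\theta_N)$, $Q_i=\frac{s_ip_i(q_ip_i-\theta_i)}{(\alpha+\sum_jq_jp_j)(\alpha+\kappa_\infty+\sum_jq_jp_j)}$, $Q_iP_i=-q_ip_i$. **Theorem.** (1) If $\kappa_0=\kappa_1=\frac12$ and $\kappa_\infty\ne0$, then $$(q_i,p_i)=\left(\frac{\theta_i\sqrt{s_i}}{\kappa_\infty},\frac{\kappa_\infty}{2\sqrt{s_i}}\right),\qquad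 i=1,\dots,N,$$ for any holomorphic branch of the square roots, is an algebraic solution of $\mathcal H_N(\vec\kappa)$, and it is fixed by $w_0=R_\tau\circ R_{\theta_1}\circ\cdots\circ R_{\theta_N}\circ R_{\kappa_\infty}\in G$. (2) If two components of $\vec\kappa$ are half-integers (elements of $\mathbb Z+\frac12$) and $\kappa_\infty\neq0$, then $\mathcal H_N(\vec\kappa)$ has an algebraic solution. If moreover at least one of the remaining $N+1$ components of $\vec\kappa$ is not an integer, then there is an algebraic solution that is the image of a solution from (1), for a suitable parameter, under an element of $G$ (a word in the generators none of whose denominators vanishes along the way). -/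

import Mathlib

namespace Garnier

noncomputable section

/-- The labels of the `N + 3` components of the parameter
`(κ₀, κ₁, κ_∞, θ₁, …, θ_N)`. -/
inductive Idx (N : ℕ) : Type
  | k0 : Idx N
  | k1 : Idx N
  | kinf : Idx N
  | th : Fin N → Idx N
  deriving DecidableEq

/-- A parameter `(κ₀, κ₁, κ_∞, θ₁, …, θ_N) ∈ ℂ^{N+3}`. -/
abbrev Param (N : ℕ) : Type := Idx N → ℂ

/-- `α = -(κ₀ + κ₁ + κ_∞ + ∑ θ_i - 1) / 2`. -/
def alpha {N : ℕ} (κ : Param N) : ℂ :=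
  -(1 / 2) * (κ .k0 + κ .k1 + κ .kinf + ∑ i, κ (.th i) - 1)

/-- `R_{ij} = s_i (s_j - 1) / (s_j - s_i)`. -/
def coeffR {N : ℕ} (s : Fin N → ℂ) (i j : Fin N) : ℂ :=
  s i * (s j - 1) / (s j - s i)

/-- `S_{ij} = s_i (s_i - 1) / (s_i - s_j)`. -/
def coeffS {N : ℕ} (s : Fin N → ℂ) (i j : Fin N) : ℂ :=
  s i * (s i - 1) / (s i - s j)

/-- The Hamiltonian `H_i(q, p, s; κ)`. -/
def hamiltonian {N : ℕ} (κ : Param N) (i : Fin N) (q p s : Fin N → ℂ) : ℂ :=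
  (q i * (alpha κ + ∑ j, q j * p j) * (alpha κ + κ .kinf + ∑ j, q j * p j)
    + s i * p i * (q i * p i - κ (.th i))
    - ∑ j ∈ Finset.univ.erase i, coeffR s j i * (q j * p j - κ (.th j)) * q i * p j
    - ∑ j ∈ Finset.univ.erase i, coeffS s i j * (q i * p i - κ (.th i)) * q j * p i
    - ∑ j ∈ Finset.univ.erase i, coeffR s i j * q j * p j * (q i * p i - κ (.th i))
    - ∑ j ∈ Finset.univ.erase i, coeffR s i j * q i * p i * (q j * p j - κ (.th j))
    - (s i + 1) * (q i * p i - κ (.th i)) * q i * p i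
    + (κ .k1 * s i + κ .k0 - 1) * q i * p i) / (s i * (s i - 1))

/-- The space of the independent variables: `s_i ≠ 0, 1` and `s_i ≠ s_j` for `i ≠ j`. -/
def config (N : ℕ) : Set (Fin N → ℂ) :=
  {s | (∀ i, s i ≠ 0 ∧ s i ≠ 1) ∧ ∀ i j, i ≠ j → s i ≠ s j}

/-- `(q, p)` is a holomorphic solution of the Garnier system
`∂q_i/∂s_j = ∂H_j/∂p_i`, `∂p_i/∂s_j = -∂H_j/∂q_i` on the domain `U`. -/
structure IsSolution {N : ℕ} (κ : Param N) (U : Set (Fin N → ℂ))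
    (q p : (Fin N → ℂ) → Fin N → ℂ) : Prop where
  isOpen : IsOpen U
  isConnected : IsConnected U
  subset_config : U ⊆ config N
  differentiableOn_q : DifferentiableOn ℂ q U
  differentiableOn_p : DifferentiableOn ℂ p U
  eq_q : ∀ s ∈ U, ∀ i j, HasDerivAt (fun x => q (Function.update s j x) i)
    (deriv (fun y => hamiltonian κ j (q s) (Function.update (p s) i y) s) (p s i)) (s j)
  eq_p : ∀ s ∈ U, ∀ i j, HasDerivAt (fun x => p (Function.update s j x) i)
    (-deriv (fun y => hamiltonian κ j (Function.update (q s) i y) (p s) s) (q s i)) (s j)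

/-- `f` is an algebraic function on `U`: it is a root of a nonzero polynomial whose
coefficients are polynomials in `s₁, …, s_N`. -/
def IsAlgebraicFunction {N : ℕ} (U : Set (Fin N → ℂ)) (f : (Fin N → ℂ) → ℂ) : Prop :=
  ∃ F : Polynomial (MvPolynomial (Fin N) ℂ), F ≠ 0 ∧
    ∀ s ∈ U, (F.map (MvPolynomial.eval s)).eval (f s) = 0

/-- A branch, on the domain `U`, of an algebraic solution of the Garnier system. -/
structure IsAlgebraicSolution {N : ℕ} (κ : Param N) (U : Set (Fin N → ℂ))
    (q p : (Fin N → ℂ) → Fin N → ℂ) : Prop extends IsSolution κ U q p where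
  algebraic_q : ∀ i, IsAlgebraicFunction U (fun s => q s i)
  algebraic_p : ∀ i, IsAlgebraicFunction U (fun s => p s i)

/-- A point `(q, p, s)` of the extended phase space. -/
@[ext]
structure Pt (N : ℕ) : Type where
  q : Fin N → ℂ
  p : Fin N → ℂ
  s : Fin N → ℂ

/-- The generators of the group `G` of birational canonical transformations: `sigma m`
exchanges `κ₀` and `θ_m`, `sigmaOne` exchanges `κ₀` and `κ₁`, `sigmaInf` exchanges `κ₁` and
`κ_∞`, `refl a` changes the sign of the component `a`, and `tau` is `R_τ`.
All of them are involutions, so that the elements of `G` are the words in them. -/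
inductive Gen (N : ℕ) : Type
  | sigma : Fin N → Gen N
  | sigmaOne : Gen N
  | sigmaInf : Gen N
  | refl : Idx N → Gen N
  | tau : Gen N

/-- `g₁ = ∑ q_j`. -/
def Pt.g1 {N : ℕ} (x : Pt N) : ℂ := ∑ j, x.q j

/-- `g_s = ∑ q_j / s_j`. -/
def Pt.gs {N : ℕ} (x : Pt N) : ℂ := ∑ j, x.q j / x.s j

/-- `(α + ∑ q_j p_j) (α + κ_∞ + ∑ q_j p_j)`. -/
def Pt.den {N : ℕ} (κ : Param N) (x : Pt N) : ℂ :=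
  (alpha κ + ∑ j, x.q j * x.p j) * (alpha κ + κ .kinf + ∑ j, x.q j * x.p j)

/-- The action of a generator on the parameter. -/
def Gen.param {N : ℕ} : Gen N → Param N → Param N
  | .sigma m, κ => fun a => κ (Equiv.swap .k0 (.th m) a)
  | .sigmaOne, κ => fun a => κ (Equiv.swap .k0 .k1 a)
  | .sigmaInf, κ => fun a => κ (Equiv.swap .k1 .kinf a)
  | .refl a, κ => Function.update κ a (-κ a)
  | .tau, κ => fun a => match a with
    | .k0 => -κ .k0 + 1
    | .k1 => -κ .k1 + 1
    | .kinf => -κ .kinf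
    | .th i => -κ (.th i)

/-- The action of a generator on `(q, p, s)`, for the parameter `κ`. For `tau`, the formula
`P_i = -q_i p_i / Q_i` is written in lowest terms, which for `θ_i = 0` allows one more
cancellation. -/
def Gen.act {N : ℕ} : Gen N → Param N → Pt N → Pt N
  | .sigma m, _, x =>
    { q := fun i => if i = m then x.s m * (1 - x.gs) / (x.s m - 1) else x.q i / coeffR x.s i m
      p := fun i => if i = m then -(x.s m - 1) * x.p m
        else coeffR x.s i m * (x.p i - x.s m / x.s i * x.p m)
      s := fun i => if i = m then x.s m / (x.s m - 1) else (x.s m - x.s i) / (x.s m - 1) }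
  | .sigmaOne, _, x =>
    { q := fun i => x.q i / x.s i
      p := fun i => x.s i * x.p i
      s := fun i => 1 / x.s i }
  | .sigmaInf, κ, x =>
    { q := fun i => x.q i / (x.g1 - 1)
      p := fun i => (x.g1 - 1) * (x.p i - alpha κ - ∑ j, x.q j * x.p j)
      s := fun i => x.s i / (x.s i - 1) }
  | .refl .kinf, _, x => x
  | .refl .k1, κ, x =>
    { q := x.q
      p := fun i => x.p i - κ .k1 / (x.g1 - 1)
      s := x.s }
  | .refl .k0, κ, x =>
    { q := x.q
      p := fun i => x.p i - κ .k0 / (x.s i * (x.gs - 1))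
      s := x.s }
  | .refl (.th j), κ, x =>
    { q := x.q
      p := fun i => if i = j then x.p j - κ (.th j) / x.q j else x.p i
      s := x.s }
  | .tau, κ, x =>
    { q := fun i => x.s i * x.p i * (x.q i * x.p i - κ (.th i)) / x.den κ
      p := fun i => if κ (.th i) = 0 then -x.den κ / (x.s i * x.p i)
        else -x.q i * x.den κ / (x.s i * (x.q i * x.p i - κ (.th i)))
      s := x.s }

/-- The denominators of the transformation do not vanish at the point. (The change of sign of
a component that is zero is the identity map.) -/
def Gen.Regular {N : ℕ} : Gen N → Param N → Pt N → Prop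
  | .sigma _, _, _ => True
  | .sigmaOne, _, _ => True
  | .sigmaInf, _, x => x.g1 ≠ 1
  | .refl .kinf, _, _ => True
  | .refl .k1, κ, x => κ .k1 = 0 ∨ x.g1 ≠ 1
  | .refl .k0, κ, x => κ .k0 = 0 ∨ x.gs ≠ 1
  | .refl (.th j), κ, x => κ (.th j) = 0 ∨ x.q j ≠ 0
  | .tau, κ, x => x.den κ ≠ 0 ∧
      ∀ i, if κ (.th i) = 0 then x.p i ≠ 0 else x.q i * x.p i ≠ κ (.th i)

/-- The action of a word on the parameter; the head of the list is applied first. -/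
def wordParam {N : ℕ} : List (Gen N) → Param N → Param N
  | [], κ => κ
  | g :: w, κ => wordParam w (g.param κ)

/-- The action of a word on `(q, p, s)`; the head of the list is applied first. -/
def wordAct {N : ℕ} : List (Gen N) → Param N → Pt N → Pt N
  | [], _, x => x
  | g :: w, κ, x => wordAct w (g.param κ) (g.act κ x)

/-- No denominator vanishes at any of the successive transformations of a word. -/
def WordRegular {N : ℕ} : List (Gen N) → Param N → Pt N → Prop
  | [], _, _ => True
  | g :: w, κ, x => g.Regular κ x ∧ WordRegular w (g.param κ) (g.act κ x)

/-- `w₀ = R_τ ∘ R_{θ₁} ∘ ⋯ ∘ R_{θ_N} ∘ R_{κ_∞}`. -/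
def w0 (N : ℕ) : List (Gen N) :=
  .refl .kinf :: ((List.finRange N).reverse.map fun i => Gen.refl (.th i)) ++ [.tau]

/-- `t = (√s₁, …, √s_N)` is a holomorphic branch of the square roots on the domain `U`. -/
structure IsSqrtBranch {N : ℕ} (U : Set (Fin N → ℂ)) (t : (Fin N → ℂ) → Fin N → ℂ) : Prop where
  isOpen : IsOpen U
  isConnected : IsConnected U
  subset_config : U ⊆ config N
  differentiableOn : DifferentiableOn ℂ t U
  sq_eq : ∀ s ∈ U, ∀ i, t s i ^ 2 = s i

/-- `q_i = θ_i √s_i / κ_∞`, with `t` in place of `√s`. -/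
def seedQ {N : ℕ} (κ : Param N) (t : Fin N → ℂ) : Fin N → ℂ :=
  fun i => κ (.th i) * t i / κ .kinf

/-- `p_i = κ_∞ / (2 √s_i)`, with `t` in place of `√s`. -/
def seedP {N : ℕ} (κ : Param N) (t : Fin N → ℂ) : Fin N → ℂ :=
  fun i => κ .kinf / (2 * t i)

/-- The parameters of the seed: `κ₀ = κ₁ = 1/2` and `κ_∞ ≠ 0`. -/
def IsSeedParam {N : ℕ} (κ : Param N) : Prop :=
  κ .k0 = 1 / 2 ∧ κ .k1 = 1 / 2 ∧ κ .kinf ≠ 0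

/-- `(q, p)` on `U`, for the parameter `κ`, is the image of a branch of the seed under an
element of `G`: the graph of `(q, p)` is the image of the graph of the seed. -/
def ObtainedFromSeed {N : ℕ} (κ : Param N) (U : Set (Fin N → ℂ))
    (q p : (Fin N → ℂ) → Fin N → ℂ) : Prop :=
  ∃ (w : List (Gen N)) (κ' : Param N) (V : Set (Fin N → ℂ)) (t : (Fin N → ℂ) → Fin N → ℂ),
    IsSeedParam κ' ∧ wordParam w κ' = κ ∧ IsSqrtBranch V t ∧
    (∀ s ∈ V, WordRegular w κ' ⟨seedQ κ' (t s), seedP κ' (t s), s⟩) ∧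
    (fun s => (⟨q s, p s, s⟩ : Pt N)) '' U =
      (fun s => wordAct w κ' ⟨seedQ κ' (t s), seedP κ' (t s), s⟩) '' V

/-- `z` is a half-integer, that is, `z ∈ ℤ + 1/2`. -/
def IsHalfInteger (z : ℂ) : Prop := ∃ m : ℤ, z = m + 1 / 2

end

end Garnier

namespace Garnier

noncomputable section

open Filter Topology

variable {N : ℕ}


/-! ### The Hamiltonian vector field in explicit form -/

/-- `h_k = 2 q_k p_k - θ_k`. -/
def spinH (κ : Param N) (q p : Fin N → ℂ) (k : Fin N) : ℂ := 2 * q k * p k - κ (.th k)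

/-- `f_k = p_k (q_k p_k - θ_k)`. -/
def spinF (κ : Param N) (q p : Fin N → ℂ) (k : Fin N) : ℂ := p k * (q k * p k - κ (.th k))

/-- `C = 2 α + κ_∞ + 2 ∑ q_k p_k`. -/
def spinC (κ : Param N) (q p : Fin N → ℂ) : ℂ := 2 * alpha κ + κ .kinf + 2 * ∑ k, q k * p k

/-- `D = (α + ∑ q_k p_k) (α + κ_∞ + ∑ q_k p_k)`. -/
def spinD (κ : Param N) (q p : Fin N → ℂ) : ℂ :=
  (alpha κ + ∑ k, q k * p k) * (alpha κ + κ .kinf + ∑ k, q k * p k)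

/-- The explicit form of `∂H_j/∂p_i`. -/
def fieldQ (κ : Param N) (s q p : Fin N → ℂ) (i j : Fin N) : ℂ :=
  (if i = j then
    q j ^ 2 * spinC κ q p + s j * spinH κ q p j
      - spinH κ q p j * ∑ k ∈ Finset.univ.erase j, coeffS s j k * q k
      - q j * ∑ k ∈ Finset.univ.erase j, coeffR s j k * spinH κ q p k
      - (s j + 1) * spinH κ q p j * q j + (κ .k1 * s j + κ .k0 - 1) * q j
  else
    q j * q i * spinC κ q p - coeffR s i j * q j * spinH κ q p i
      - coeffR s j i * q i * spinH κ q p j) / (s j * (s j - 1))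

/-- The explicit form of `-∂H_j/∂q_i`. -/
def fieldP (κ : Param N) (s q p : Fin N → ℂ) (i j : Fin N) : ℂ :=
  -(if i = j then
    spinD κ q p + q j * p j * spinC κ q p + s j * p j ^ 2
      - ∑ k ∈ Finset.univ.erase j, coeffR s k j * spinF κ q p k
      - p j ^ 2 * ∑ k ∈ Finset.univ.erase j, coeffS s j k * q k
      - p j * ∑ k ∈ Finset.univ.erase j, coeffR s j k * spinH κ q p k
      - (s j + 1) * spinH κ q p j * p j + (κ .k1 * s j + κ .k0 - 1) * p j
  else
    q j * p i * spinC κ q p - coeffS s j i * spinF κ q p j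
      - coeffR s i j * p i ^ 2 * q j - coeffR s j i * p i * spinH κ q p j) / (s j * (s j - 1))

/-- An arbitrary curve in phase space serves both Hamilton equations: a constant `q` with a moving
coordinate of `p` gives ∂H/∂p, and the reverse gives ∂H/∂q. -/
theorem hasDerivAt_hamiltonian (κ : Param N) (j : Fin N) (s : Fin N → ℂ)
    {q p : ℂ → Fin N → ℂ} {q' p' : Fin N → ℂ} {y : ℂ}
    (hq : ∀ k, HasDerivAt (fun x => q x k) (q' k) y)
    (hp : ∀ k, HasDerivAt (fun x => p x k) (p' k) y) :
    HasDerivAt (fun x => hamiltonian κ j (q x) (p x) s)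
      ((q' j * spinD κ (q y) (p y)
        + q y j * spinC κ (q y) (p y) * ∑ k, (q' k * p y k + q y k * p' k)
        + s j * (p' j * (q y j * p y j - κ (.th j)) + p y j * (q' j * p y j + q y j * p' j))
        - ∑ k ∈ Finset.univ.erase j, coeffR s k j *
            ((q' k * p y k + q y k * p' k) * q y j * p y k
              + (q y k * p y k - κ (.th k)) * (q' j * p y k + q y j * p' k))
        - ∑ k ∈ Finset.univ.erase j, coeffS s j k *
            ((q' j * p y j + q y j * p' j) * q y k * p y j
              + (q y j * p y j - κ (.th j)) * (q' k * p y j + q y k * p' j))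
        - ∑ k ∈ Finset.univ.erase j, coeffR s j k *
            ((q' k * p y k + q y k * p' k) * (q y j * p y j - κ (.th j))
              + q y k * p y k * (q' j * p y j + q y j * p' j))
        - ∑ k ∈ Finset.univ.erase j, coeffR s j k *
            ((q' j * p y j + q y j * p' j) * (q y k * p y k - κ (.th k))
              + q y j * p y j * (q' k * p y k + q y k * p' k))
        - (s j + 1) * (2 * q y j * p y j - κ (.th j)) * (q' j * p y j + q y j * p' j)
        + (κ .k1 * s j + κ .k0 - 1) * (q' j * p y j + q y j * p' j)) / (s j * (s j - 1))) y := by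
  have hqp : ∀ k, HasDerivAt (fun x => q x k * p x k) (q' k * p y k + q y k * p' k) y :=
    fun k => (hq k).fun_mul (hp k)
  have hS : HasDerivAt (fun x => ∑ k, q x k * p x k) (∑ k, (q' k * p y k + q y k * p' k)) y :=
    HasDerivAt.fun_sum fun k _ => hqp k
  have h1 := ((hq j).fun_mul (hS.const_add (alpha κ))).fun_mul (hS.const_add (alpha κ + κ .kinf))
  have h2 := ((hp j).const_mul (s j)).fun_mul ((hqp j).sub_const (κ (.th j)))
  have h3 := HasDerivAt.fun_sum (u := Finset.univ.erase j) fun k _ =>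
    ((((hqp k).sub_const (κ (.th k))).const_mul (coeffR s k j)).fun_mul (hq j)).fun_mul (hp k)
  have h4 := HasDerivAt.fun_sum (u := Finset.univ.erase j) fun k _ =>
    ((((hqp j).sub_const (κ (.th j))).const_mul (coeffS s j k)).fun_mul (hq k)).fun_mul (hp j)
  have h5 := HasDerivAt.fun_sum (u := Finset.univ.erase j) fun k _ =>
    (((hq k).const_mul (coeffR s j k)).fun_mul (hp k)).fun_mul ((hqp j).sub_const (κ (.th j)))
  have h6 := HasDerivAt.fun_sum (u := Finset.univ.erase j) fun k _ =>
    (((hq j).const_mul (coeffR s j k)).fun_mul (hp j)).fun_mul ((hqp k).sub_const (κ (.th k)))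
  have h7 := ((((hqp j).sub_const (κ (.th j))).const_mul (s j + 1)).fun_mul (hq j)).fun_mul (hp j)
  have h8 := ((hq j).const_mul (κ .k1 * s j + κ .k0 - 1)).fun_mul (hp j)
  have H := ((((((((h1.fun_add h2).fun_sub h3).fun_sub h4).fun_sub h5).fun_sub h6).fun_sub h7).fun_add h8).div_const
    (s j * (s j - 1)))
  refine H.congr_deriv ?_
  congr 1
  simp only [spinD, spinC]
  congr 1
  · congr 1
    · congr 1
      · congr 1
        · congr 1
          · congr 1
            · ring
            · exact Finset.sum_congr rfl fun k _ => by ring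
          · exact Finset.sum_congr rfl fun k _ => by ring
        · exact Finset.sum_congr rfl fun k _ => by ring
      · exact Finset.sum_congr rfl fun k _ => by ring
    · ring
  · ring

theorem hasDerivAt_update_apply (v : Fin N → ℂ) (i k : Fin N) (y : ℂ) :
    HasDerivAt (fun x => Function.update v i x k) (if k = i then 1 else 0) y := by
  by_cases h : k = i
  · subst h; simpa using hasDerivAt_id' y
  · simpa [h, Function.update_of_ne h] using hasDerivAt_const y (v k)

theorem sum_erase_ite {M : Type*} [AddCommMonoid M] (i j : Fin N) (F : Fin N → M) :
    ∑ k ∈ Finset.univ.erase j, (if k = i then F k else 0) = if i = j then 0 else F i := by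
  rw [Finset.sum_ite_eq']
  by_cases h : i = j <;> simp [h]

/-- Differentiating a sum over `k ≠ j` in the coordinate `i` leaves a common factor of the sum plus
one summand supported at `k = i`, which is present only if `i ≠ j`. -/
theorem sum_erase_congr_ite {F G H : Fin N → ℂ} (i j : Fin N)
    (h : ∀ k, k ≠ j → F k = H k + if k = i then G k else 0) :
    ∑ k ∈ Finset.univ.erase j, F k =
      ∑ k ∈ Finset.univ.erase j, H k + if i = j then 0 else G i := by
  rw [← sum_erase_ite, ← Finset.sum_add_distrib]
  exact Finset.sum_congr rfl fun k hk => h k (Finset.ne_of_mem_erase hk)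

theorem sum_coeffR_mul_spinH (κ : Param N) (s q p : Fin N → ℂ) (j : Fin N) :
    ∑ k ∈ Finset.univ.erase j, coeffR s j k * spinH κ q p k =
      ∑ k ∈ Finset.univ.erase j, coeffR s j k * (q k * p k) +
        ∑ k ∈ Finset.univ.erase j, coeffR s j k * (q k * p k - κ (.th k)) := by
  rw [← Finset.sum_add_distrib]
  exact Finset.sum_congr rfl fun k _ => by simp only [spinH]; ring

theorem deriv_hamiltonian_p (κ : Param N) (i j : Fin N) (s q p : Fin N → ℂ) :
    deriv (fun y => hamiltonian κ j q (Function.update p i y) s) (p i) = fieldQ κ s q p i j := by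
  have H := hasDerivAt_hamiltonian κ j s (q := fun _ => q) (q' := 0)
    (fun k => hasDerivAt_const (p i) (q k)) (fun k => hasDerivAt_update_apply p i k (p i))
  rw [H.deriv]
  unfold fieldQ
  congr 1
  simp only [Function.update_eq_self, Pi.zero_apply, zero_mul, zero_add]
  set δ : ℂ := if j = i then 1 else 0 with hδ
  rw [sum_erase_congr_ite (F := fun k => coeffR s k j * ((q k * if k = i then 1 else 0) * q j * p k
        + (q k * p k - κ (.th k)) * (q j * if k = i then 1 else 0)))
      (G := fun k => coeffR s k j * q j * spinH κ q p k) (H := fun _ => 0) i j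
      (fun k _ => by simp only [spinH]; split_ifs <;> ring),
    sum_erase_congr_ite (F := fun k => coeffS s j k * (q j * δ * q k * p j
        + (q j * p j - κ (.th j)) * (q k * δ)))
      (G := fun _ => 0)
      (H := fun k => δ * spinH κ q p j * (coeffS s j k * q k)) i j
      (fun k _ => by simp only [spinH]; split_ifs <;> ring),
    sum_erase_congr_ite (F := fun k => coeffR s j k * ((q k * if k = i then 1 else 0) *
        (q j * p j - κ (.th j)) + q k * p k * (q j * δ)))
      (G := fun k => coeffR s j k * q k * (q j * p j - κ (.th j)))
      (H := fun k => δ * q j * (coeffR s j k * (q k * p k))) i j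
      (fun k _ => by split_ifs <;> ring),
    sum_erase_congr_ite (F := fun k => coeffR s j k * (q j * δ * (q k * p k - κ (.th k))
        + q j * p j * (q k * if k = i then 1 else 0)))
      (G := fun k => coeffR s j k * q k * (q j * p j))
      (H := fun k => δ * q j * (coeffR s j k * (q k * p k - κ (.th k)))) i j
      (fun k _ => by split_ifs <;> ring)]
  simp only [← Finset.mul_sum, Finset.sum_const_zero, mul_ite, mul_one, mul_zero,
    Finset.sum_ite_eq', Finset.mem_univ, if_true, sum_coeffR_mul_spinH]
  by_cases h : i = j
  · subst h
    simp only [hδ, if_true, spinH]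
    ring
  · simp only [hδ, if_neg h, if_neg (Ne.symm h), spinH]
    ring

theorem deriv_hamiltonian_q (κ : Param N) (i j : Fin N) (s q p : Fin N → ℂ) :
    -deriv (fun y => hamiltonian κ j (Function.update q i y) p s) (q i) =
      fieldP κ s q p i j := by
  have H := hasDerivAt_hamiltonian κ j s (p := fun _ => p) (p' := 0)
    (fun k => hasDerivAt_update_apply q i k (q i)) (fun k => hasDerivAt_const (q i) (p k))
  rw [H.deriv]
  unfold fieldP
  rw [neg_div]
  congr 2
  simp only [Function.update_eq_self, Pi.zero_apply, zero_mul, mul_zero, zero_add, add_zero]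
  set δ : ℂ := if j = i then 1 else 0 with hδ
  rw [sum_erase_congr_ite (F := fun k => coeffR s k j * ((if k = i then 1 else 0) * p k * q j * p k
        + (q k * p k - κ (.th k)) * (δ * p k)))
      (G := fun k => coeffR s k j * q j * p k ^ 2)
      (H := fun k => δ * (coeffR s k j * spinF κ q p k)) i j
      (fun k _ => by simp only [spinF]; split_ifs <;> ring),
    sum_erase_congr_ite (F := fun k => coeffS s j k * (δ * p j * q k * p j
        + (q j * p j - κ (.th j)) * ((if k = i then 1 else 0) * p j)))
      (G := fun k => coeffS s j k * spinF κ q p j)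
      (H := fun k => δ * p j ^ 2 * (coeffS s j k * q k)) i j
      (fun k _ => by simp only [spinF]; split_ifs <;> ring),
    sum_erase_congr_ite (F := fun k => coeffR s j k * ((if k = i then 1 else 0) * p k *
        (q j * p j - κ (.th j)) + q k * p k * (δ * p j)))
      (G := fun k => coeffR s j k * p k * (q j * p j - κ (.th j)))
      (H := fun k => δ * p j * (coeffR s j k * (q k * p k))) i j
      (fun k _ => by split_ifs <;> ring),
    sum_erase_congr_ite (F := fun k => coeffR s j k * (δ * p j * (q k * p k - κ (.th k))
        + q j * p j * ((if k = i then 1 else 0) * p k)))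
      (G := fun k => coeffR s j k * p k * (q j * p j))
      (H := fun k => δ * p j * (coeffR s j k * (q k * p k - κ (.th k)))) i j
      (fun k _ => by split_ifs <;> ring)]
  simp only [← Finset.mul_sum, ite_mul, one_mul, zero_mul,
    Finset.sum_ite_eq', Finset.mem_univ, if_true, sum_coeffR_mul_spinH]
  by_cases h : i = j
  · subst h
    simp only [hδ, if_true, spinH]
    ring
  · simp only [hδ, if_neg h, if_neg (Ne.symm h), spinH, spinF]
    ring

/-- The derivative of a solution along an arbitrary curve. -/
theorem IsSolution.hasDerivAt_comp {κ : Param N} {U : Set (Fin N → ℂ)}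
    {q p : (Fin N → ℂ) → Fin N → ℂ} (h : IsSolution κ U q p) {γ : ℂ → Fin N → ℂ}
    {γ' : Fin N → ℂ} {x : ℂ} (hγ : HasDerivAt γ γ' x) (hx : γ x ∈ U) (i : Fin N) :
    HasDerivAt (fun y => q (γ y) i)
        (∑ j, γ' j * fieldQ κ (γ x) (q (γ x)) (p (γ x)) i j) x ∧
      HasDerivAt (fun y => p (γ y) i)
        (∑ j, γ' j * fieldP κ (γ x) (q (γ x)) (p (γ x)) i j) x := by
  have key : ∀ (f : (Fin N → ℂ) → Fin N → ℂ) (c : Fin N → ℂ), DifferentiableOn ℂ f U →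
      (∀ j, HasDerivAt (fun y => f (Function.update (γ x) j y) i) (c j) (γ x j)) →
      HasDerivAt (fun y => f (γ y) i) (∑ j, γ' j * c j) x := by
    intro f c hf hc
    have hd : DifferentiableAt ℂ f (γ x) := hf.differentiableAt (h.isOpen.mem_nhds hx)
    have hdi : HasFDerivAt (fun s => f s i) ((ContinuousLinearMap.proj i).comp (fderiv ℂ f (γ x)))
        (γ x) := (ContinuousLinearMap.proj (R := ℂ) (φ := fun _ : Fin N => ℂ) i).hasFDerivAt.comp
          (γ x) hd.hasFDerivAt
    set L := (ContinuousLinearMap.proj (R := ℂ) (φ := fun _ : Fin N => ℂ) i).comp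
      (fderiv ℂ f (γ x)) with hL
    have hc' : ∀ j, L (Pi.single j 1) = c j := by
      intro j
      have h1 : HasFDerivAt (fun s => f s i) L (Function.update (γ x) j (γ x j)) := by
        rwa [Function.update_eq_self]
      have h2 := h1.comp_hasDerivAt (γ x j) (hasDerivAt_update (γ x) j (γ x j))
      exact h2.unique (hc j)
    have h3 := hdi.comp_hasDerivAt x hγ
    have h4 : L γ' = ∑ j, γ' j * c j := by
      conv_lhs => rw [pi_eq_sum_univ' γ']
      simp [hc']
    rw [← h4]; exact h3
  refine ⟨key q _ h.differentiableOn_q fun j => ?_, key p _ h.differentiableOn_p fun j => ?_⟩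
  · rw [← deriv_hamiltonian_p]; exact h.eq_q _ hx i j
  · rw [← deriv_hamiltonian_q]; exact h.eq_p _ hx i j


/-! ### The isomonodromic deformation equations at the finite poles -/

/-- The finite singular points `0`, `1`, `s_1, …, s_N`. -/
abbrev Site (N : ℕ) : Type := Option (Option (Fin N))

/-- The position of a site. -/
def siteU (s : Fin N → ℂ) : Site N → ℂ
  | none => 0
  | some none => 1
  | some (some i) => s i

/-- A tangent vector of the positions. -/
def siteDU (ds : Fin N → ℂ) : Site N → ℂ
  | none => 0
  | some none => 0
  | some (some i) => ds i

/-- The label of the parameter component at a site. -/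
def siteIdx : Site N → Idx N
  | none => .k0
  | some none => .kinf
  | some (some i) => .th i

/-- The parameter component at a site. -/
def siteTh (κ : Param N) (a : Site N) : ℂ := κ (siteIdx a)

/-- The upper right entries of the residue matrices. -/
def siteE (s q : Fin N → ℂ) : Site N → ℂ
  | none => 1 - ∑ i, q i / s i
  | some none => -1
  | some (some i) => q i / s i

/-- The slopes of the eigenlines of the residue matrices. -/
def siteY (κ : Param N) (s q p : Fin N → ℂ) : Site N → ℂ
  | none => 0
  | some none => alpha κ + ∑ i, q i * p i
  | some (some i) => s i * p i

/-- The derivative of `siteE`. -/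
def siteDE (s ds q dq : Fin N → ℂ) : Site N → ℂ
  | none => -∑ i, (dq i / s i - q i * ds i / s i ^ 2)
  | some none => 0
  | some (some i) => dq i / s i - q i * ds i / s i ^ 2

/-- The derivative of `siteY`. -/
def siteDY (s ds q dq p dp : Fin N → ℂ) : Site N → ℂ
  | none => 0
  | some none => ∑ i, (dq i * p i + q i * dp i)
  | some (some i) => ds i * p i + s i * dp i

/-- The logarithmic derivative of the distance of two sites. -/
def siteW (u du : Site N → ℂ) (a b : Site N) : ℂ := (du a - du b) / (u a - u b)

/-- The interaction of two sites, on the entries. -/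
def pairE (θ e y : Site N → ℂ) (a b : Site N) : ℂ :=
  -2 * e a * e b * (y a - y b) + θ a * e b - θ b * e a

/-- The interaction of two sites, on the slopes. -/
def pairY (θ e y : Site N → ℂ) (a b : Site N) : ℂ :=
  (y a - y b) * (e b * (y a - y b) + θ b)

/-- The isomonodromic deformation equations for `(e, y)`, up to an infinitesimal gauge
transformation `(ρ, c)`. -/
def SiteFlow (θ u du e y de dy : Site N → ℂ) : Prop :=
  ∃ ρ c : ℂ, ∀ a, de a = ∑ b, siteW u du a b * pairE θ e y a b + ρ * e a ∧
    dy a = ∑ b, siteW u du a b * pairY θ e y a b - ρ * y a + c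

/-- With `f_a(η) = (η - y_a)(e_a(η - y_a) + θ_a)`, the quantity `pairE` is the η² coefficient of the
bracket `f_a f_b' - f_b f_a'`, which explains the antisymmetry; `pairY` is the value `f_b(y_a)`.
Consequently `∑ e_a` is only rescaled by the flow, and `∑ e_a = 0` persists. -/
theorem pairE_antisymm (θ e y : Site N → ℂ) (a b : Site N) :
    pairE θ e y a b = -pairE θ e y b a := by
  simp only [pairE]; ring

/-- This is the antisymmetry that conserves `∑ e_a y_a` when `∑ e_a = 0`. It provides the equation
for the slope at the site 1, which is not an independent coordinate. -/
theorem pair_moment (θ e y : Site N → ℂ) (a b : Site N) :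
    pairE θ e y a b * y a + pairY θ e y a b * e a =
      -(pairE θ e y b a * y b + pairY θ e y b a * e b) := by
  simp only [pairE, pairY]; ring

/-- When only `s_j` moves, the weight of a pair is nonzero only if exactly one of the two sites is
`s_j`. -/
theorem siteSum_of_ne (s : Fin N → ℂ) (F : Site N → ℂ) (j : Fin N) {a : Site N}
    (ha : a ≠ some (some j)) :
    ∑ b, siteW (siteU s) (siteDU (Pi.single j 1)) a b * F b =
      1 / (s j - siteU s a) * F (some (some j)) := by
  have h0 : ∀ b : Site N, b ≠ some (some j) → siteDU (Pi.single j (1 : ℂ)) b = 0 := by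
    rintro (_ | _ | i) hb <;> simp only [siteDU]
    rw [Pi.single_eq_of_ne]
    rintro rfl; exact hb rfl
  rw [Finset.sum_eq_single (some (some j))]
  · simp only [siteW, h0 a ha]
    simp only [siteDU, siteU, Pi.single_eq_same]
    rw [zero_sub, neg_div, ← div_neg, neg_sub]
  · intro b _ hb
    simp [siteW, h0 a ha, h0 b hb]
  · simp

theorem siteSum_self (s : Fin N → ℂ) (F : Site N → ℂ) (j : Fin N) :
    ∑ b, siteW (siteU s) (siteDU (Pi.single j 1)) (some (some j)) b * F b =
      1 / s j * F none + 1 / (s j - 1) * F (some none)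
        + ∑ k ∈ Finset.univ.erase j, 1 / (s j - s k) * F (some (some k)) := by
  rw [Fintype.sum_option, Fintype.sum_option, ← Finset.add_sum_erase _ _ (Finset.mem_univ j)]
  have : ∑ k ∈ Finset.univ.erase j, siteW (siteU s) (siteDU (Pi.single j 1)) (some (some j))
      (some (some k)) * F (some (some k)) =
      ∑ k ∈ Finset.univ.erase j, 1 / (s j - s k) * F (some (some k)) := by
    refine Finset.sum_congr rfl fun k hk => ?_
    simp [siteW, siteDU, siteU, Pi.single_eq_of_ne (Finset.ne_of_mem_erase hk)]
  rw [this]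
  simp [siteW, siteDU, siteU]
  ring

section Basis

variable (κ : Param N) (s q p : Fin N → ℂ)

theorem sum_spinH_erase (j : Fin N) :
    ∑ k ∈ Finset.univ.erase j, spinH κ q p k =
      2 * (∑ k, q k * p k) - ∑ k, κ (.th k) - spinH κ q p j := by
  have h : ∑ k, spinH κ q p k = 2 * (∑ k, q k * p k) - ∑ k, κ (.th k) := by
    rw [Finset.mul_sum, ← Finset.sum_sub_distrib]
    exact Finset.sum_congr rfl fun k _ => by simp only [spinH]; ring
  rw [← h, ← Finset.add_sum_erase _ _ (Finset.mem_univ j)]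
  ring

theorem two_mul_alpha :
    2 * alpha κ = 1 - κ .k0 - κ .k1 - κ .kinf - ∑ k, κ (.th k) := by
  simp only [alpha]; ring

/-- The gauge parameter of the flow of `s_j` that keeps `e_1 = -1`. -/
def gaugeRho (j : Fin N) : ℂ :=
  1 / (s j - 1) * pairE (siteTh κ) (siteE s q) (siteY κ s q p) (some none) (some (some j))

/-- The gauge parameter of the flow of `s_j` that keeps `y_0 = 0`. -/
def gaugeC (j : Fin N) : ℂ :=
  -(1 / s j * pairY (siteTh κ) (siteE s q) (siteY κ s q p) none (some (some j)))

variable {s}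

/-- Partial fractions in the differences `s_i - s_k` split each interaction with `s_k` into the
coefficients `R` and `S` of the Hamiltonian and terms without poles, whose sums are expressed by `∑
q_k p_k`, `∑ q_k / s_k` and `∑ θ_k`. -/
theorem site_fieldQ (hs : s ∈ config N) (i j : Fin N) :
    siteDE s (Pi.single j 1) q (fun i => fieldQ κ s q p i j) (some (some i)) =
      ∑ b, siteW (siteU s) (siteDU (Pi.single j 1)) (some (some i)) b *
          pairE (siteTh κ) (siteE s q) (siteY κ s q p) (some (some i)) b
        + gaugeRho κ s q p j * siteE s q (some (some i)) := by
  have hj0 := (hs.1 j).1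
  have hj1 : s j - 1 ≠ 0 := sub_ne_zero.2 (hs.1 j).2
  have hi0 := (hs.1 i).1
  by_cases hij : i = j
  · subst hij
    rw [siteSum_self s (fun b => pairE (siteTh κ) (siteE s q) (siteY κ s q p) (some (some i)) b)]
    have e3 : ∑ k ∈ Finset.univ.erase i, 1 / (s i - s k) *
          pairE (siteTh κ) (siteE s q) (siteY κ s q p) (some (some i)) (some (some k)) =
        -(spinH κ q p i / s i) * ∑ k ∈ Finset.univ.erase i, q k / s k
        - spinH κ q p i / (s i * (s i * (s i - 1))) *
          ∑ k ∈ Finset.univ.erase i, coeffS s i k * q k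
        + q i / (s i * (s i - 1)) * ∑ k ∈ Finset.univ.erase i, spinH κ q p k
        - q i / (s i * (s i * (s i - 1))) *
          ∑ k ∈ Finset.univ.erase i, coeffR s i k * spinH κ q p k := by
      simp only [Finset.mul_sum, ← Finset.sum_sub_distrib, ← Finset.sum_add_distrib]
      refine Finset.sum_congr rfl fun k hk => ?_
      have hki := Finset.ne_of_mem_erase hk
      have h1 : s i - s k ≠ 0 := sub_ne_zero.2 (hs.2 i k hki.symm)
      have h2 : s k - s i ≠ 0 := sub_ne_zero.2 (hs.2 k i hki)
      have hk0 := (hs.1 k).1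
      have h3 : s k - s i = -(s i - s k) := by ring
      simp only [pairE, siteE, siteY, siteTh, siteIdx, spinH, coeffS, coeffR]
      rw [h3]
      field_simp
      ring
    have e4 : ∑ k, q k / s k = q i / s i + ∑ k ∈ Finset.univ.erase i, q k / s k :=
      (Finset.add_sum_erase _ _ (Finset.mem_univ i)).symm
    have e5 := two_mul_alpha κ
    rw [e3, sum_spinH_erase]
    simp only [siteDE, Pi.single_eq_same, fieldQ, if_true, gaugeRho, pairE, siteE, siteY, siteTh,
      siteIdx, spinC, e4]
    generalize ∑ k ∈ Finset.univ.erase i, q k / s k = S4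
    generalize ∑ k ∈ Finset.univ.erase i, coeffS s i k * q k = S1
    generalize ∑ k ∈ Finset.univ.erase i, coeffR s i k * spinH κ q p k = S2
    -- `κ₁` belongs to the pole at infinity and does not occur at the finite sites; the definition
    -- of `α` eliminates it.
    have e6 : κ .k1 = 1 - κ .k0 - 2 * alpha κ - κ .kinf - ∑ k, κ (.th k) := by
      linear_combination e5
    rw [e6]
    generalize ∑ k, q k * p k = Sg
    generalize ∑ k, κ (.th k) = Th
    simp only [spinH]
    field_simp
    ring
  · rw [siteSum_of_ne s (fun b => pairE (siteTh κ) (siteE s q) (siteY κ s q p) (some (some i)) b) j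
      (by simpa using hij)]
    have h1 : s j - s i ≠ 0 := sub_ne_zero.2 (hs.2 j i (Ne.symm hij))
    have h3 : s i - s j = -(s j - s i) := by ring
    simp only [siteDE, Pi.single_eq_of_ne hij, fieldQ, if_neg hij, gaugeRho, pairE, siteE, siteY,
      siteTh, siteIdx, spinC, siteU, spinH, coeffR]
    rw [h3]
    generalize ∑ k, q k * p k = Sg
    field_simp
    ring

theorem site_fieldP (hs : s ∈ config N) (i j : Fin N) :
    siteDY s (Pi.single j 1) q (fun i => fieldQ κ s q p i j) p (fun i => fieldP κ s q p i j)
        (some (some i)) =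
      ∑ b, siteW (siteU s) (siteDU (Pi.single j 1)) (some (some i)) b *
          pairY (siteTh κ) (siteE s q) (siteY κ s q p) (some (some i)) b
        - gaugeRho κ s q p j * siteY κ s q p (some (some i)) + gaugeC κ s q p j := by
  have hj0 := (hs.1 j).1
  have hj1 : s j - 1 ≠ 0 := sub_ne_zero.2 (hs.1 j).2
  have hi0 := (hs.1 i).1
  by_cases hij : i = j
  · subst hij
    rw [siteSum_self s (fun b => pairY (siteTh κ) (siteE s q) (siteY κ s q p) (some (some i)) b)]
    have e3 : ∑ k ∈ Finset.univ.erase i, 1 / (s i - s k) *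
          pairY (siteTh κ) (siteE s q) (siteY κ s q p) (some (some i)) (some (some k)) =
        s i * p i ^ 2 * ∑ k ∈ Finset.univ.erase i, q k / s k
        + p i ^ 2 / (s i - 1) *
          ∑ k ∈ Finset.univ.erase i, coeffS s i k * q k
        - s i * p i / (s i - 1) * ∑ k ∈ Finset.univ.erase i, spinH κ q p k
        + p i / (s i - 1) *
          ∑ k ∈ Finset.univ.erase i, coeffR s i k * spinH κ q p k
        + 1 / (s i - 1) * ∑ k ∈ Finset.univ.erase i, coeffR s k i * spinF κ q p k := by
      simp only [Finset.mul_sum, ← Finset.sum_sub_distrib, ← Finset.sum_add_distrib]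
      refine Finset.sum_congr rfl fun k hk => ?_
      have hki := Finset.ne_of_mem_erase hk
      have h1 : s i - s k ≠ 0 := sub_ne_zero.2 (hs.2 i k hki.symm)
      have hk0 := (hs.1 k).1
      have h3 : s k - s i = -(s i - s k) := by ring
      simp only [pairY, siteE, siteY, siteTh, siteIdx, spinH, spinF, coeffS, coeffR]
      rw [h3]
      field_simp
      ring
    have e4 : ∑ k, q k / s k = q i / s i + ∑ k ∈ Finset.univ.erase i, q k / s k :=
      (Finset.add_sum_erase _ _ (Finset.mem_univ i)).symm
    have e5 := two_mul_alpha κ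
    rw [e3, sum_spinH_erase]
    simp only [siteDY, Pi.single_eq_same, fieldP, if_true, gaugeRho, gaugeC, pairE, pairY, siteE,
      siteY, siteTh, siteIdx, spinC, spinD, e4]
    generalize ∑ k ∈ Finset.univ.erase i, q k / s k = S4
    generalize ∑ k ∈ Finset.univ.erase i, coeffS s i k * q k = S1
    generalize ∑ k ∈ Finset.univ.erase i, coeffR s i k * spinH κ q p k = S2
    generalize ∑ k ∈ Finset.univ.erase i, coeffR s k i * spinF κ q p k = S6
    have e6 : κ .k1 = 1 - κ .k0 - 2 * alpha κ - κ .kinf - ∑ k, κ (.th k) := by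
      linear_combination e5
    rw [e6]
    generalize ∑ k, q k * p k = Sg
    generalize ∑ k, κ (.th k) = Th
    simp only [spinH]
    field_simp
    ring
  · rw [siteSum_of_ne s (fun b => pairY (siteTh κ) (siteE s q) (siteY κ s q p) (some (some i)) b) j
      (by simpa using hij)]
    have h1 : s j - s i ≠ 0 := sub_ne_zero.2 (hs.2 j i (Ne.symm hij))
    have h3 : s i - s j = -(s j - s i) := by ring
    simp only [siteDY, Pi.single_eq_of_ne hij, fieldP, if_neg hij, gaugeRho, gaugeC, pairE, pairY,
      siteE, siteY, siteTh, siteIdx, spinC, siteU, spinH, spinF, coeffR, coeffS]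
    rw [h3]
    generalize ∑ k, q k * p k = Sg
    field_simp
    ring

end Basis


theorem sum_univ_eq_add_erase (f : Fin N → ℂ) (j : Fin N) :
    ∑ i, f i = f j + ∑ i ∈ Finset.univ.erase j, f i :=
  (Finset.add_sum_erase _ _ (Finset.mem_univ j)).symm

theorem siteE_sum (s q : Fin N → ℂ) : ∑ a, siteE s q a = 0 := by
  simp [Fintype.sum_option, siteE]

/-- The sites `s_i` are the direct computation above. The gauge `ρ` is chosen to keep `e_1 = -1` and
`c` to keep `y_0 = 0`, which settles two of the four equations at 0 and 1. The other two follow from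
the conservation of `∑ e_a = 0` and of `∑ e_a y_a = -α`. -/
theorem site_field_basis (κ : Param N) {s : Fin N → ℂ} (q p : Fin N → ℂ) (hs : s ∈ config N)
    (j : Fin N) (a : Site N) :
    siteDE s (Pi.single j 1) q (fun i => fieldQ κ s q p i j) a =
        ∑ b, siteW (siteU s) (siteDU (Pi.single j 1)) a b *
          pairE (siteTh κ) (siteE s q) (siteY κ s q p) a b + gaugeRho κ s q p j * siteE s q a ∧
      siteDY s (Pi.single j 1) q (fun i => fieldQ κ s q p i j) p (fun i => fieldP κ s q p i j) a =
        ∑ b, siteW (siteU s) (siteDU (Pi.single j 1)) a b *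
          pairY (siteTh κ) (siteE s q) (siteY κ s q p) a b
          - gaugeRho κ s q p j * siteY κ s q p a + gaugeC κ s q p j := by
  have hE := fun i => site_fieldQ κ q p hs i j
  have hY := fun i => site_fieldP κ q p hs i j
  set θ := siteTh κ
  set e := siteE s q with he
  set y := siteY κ s q p with hy
  set DE := siteDE s (Pi.single j 1) q fun i => fieldQ κ s q p i j with hDE
  set DY := siteDY s (Pi.single j 1) q (fun i => fieldQ κ s q p i j) p
        fun i => fieldP κ s q p i j with hDY
  have hE' : ∀ i ∈ Finset.univ.erase j, DE (some (some i)) =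
      1 / (s j - s i) * pairE θ e y (some (some i)) (some (some j))
        + gaugeRho κ s q p j * e (some (some i)) := by
    intro i hi
    have hij := Finset.ne_of_mem_erase hi
    rw [hE i, siteSum_of_ne s (pairE θ e y (some (some i))) j (by simpa using hij)]
    rfl
  have hY' : ∀ i ∈ Finset.univ.erase j, DY (some (some i)) =
      1 / (s j - s i) * pairY θ e y (some (some i)) (some (some j))
        - gaugeRho κ s q p j * y (some (some i)) + gaugeC κ s q p j := by
    intro i hi
    have hij := Finset.ne_of_mem_erase hi
    rw [hY i, siteSum_of_ne s (pairY θ e y (some (some i))) j (by simpa using hij)]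
    rfl
  have hEj := hE j
  have hYj := hY j
  rw [siteSum_self s (pairE θ e y (some (some j)))] at hEj
  rw [siteSum_self s (pairY θ e y (some (some j)))] at hYj
  have he0 : e none = 1 - ∑ i, e (some (some i)) := rfl
  have he1 : e (some none) = -1 := rfl
  have hy0 : y none = 0 := rfl
  have hρ : gaugeRho κ s q p j =
    1 / (s j - 1) * pairE θ e y (some none) (some (some j)) := rfl
  have hc : gaugeC κ s q p j = -(1 / s j * pairY θ e y none (some (some j))) := rfl
  rcases a with _ | _ | i
  · rw [siteSum_of_ne s (pairE θ e y none) j (by simp),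
      siteSum_of_ne s (pairY θ e y none) j (by simp)]
    constructor
    · have h0 : DE none = -∑ i, DE (some (some i)) := rfl
      rw [h0, sum_univ_eq_add_erase _ j, hEj, Finset.sum_congr rfl hE', Finset.sum_add_distrib,
        ← Finset.mul_sum]
      rw [he0, sum_univ_eq_add_erase _ j]
      have hcancel : ∑ k ∈ Finset.univ.erase j, 1 / (s j - s k) *
            pairE θ e y (some (some j)) (some (some k)) =
          -∑ i ∈ Finset.univ.erase j, 1 / (s j - s i) *
            pairE θ e y (some (some i)) (some (some j)) := by
        rw [← Finset.sum_neg_distrib]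
        exact Finset.sum_congr rfl fun k _ => by rw [pairE_antisymm]; ring
      rw [hcancel, pairE_antisymm θ e y (some (some j)) none,
        pairE_antisymm θ e y (some (some j)) (some none)]
      simp only [siteU, sub_zero]
      rw [hρ]
      ring
    · have h0 : DY none = 0 := rfl
      rw [h0, hy0, hc]
      simp only [siteU, sub_zero]
      ring
  · rw [siteSum_of_ne s (pairE θ e y (some none)) j (by simp),
      siteSum_of_ne s (pairY θ e y (some none)) j (by simp)]
    constructor
    · have h0 : DE (some none) = 0 := rfl
      rw [h0, he1, hρ]
      simp only [siteU]
      ring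
    · have h0 : DY (some none) = ∑ i, (DE (some (some i)) * y (some (some i))
          + e (some (some i)) * DY (some (some i))) := by
        simp only [hDY, hDE, hy, he, siteDY, siteDE, siteY, siteE]
        refine Finset.sum_congr rfl fun i _ => ?_
        have := (hs.1 i).1
        field_simp
        ring
      rw [h0, sum_univ_eq_add_erase _ j, Finset.sum_congr rfl fun i hi => by
        rw [hE' i hi, hY' i hi, show (1 / (s j - s i) * pairE θ e y (some (some i)) (some (some j))
          + gaugeRho κ s q p j * e (some (some i))) * y (some (some i)) + e (some (some i)) *
          (1 / (s j - s i) * pairY θ e y (some (some i)) (some (some j))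
          - gaugeRho κ s q p j * y (some (some i)) + gaugeC κ s q p j) =
          gaugeC κ s q p j * e (some (some i)) + 1 / (s j - s i) *
            (pairE θ e y (some (some i)) (some (some j)) * y (some (some i))
            + pairY θ e y (some (some i)) (some (some j)) * e (some (some i))) by ring],
        Finset.sum_add_distrib, ← Finset.mul_sum, hEj, hYj]
      have hcancel : y (some (some j)) * ∑ k ∈ Finset.univ.erase j, 1 / (s j - s k) *
            pairE θ e y (some (some j)) (some (some k)) + e (some (some j)) *
            ∑ k ∈ Finset.univ.erase j, 1 / (s j - s k) *
              pairY θ e y (some (some j)) (some (some k)) =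
          -∑ i ∈ Finset.univ.erase j, 1 / (s j - s i) *
            (pairE θ e y (some (some i)) (some (some j)) * y (some (some i))
            + pairY θ e y (some (some i)) (some (some j)) * e (some (some i))) := by
        rw [← Finset.sum_neg_distrib, Finset.mul_sum, Finset.mul_sum, ← Finset.sum_add_distrib]
        refine Finset.sum_congr rfl fun k _ => ?_
        linear_combination 1 / (s j - s k) * pair_moment θ e y (some (some j)) (some (some k))
      have hsum : ∑ i ∈ Finset.univ.erase j, e (some (some i)) =
          1 - e none - e (some (some j)) := by
        rw [he0, sum_univ_eq_add_erase _ j]; ring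
      rw [hsum]
      have m0 := pair_moment θ e y (some (some j)) none
      have m1 := pair_moment θ e y (some (some j)) (some none)
      rw [hy0] at m0
      rw [he1] at m1
      simp only [siteU]
      rw [hρ, hc]
      linear_combination hcancel + 1 / s j * m0 + 1 / (s j - 1) * m1
  · exact ⟨hE i, hY i⟩

theorem siteFlow_basis (κ : Param N) {s : Fin N → ℂ} (q p : Fin N → ℂ) (hs : s ∈ config N)
    (j : Fin N) :
    SiteFlow (siteTh κ) (siteU s) (siteDU (Pi.single j 1)) (siteE s q) (siteY κ s q p)
      (siteDE s (Pi.single j 1) q fun i => fieldQ κ s q p i j)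
      (siteDY s (Pi.single j 1) q (fun i => fieldQ κ s q p i j) p
        fun i => fieldP κ s q p i j) :=
  ⟨_, _, site_field_basis κ q p hs j⟩

/-- The sum is the derivative of `y_1 = α + ∑ q_k p_k`, and the deformation equation at the site 1
involves only the pair formed with `s_j`. -/
theorem sum_field_mul (κ : Param N) {s : Fin N → ℂ} (q p : Fin N → ℂ) (hs : s ∈ config N)
    (j : Fin N) :
    ∑ i, (fieldQ κ s q p i j * p i + q i * fieldP κ s q p i j) =
      (-q j * spinD κ q p + s j * spinF κ q p j) / (s j * (s j - 1)) := by
  have h := (site_field_basis κ q p hs j (some none)).2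
  rw [siteSum_of_ne s (pairY (siteTh κ) (siteE s q) (siteY κ s q p) (some none)) j
    (by simp)] at h
  have h0 : siteDY s (Pi.single j 1) q (fun i => fieldQ κ s q p i j) p
      (fun i => fieldP κ s q p i j) (some none) =
      ∑ i, (fieldQ κ s q p i j * p i + q i * fieldP κ s q p i j) := rfl
  rw [← h0, h]
  have hj0 := (hs.1 j).1
  have hj1 : s j - 1 ≠ 0 := sub_ne_zero.2 (hs.1 j).2
  simp only [gaugeRho, gaugeC, pairE, pairY, siteE, siteY, siteTh, siteIdx, siteU, spinD, spinF]
  generalize ∑ k, q k * p k = Sg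
  field_simp
  ring

/-- The weights are linear in the velocities of the poles, so the flows of the single `s_j`
superpose, and their gauge parameters with them. -/
theorem SiteFlow.sum {ι : Type*} (t : Finset ι) {θ u e y : Site N → ℂ}
    {du de dy : ι → Site N → ℂ} (c : ι → ℂ)
    (h : ∀ j ∈ t, SiteFlow θ u (du j) e y (de j) (dy j)) :
    SiteFlow θ u (fun a => ∑ j ∈ t, c j * du j a) e y (fun a => ∑ j ∈ t, c j * de j a)
      (fun a => ∑ j ∈ t, c j * dy j a) := by
  choose! ρ k h using h
  refine ⟨∑ j ∈ t, c j * ρ j, ∑ j ∈ t, c j * k j, fun a => ?_⟩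
  have hw : ∀ b, siteW u (fun a => ∑ j ∈ t, c j * du j a) a b =
      ∑ j ∈ t, c j * siteW u (du j) a b := by
    intro b
    simp only [siteW]
    rw [← Finset.sum_sub_distrib, Finset.sum_div]
    exact Finset.sum_congr rfl fun j _ => by ring
  simp only [hw, Finset.sum_mul]
  constructor
  · rw [Finset.sum_comm, ← Finset.sum_add_distrib]
    refine Finset.sum_congr rfl fun j hj => ?_
    rw [(h j hj a).1, mul_add, Finset.mul_sum]
    congr 1
    · exact Finset.sum_congr rfl fun b _ => by ring
    · ring
  · rw [Finset.sum_comm, ← Finset.sum_sub_distrib, ← Finset.sum_add_distrib]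
    refine Finset.sum_congr rfl fun j hj => ?_
    rw [(h j hj a).2, mul_add, mul_sub, Finset.mul_sum]
    congr 1
    congr 1
    · exact Finset.sum_congr rfl fun b _ => by ring
    · ring

/-- A solution of the Garnier system solves the deformation equations. -/
theorem siteFlow_field (κ : Param N) {s : Fin N → ℂ} (q p ds : Fin N → ℂ) (hs : s ∈ config N) :
    SiteFlow (siteTh κ) (siteU s) (siteDU ds) (siteE s q) (siteY κ s q p)
      (siteDE s ds q fun i => ∑ j, ds j * fieldQ κ s q p i j)
      (siteDY s ds q (fun i => ∑ j, ds j * fieldQ κ s q p i j) p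
        fun i => ∑ j, ds j * fieldP κ s q p i j) := by
  have H := SiteFlow.sum Finset.univ ds fun j _ => siteFlow_basis κ q p hs j
  have hds : ∀ i, ds i = ∑ j, ds j * (Pi.single j (1 : ℂ) : Fin N → ℂ) i := by
    intro i; simp [Pi.single_apply]
  have hE : ∀ i, (∑ j, ds j * fieldQ κ s q p i j) / s i - q i * ds i / s i ^ 2 =
      ∑ j, ds j * (fieldQ κ s q p i j / s i
        - q i * (Pi.single j (1 : ℂ) : Fin N → ℂ) i / s i ^ 2) := by
    intro i
    conv_lhs => rw [hds i]
    rw [Finset.sum_div, Finset.mul_sum, Finset.sum_div, ← Finset.sum_sub_distrib]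
    exact Finset.sum_congr rfl fun j _ => by ring
  convert H using 1
  · funext a
    rcases a with _ | _ | i
    · simp [siteDU]
    · simp [siteDU]
    · exact hds i
  · funext a
    rcases a with _ | _ | i
    · simp only [siteDE, hE]
      rw [Finset.sum_comm, ← Finset.sum_neg_distrib]
      exact Finset.sum_congr rfl fun j _ => by rw [mul_neg, Finset.mul_sum]
    · simp [siteDE]
    · exact hE i
  · funext a
    rcases a with _ | _ | i
    · simp [siteDY]
    · simp only [siteDY, Finset.mul_sum]
      rw [Finset.sum_comm]
      refine Finset.sum_congr rfl fun i _ => ?_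
      rw [Finset.sum_mul, ← Finset.sum_add_distrib]
      exact Finset.sum_congr rfl fun j _ => by ring
    · simp only [siteDY]
      conv_lhs => rw [hds i]
      rw [Finset.sum_mul, Finset.mul_sum, ← Finset.sum_add_distrib]
      exact Finset.sum_congr rfl fun j _ => by ring

/-- The deformation equations in the normalized gauge are the Garnier system. -/
theorem field_of_siteFlow (κ : Param N) {s q p ds dq dp : Fin N → ℂ} (hs : s ∈ config N)
    {de dy : Site N → ℂ}
    (h : SiteFlow (siteTh κ) (siteU s) (siteDU ds) (siteE s q) (siteY κ s q p) de dy)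
    (h1 : de (some none) = 0) (h0 : dy none = 0)
    (hde : ∀ i, de (some (some i)) = siteDE s ds q dq (some (some i)))
    (hdy : ∀ i, dy (some (some i)) = siteDY s ds q dq p dp (some (some i)))
    (i : Fin N) :
    dq i = ∑ j, ds j * fieldQ κ s q p i j ∧ dp i = ∑ j, ds j * fieldP κ s q p i j := by
  obtain ⟨ρ, c, H⟩ := h
  obtain ⟨ρ', c', H'⟩ := siteFlow_field κ q p ds hs
  -- The normalizations `e_1 = -1` and `y_0 = 0` leave no gauge freedom: they force the gauge
  -- parameters of the given flow to be those of the Garnier flow.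
  have hρ : ρ = ρ' := by
    have e1 := (H (some none)).1
    have e2 := (H' (some none)).1
    have he1 : siteE s q (some none) = -1 := rfl
    rw [h1, he1] at e1
    rw [he1] at e2
    simp only [siteDE] at e2
    linear_combination e1 - e2
  have hc : c = c' := by
    have e1 := (H none).2
    have e2 := (H' none).2
    have hy0 : siteY κ s q p none = 0 := rfl
    rw [h0, hy0] at e1
    rw [hy0] at e2
    simp only [siteDY] at e2
    linear_combination e2 - e1
  have hi0 := (hs.1 i).1
  have hq := (H (some (some i))).1
  rw [hρ, ← (H' (some (some i))).1, hde i] at hq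
  have hp := (H (some (some i))).2
  rw [hρ, hc, ← (H' (some (some i))).2, hdy i] at hp
  simp only [siteDE, siteDY] at hq hp
  constructor
  · field_simp at hq
    exact mul_left_cancel₀ hi0 (by linear_combination hq)
  · exact mul_left_cancel₀ hi0 (by linear_combination hp)

/-! ### Symmetries of the deformation equations -/

theorem SiteFlow.relabel {θ u du e y de dy : Site N → ℂ} (h : SiteFlow θ u du e y de dy)
    (π : Equiv.Perm (Site N)) :
    SiteFlow (θ ∘ π) (u ∘ π) (du ∘ π) (e ∘ π) (y ∘ π) (de ∘ π) (dy ∘ π) := by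
  obtain ⟨ρ, c, h⟩ := h
  refine ⟨ρ, c, fun a => ?_⟩
  have := h (π a)
  constructor
  · rw [Function.comp_apply, this.1, ← Equiv.sum_comp π]; rfl
  · rw [Function.comp_apply, this.2, ← Equiv.sum_comp π]; rfl

/-- A dilation of the positions adds the same constant `dl / l` to all weights of distinct sites.
Since `∑ e_a = 0`, the sum of `pairE` over `b` is a multiple of `e_a` and that of `pairY` is affine
in `y_a` with the matching slope, so the extra terms are an infinitesimal gauge transformation. -/
theorem SiteFlow.affine {θ u du e y de dy : Site N → ℂ} (h : SiteFlow θ u du e y de dy)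
    (hu : Function.Injective u) (he : ∑ a, e a = 0) {l : ℂ} (hl : l ≠ 0) (m dl dm : ℂ) :
    SiteFlow θ (fun a => l * u a + m) (fun a => dl * u a + l * du a + dm) e y de dy := by
  obtain ⟨ρ, c, h⟩ := h
  have hw : ∀ a b, a ≠ b → siteW (fun a => l * u a + m) (fun a => dl * u a + l * du a + dm) a b =
      siteW u du a b + dl / l := by
    intro a b hab
    have h1 : u a - u b ≠ 0 := sub_ne_zero.2 (hu.ne hab)
    simp only [siteW]
    rw [show l * u a + m - (l * u b + m) = l * (u a - u b) by ring]
    field_simp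
    ring
  refine ⟨ρ - dl / l * (2 * ∑ b, e b * y b - ∑ b, θ b),
    c - dl / l * (∑ b, e b * y b ^ 2 - ∑ b, θ b * y b), fun a => ?_⟩
  have hwE : ∀ b, siteW (fun a => l * u a + m) (fun a => dl * u a + l * du a + dm) a b *
      pairE θ e y a b = siteW u du a b * pairE θ e y a b + dl / l * pairE θ e y a b := by
    intro b
    by_cases hab : a = b
    · subst hab; simp [pairE]
    · rw [hw a b hab]; ring
  have hwY : ∀ b, siteW (fun a => l * u a + m) (fun a => dl * u a + l * du a + dm) a b *
      pairY θ e y a b = siteW u du a b * pairY θ e y a b + dl / l * pairY θ e y a b := by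
    intro b
    by_cases hab : a = b
    · subst hab; simp [pairY]
    · rw [hw a b hab]; ring
  have sE : ∑ b, pairE θ e y a b =
      -2 * e a * y a * ∑ b, e b + 2 * e a * ∑ b, e b * y b + θ a * ∑ b, e b
        - e a * ∑ b, θ b := by
    simp only [Finset.mul_sum, ← Finset.sum_sub_distrib, ← Finset.sum_add_distrib]
    exact Finset.sum_congr rfl fun b _ => by simp only [pairE]; ring
  have sY : ∑ b, pairY θ e y a b =
      y a ^ 2 * ∑ b, e b - 2 * y a * ∑ b, e b * y b + ∑ b, e b * y b ^ 2
        + y a * ∑ b, θ b - ∑ b, θ b * y b := by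
    simp only [Finset.mul_sum, ← Finset.sum_sub_distrib, ← Finset.sum_add_distrib]
    exact Finset.sum_congr rfl fun b _ => by simp only [pairY]; ring
  rw [he] at sE sY
  constructor
  · simp only [hwE]
    rw [Finset.sum_add_distrib, ← Finset.mul_sum, sE, (h a).1]
    ring
  · simp only [hwY]
    rw [Finset.sum_add_distrib, ← Finset.mul_sum, sY, (h a).2]
    ring

/-- Translation of `η`, the finite form of the gauge parameter `c`: the interactions depend on
differences of slopes only. `SiteFlow.scale` is the finite form of `ρ`. -/
theorem SiteFlow.shift {θ u du e y de dy : Site N → ℂ} (h : SiteFlow θ u du e y de dy)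
    (k dk : ℂ) : SiteFlow θ u du e (fun a => y a - k) de (fun a => dy a - dk) := by
  obtain ⟨ρ, c, h⟩ := h
  refine ⟨ρ, c - ρ * k - dk, fun a => ?_⟩
  have hE : ∀ b, pairE θ e (fun a => y a - k) a b = pairE θ e y a b := by
    intro b; simp only [pairE]; ring
  have hY : ∀ b, pairY θ e (fun a => y a - k) a b = pairY θ e y a b := by
    intro b; simp only [pairY]; ring
  simp only [hE, hY]
  refine ⟨(h a).1, ?_⟩
  rw [(h a).2]
  ring

theorem SiteFlow.scale {θ u du e y de dy : Site N → ℂ} (h : SiteFlow θ u du e y de dy)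
    {l : ℂ} (hl : l ≠ 0) (dl : ℂ) :
    SiteFlow θ u du (fun a => l * e a) (fun a => y a / l) (fun a => dl * e a + l * de a)
      (fun a => dy a / l - dl * y a / l ^ 2) := by
  obtain ⟨ρ, c, h⟩ := h
  refine ⟨ρ + dl / l, c / l, fun a => ?_⟩
  have hE : ∀ b, siteW u du a b * pairE θ (fun a => l * e a) (fun a => y a / l) a b =
      l * (siteW u du a b * pairE θ e y a b) := by
    intro b; simp only [pairE]; field_simp
  have hY : ∀ b, siteW u du a b * pairY θ (fun a => l * e a) (fun a => y a / l) a b =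
      1 / l * (siteW u du a b * pairY θ e y a b) := by
    intro b; simp only [pairY]; field_simp
  simp only [hE, hY, ← Finset.mul_sum]
  rw [(h a).1, (h a).2]
  constructor
  · field_simp; ring
  · field_simp; ring

/-- The change of sign of the parameter at a site. -/
theorem SiteFlow.reflect {θ u du e y de dy : Site N → ℂ} (h : SiteFlow θ u du e y de dy)
    (d : Site N) (hd : e d ≠ 0) :
    SiteFlow (Function.update θ d (-θ d)) u du e (Function.update y d (y d - θ d / e d)) de
      (Function.update dy d (dy d + θ d * de d / e d ^ 2)) := by
  obtain ⟨ρ, c, h⟩ := h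
  refine ⟨ρ, c, fun a => ?_⟩
  -- The reflection exchanges the two roots `y_d` and `y_d - θ_d / e_d` of the quadratic `f_d` and
  -- leaves `f_d` itself unchanged, so every bracket is the same.
  have hE : ∀ b, pairE (Function.update θ d (-θ d)) e (Function.update y d (y d - θ d / e d)) a b =
      pairE θ e y a b := by
    intro b
    simp only [pairE]
    by_cases ha : a = d <;> by_cases hb : b = d
    · subst ha; subst hb; simp
    · subst ha
      rw [Function.update_self, Function.update_self, Function.update_of_ne hb,
        Function.update_of_ne hb]
      field_simp
      ring
    · subst hb
      rw [Function.update_self, Function.update_self, Function.update_of_ne ha,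
        Function.update_of_ne ha]
      field_simp
      ring
    · rw [Function.update_of_ne ha, Function.update_of_ne ha, Function.update_of_ne hb,
        Function.update_of_ne hb]
  simp only [hE]
  refine ⟨(h a).1, ?_⟩
  by_cases ha : a = d
  · subst ha
    rw [Function.update_self, Function.update_self, (h a).1, (h a).2]
    have hY : ∀ b, siteW u du a b * pairY (Function.update θ a (-θ a)) e
        (Function.update y a (y a - θ a / e a)) a b =
        siteW u du a b * pairY θ e y a b
          + θ a / e a ^ 2 * (siteW u du a b * pairE θ e y a b) := by
      intro b
      by_cases hb : b = a
      · subst hb; simp [pairY, pairE]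
      · simp only [pairY, pairE]
        rw [Function.update_self, Function.update_of_ne hb, Function.update_of_ne hb]
        field_simp
        ring
    simp only [hY]
    rw [Finset.sum_add_distrib, ← Finset.mul_sum]
    field_simp
    ring
  · rw [Function.update_of_ne ha, Function.update_of_ne ha, (h a).2]
    congr 2
    refine Finset.sum_congr rfl fun b _ => ?_
    congr 1
    simp only [pairY]
    rw [Function.update_of_ne ha]
    by_cases hb : b = d
    · subst hb
      rw [Function.update_self, Function.update_self]
      field_simp
      ring
    · rw [Function.update_of_ne hb, Function.update_of_ne hb]


/-! ### Algebraic functions -/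

/-- Restriction of polynomials to a set of points. -/
def evalOn (U : Set (Fin N → ℂ)) : MvPolynomial (Fin N) ℂ →+* (U → ℂ) :=
  RingHom.pi fun s => MvPolynomial.eval (s : Fin N → ℂ)

/-- Algebraicity becomes that of an element of the algebra of all functions on `U` over the
polynomial ring, where closure under sums and products is known. -/
theorem isAlgebraicFunction_iff {U : Set (Fin N → ℂ)} {f : (Fin N → ℂ) → ℂ} :
    IsAlgebraicFunction U f ↔
      letI := (evalOn U).toAlgebra
      IsAlgebraic (MvPolynomial (Fin N) ℂ) (fun s : U => f s) := by
  let _ := (evalOn U).toAlgebra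
  have key : ∀ (F : Polynomial (MvPolynomial (Fin N) ℂ)) (s : U),
      (Polynomial.aeval (fun s : U => f s) F) s =
        (F.map (MvPolynomial.eval (s : Fin N → ℂ))).eval (f s) := by
    intro F s
    have := Polynomial.hom_eval₂ F (evalOn U) (Pi.evalRingHom (fun _ : U => ℂ) s)
      (fun s : U => f s)
    rw [Polynomial.eval_map]
    exact this
  constructor
  · rintro ⟨F, hF, h⟩
    exact ⟨F, hF, funext fun s => by rw [key]; exact h s s.2⟩
  · rintro ⟨F, hF, h⟩
    refine ⟨F, hF, fun s hs => ?_⟩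
    rw [← key F ⟨s, hs⟩, h]; rfl

namespace IsAlgebraicFunction

variable {U : Set (Fin N → ℂ)} {f g : (Fin N → ℂ) → ℂ}

theorem congr (hf : IsAlgebraicFunction U f) (h : ∀ s ∈ U, g s = f s) :
    IsAlgebraicFunction U g := by
  obtain ⟨F, hF, hr⟩ := hf
  exact ⟨F, hF, fun s hs => by rw [h s hs]; exact hr s hs⟩

theorem mono {V : Set (Fin N → ℂ)} (hf : IsAlgebraicFunction U f) (h : V ⊆ U) :
    IsAlgebraicFunction V f := by
  obtain ⟨F, hF, hr⟩ := hf
  exact ⟨F, hF, fun s hs => hr s (h hs)⟩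

theorem add (hf : IsAlgebraicFunction U f) (hg : IsAlgebraicFunction U g) :
    IsAlgebraicFunction U (fun s => f s + g s) := by
  let _ := (evalOn U).toAlgebra
  rw [isAlgebraicFunction_iff] at *
  exact IsAlgebraic.add hf hg

theorem mul (hf : IsAlgebraicFunction U f) (hg : IsAlgebraicFunction U g) :
    IsAlgebraicFunction U (fun s => f s * g s) := by
  let _ := (evalOn U).toAlgebra
  rw [isAlgebraicFunction_iff] at *
  exact IsAlgebraic.mul hf hg

theorem neg (hf : IsAlgebraicFunction U f) : IsAlgebraicFunction U (fun s => -f s) := by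
  let _ := (evalOn U).toAlgebra
  rw [isAlgebraicFunction_iff] at *
  exact IsAlgebraic.neg hf

theorem sub (hf : IsAlgebraicFunction U f) (hg : IsAlgebraicFunction U g) :
    IsAlgebraicFunction U (fun s => f s - g s) := by
  simpa only [sub_eq_add_neg] using hf.add hg.neg

theorem of_polynomial (F : MvPolynomial (Fin N) ℂ) :
    IsAlgebraicFunction U (fun s => MvPolynomial.eval s F) :=
  ⟨Polynomial.X - Polynomial.C F, Polynomial.X_sub_C_ne_zero F, fun s _ => by simp⟩

theorem const (c : ℂ) : IsAlgebraicFunction U (fun _ => c) :=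
  (of_polynomial (MvPolynomial.C c)).congr fun s _ => by simp

theorem coord (i : Fin N) : IsAlgebraicFunction U (fun s => s i) :=
  (of_polynomial (MvPolynomial.X i)).congr fun s _ => by simp

theorem inv (hf : IsAlgebraicFunction U f) : IsAlgebraicFunction U (fun s => (f s)⁻¹) := by
  obtain ⟨F, hF, hr⟩ := hf
  -- The reversed polynomial annihilates the inverse where `f` is nonzero; the factor `X` covers the
  -- zeros of `f`, where the inverse is 0 by convention.
  refine ⟨Polynomial.X * F.reverse, mul_ne_zero Polynomial.X_ne_zero (by simpa using hF),
    fun s hs => ?_⟩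
  rw [Polynomial.map_mul, Polynomial.eval_mul, Polynomial.map_X, Polynomial.eval_X]
  by_cases h0 : f s = 0
  · simp [h0]
  · have h1 := hr s hs
    rw [Polynomial.eval_map] at h1 ⊢
    let _ := invertibleOfNonzero h0
    have := (Polynomial.eval₂_reverse_eq_zero_iff (MvPolynomial.eval s) (f s) F).2 h1
    rw [invOf_eq_inv] at this
    rw [this, mul_zero]

theorem div (hf : IsAlgebraicFunction U f) (hg : IsAlgebraicFunction U g) :
    IsAlgebraicFunction U (fun s => f s / g s) := by
  simpa only [div_eq_mul_inv] using hf.mul hg.inv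

theorem sum {ι : Type*} (t : Finset ι) {F : ι → (Fin N → ℂ) → ℂ}
    (h : ∀ k ∈ t, IsAlgebraicFunction U (F k)) :
    IsAlgebraicFunction U (fun s => ∑ k ∈ t, F k s) := by
  classical
  induction t using Finset.induction_on with
  | empty => simpa using const (U := U) 0
  | insert a t ha ih =>
    simp only [Finset.sum_insert ha]
    exact (h a (by simp)).add (ih fun k hk => h k (by simp [hk]))

theorem ite (P : Prop) [Decidable P] (hf : P → IsAlgebraicFunction U f)
    (hg : ¬P → IsAlgebraicFunction U g) :
    IsAlgebraicFunction U (fun s => if P then f s else g s) := by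
  by_cases h : P
  · simpa [h] using hf h
  · simpa [h] using hg h

end IsAlgebraicFunction

theorem mvPolynomial_eq_zero_of_isOpen {U : Set (Fin N → ℂ)} (hU : IsOpen U) (hne : U.Nonempty)
    (F : MvPolynomial (Fin N) ℂ) (h : ∀ s ∈ U, MvPolynomial.eval s F = 0) : F = 0 := by
  obtain ⟨s, hs⟩ := hne
  obtain ⟨ε, hε, hb⟩ := Metric.isOpen_iff.1 hU s hs
  refine MvPolynomial.funext_set (fun i => Metric.ball (s i) ε) (fun i => ?_) fun x hx => ?_
  · exact infinite_of_mem_nhds (s i) (Metric.ball_mem_nhds _ hε)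
  · rw [map_zero]
    apply h
    apply hb
    rw [← ball_pi _ hε] at *
    exact hx

/-- Substituting fractions with the common denominator `D` gives a polynomial after multiplication
by a power of `D`. -/
theorem exists_polynomial_subst (A : Fin N → MvPolynomial (Fin N) ℂ) (D : MvPolynomial (Fin N) ℂ)
    (G : MvPolynomial (Fin N) ℂ) :
    ∃ (n : ℕ) (G' : MvPolynomial (Fin N) ℂ), ∀ s, MvPolynomial.eval s D ≠ 0 →
      MvPolynomial.eval s G' = MvPolynomial.eval s D ^ n *
        MvPolynomial.eval (fun i => MvPolynomial.eval s (A i) / MvPolynomial.eval s D) G := by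
  induction G using MvPolynomial.induction_on with
  | C a => exact ⟨0, MvPolynomial.C a, by simp⟩
  | add P Q hP hQ =>
    obtain ⟨n, P', hP⟩ := hP
    obtain ⟨m, Q', hQ⟩ := hQ
    refine ⟨n + m, D ^ m * P' + D ^ n * Q', fun s hs => ?_⟩
    simp only [map_add, map_mul, map_pow, hP s hs, hQ s hs]
    ring
  | mul_X P i hP =>
    obtain ⟨n, P', hP⟩ := hP
    refine ⟨n + 1, P' * A i, fun s hs => ?_⟩
    simp only [map_mul, hP s hs, MvPolynomial.eval_X]
    field_simp
    ring

theorem exists_polynomial_map_subst (A : Fin N → MvPolynomial (Fin N) ℂ)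
    (D : MvPolynomial (Fin N) ℂ) (F : Polynomial (MvPolynomial (Fin N) ℂ)) :
    ∃ (n : ℕ) (F' : Polynomial (MvPolynomial (Fin N) ℂ)), ∀ s, MvPolynomial.eval s D ≠ 0 →
      F'.map (MvPolynomial.eval s) = Polynomial.C (MvPolynomial.eval s D ^ n) *
        F.map (MvPolynomial.eval
          fun i => MvPolynomial.eval s (A i) / MvPolynomial.eval s D) := by
  induction F using Polynomial.induction_on' with
  | add P Q hP hQ =>
    obtain ⟨n, P', hP⟩ := hP
    obtain ⟨m, Q', hQ⟩ := hQ
    refine ⟨n + m, Polynomial.C (D ^ m) * P' + Polynomial.C (D ^ n) * Q', fun s hs => ?_⟩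
    rw [Polynomial.map_add, Polynomial.map_mul, Polynomial.map_mul, Polynomial.map_C,
      Polynomial.map_C, hP s hs, hQ s hs, Polynomial.map_add]
    simp only [map_pow]
    ring
  | monomial k G =>
    obtain ⟨n, G', hG⟩ := exists_polynomial_subst A D G
    refine ⟨n, Polynomial.monomial k G', fun s hs => ?_⟩
    rw [Polynomial.map_monomial, Polynomial.map_monomial, hG s hs, Polynomial.C_mul_monomial]

/-- Algebraic functions remain algebraic under a birational change of the variables. -/
theorem IsAlgebraicFunction.comp {U U' : Set (Fin N → ℂ)} {f : (Fin N → ℂ) → ℂ}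
    (hf : IsAlgebraicFunction U f) (hU : IsOpen U) (hne : U.Nonempty)
    {φ : (Fin N → ℂ) → Fin N → ℂ} (A : Fin N → MvPolynomial (Fin N) ℂ)
    (D : MvPolynomial (Fin N) ℂ) (hD : ∀ s ∈ U', MvPolynomial.eval s D ≠ 0)
    (hφ : ∀ s ∈ U', ∀ i, φ s i = MvPolynomial.eval s (A i) / MvPolynomial.eval s D)
    (hmap : ∀ s ∈ U', φ s ∈ U) (hsurj : ∀ s ∈ U, ∃ s' ∈ U', φ s' = s) :
    IsAlgebraicFunction U' (fun s => f (φ s)) := by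
  obtain ⟨F, hF, hr⟩ := hf
  obtain ⟨n, F', h⟩ := exists_polynomial_map_subst A D F
  have h' : ∀ s ∈ U', F'.map (MvPolynomial.eval s) =
      Polynomial.C (MvPolynomial.eval s D ^ n) * F.map (MvPolynomial.eval (φ s)) := by
    intro s hs
    rw [h s (hD s hs)]
    congr 3
    exact (funext (hφ s hs)).symm
  refine ⟨F', fun h0 => hF ?_, fun s hs => ?_⟩
  -- If the new polynomial were zero, each coefficient of `F` would vanish at all points of `U`,
  -- because `φ` maps `U'` onto `U`; a polynomial that vanishes on a nonempty open set is zero.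
  · ext1 k
    refine mvPolynomial_eq_zero_of_isOpen hU hne _ fun s hs => ?_
    obtain ⟨s', hs', rfl⟩ := hsurj s hs
    have h1 := congrArg (fun P => P.coeff k) (h' s' hs')
    rw [h0] at h1
    simp only [Polynomial.map_zero, Polynomial.coeff_zero, Polynomial.coeff_C_mul,
      Polynomial.coeff_map] at h1
    rcases mul_eq_zero.1 h1.symm with h2 | h2
    · exact absurd h2 (pow_ne_zero n (hD s' hs'))
    · exact h2
  · rw [h' s hs, Polynomial.eval_mul, hr _ (hmap s hs), mul_zero]


/-! ### The flow along curves, in the coordinates of the sites -/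

/-- Along the curve `(γ, q, p)`, at the parameter value `x`, the point `(q, p)` moves by the flow
of the Garnier system. -/
def FlowAt (κ : Param N) (γ q p : ℂ → Fin N → ℂ) (x : ℂ) : Prop :=
  ∃ ds : Fin N → ℂ, (∀ i, HasDerivAt (fun z => γ z i) (ds i) x) ∧
    (∀ i, HasDerivAt (fun z => q z i) (∑ j, ds j * fieldQ κ (γ x) (q x) (p x) i j) x) ∧
    ∀ i, HasDerivAt (fun z => p z i) (∑ j, ds j * fieldP κ (γ x) (q x) (p x) i j) x

theorem FlowAt.congr {κ : Param N} {γ q p γ' q' p' : ℂ → Fin N → ℂ} {x : ℂ}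
    (h : FlowAt κ γ q p x) (hγ : γ' =ᶠ[𝓝 x] γ) (hq : q' =ᶠ[𝓝 x] q) (hp : p' =ᶠ[𝓝 x] p) :
    FlowAt κ γ' q' p' x := by
  obtain ⟨ds, h1, h2, h3⟩ := h
  refine ⟨ds, fun i => (h1 i).congr_of_eventuallyEq ?_, fun i => ?_, fun i => ?_⟩
  · filter_upwards [hγ] with z hz; rw [hz]
  · rw [hγ.eq_of_nhds, hq.eq_of_nhds, hp.eq_of_nhds]
    refine (h2 i).congr_of_eventuallyEq ?_
    filter_upwards [hq] with z hz; rw [hz]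
  · rw [hγ.eq_of_nhds, hq.eq_of_nhds, hp.eq_of_nhds]
    refine (h3 i).congr_of_eventuallyEq ?_
    filter_upwards [hp] with z hz; rw [hz]

theorem isOpen_config : IsOpen (config N) := by
  have : config N = (⋂ i, {s | s i ≠ 0 ∧ s i ≠ 1}) ∩
      ⋂ i, ⋂ j, {s : Fin N → ℂ | i ≠ j → s i ≠ s j} := by
    ext s; simp [config]
  rw [this]
  refine IsOpen.inter (isOpen_iInter_of_finite fun i => ?_)
    (isOpen_iInter_of_finite fun i => isOpen_iInter_of_finite fun j => ?_)
  · exact (isOpen_ne.preimage (continuous_apply i)).inter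
      (isOpen_ne.preimage (continuous_apply i))
  · by_cases h : i = j
    · simp [h]
    · simpa [h] using isOpen_ne_fun (continuous_apply i) (continuous_apply j)

theorem FlowAt.continuousAt {κ : Param N} {γ q p : ℂ → Fin N → ℂ} {x : ℂ}
    (h : FlowAt κ γ q p x) : ContinuousAt γ x ∧ ContinuousAt q x ∧ ContinuousAt p x := by
  obtain ⟨ds, h1, h2, h3⟩ := h
  exact ⟨continuousAt_pi.2 fun i => (h1 i).continuousAt,
    continuousAt_pi.2 fun i => (h2 i).continuousAt, continuousAt_pi.2 fun i => (h3 i).continuousAt⟩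

theorem FlowAt.eventually_config {κ : Param N} {γ q p : ℂ → Fin N → ℂ} {x : ℂ}
    (h : FlowAt κ γ q p x) (hs : γ x ∈ config N) : ∀ᶠ z in 𝓝 x, γ z ∈ config N :=
  h.continuousAt.1.eventually (isOpen_config.mem_nhds hs)

theorem hasDerivAt_siteU {γ : ℂ → Fin N → ℂ} {ds : Fin N → ℂ} {x : ℂ}
    (h : ∀ i, HasDerivAt (fun z => γ z i) (ds i) x) (a : Site N) :
    HasDerivAt (fun z => siteU (γ z) a) (siteDU ds a) x := by
  rcases a with _ | _ | i
  · exact hasDerivAt_const x 0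
  · exact hasDerivAt_const x 1
  · exact h i

theorem hasDerivAt_siteE {γ q : ℂ → Fin N → ℂ} {ds dq : Fin N → ℂ} {x : ℂ}
    (h : ∀ i, HasDerivAt (fun z => γ z i) (ds i) x)
    (hq : ∀ i, HasDerivAt (fun z => q z i) (dq i) x) (hs : ∀ i, γ x i ≠ 0) (a : Site N) :
    HasDerivAt (fun z => siteE (γ z) (q z) a) (siteDE (γ x) ds (q x) dq a) x := by
  have hi : ∀ i, HasDerivAt (fun z => q z i / γ z i)
      (dq i / γ x i - q x i * ds i / γ x i ^ 2) x := by
    intro i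
    have h0 := hs i
    refine ((hq i).fun_div (h i) h0).congr_deriv ?_
    field_simp
  rcases a with _ | _ | i
  · exact (HasDerivAt.fun_sum fun i _ => hi i).const_sub 1
  · exact hasDerivAt_const x (-1)
  · exact hi i

theorem hasDerivAt_siteY (κ : Param N) {γ q p : ℂ → Fin N → ℂ} {ds dq dp : Fin N → ℂ} {x : ℂ}
    (h : ∀ i, HasDerivAt (fun z => γ z i) (ds i) x)
    (hq : ∀ i, HasDerivAt (fun z => q z i) (dq i) x)
    (hp : ∀ i, HasDerivAt (fun z => p z i) (dp i) x) (a : Site N) :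
    HasDerivAt (fun z => siteY κ (γ z) (q z) (p z) a)
      (siteDY (γ x) ds (q x) dq (p x) dp a) x := by
  rcases a with _ | _ | i
  · exact hasDerivAt_const x 0
  · exact (HasDerivAt.fun_sum fun i _ => (hq i).fun_mul (hp i)).const_add (alpha κ)
  · exact (h i).fun_mul (hp i)

theorem FlowAt.sites {κ : Param N} {γ q p : ℂ → Fin N → ℂ} {x : ℂ}
    (h : FlowAt κ γ q p x) (hs : γ x ∈ config N) :
    ∃ du de dy : Site N → ℂ, (∀ a, HasDerivAt (fun z => siteU (γ z) a) (du a) x) ∧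
      (∀ a, HasDerivAt (fun z => siteE (γ z) (q z) a) (de a) x) ∧
      (∀ a, HasDerivAt (fun z => siteY κ (γ z) (q z) (p z) a) (dy a) x) ∧
      SiteFlow (siteTh κ) (siteU (γ x)) du (siteE (γ x) (q x)) (siteY κ (γ x) (q x) (p x))
        de dy := by
  obtain ⟨ds, h1, h2, h3⟩ := h
  exact ⟨_, _, _, hasDerivAt_siteU h1, hasDerivAt_siteE h1 h2 fun i => (hs.1 i).1,
    hasDerivAt_siteY κ h1 h2 h3, siteFlow_field κ (q x) (p x) ds hs⟩

/-- To show that a transformation preserves the system it thus suffices to express the new site data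
near `x` through the old ones and to transform `SiteFlow`. The derivatives of `q` and `p` are
recovered from `q_i = s_i e_i` and `p_i = y_i / s_i`. -/
theorem FlowAt.of_sites {κ : Param N} {γ q p : ℂ → Fin N → ℂ} {x : ℂ} (hs : γ x ∈ config N)
    {u e y : ℂ → Site N → ℂ} {du de dy : Site N → ℂ}
    (hu : ∀ᶠ z in 𝓝 x, siteU (γ z) = u z) (he : ∀ᶠ z in 𝓝 x, siteE (γ z) (q z) = e z)
    (hy : ∀ᶠ z in 𝓝 x, siteY κ (γ z) (q z) (p z) = y z)
    (hdu : ∀ a, HasDerivAt (fun z => u z a) (du a) x)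
    (hde : ∀ a, HasDerivAt (fun z => e z a) (de a) x)
    (hdy : ∀ a, HasDerivAt (fun z => y z a) (dy a) x)
    (hflow : SiteFlow (siteTh κ) (u x) du (e x) (y x) de dy) : FlowAt κ γ q p x := by
  have hdu' : ∀ a, HasDerivAt (fun z => siteU (γ z) a) (du a) x := fun a =>
    (hdu a).congr_of_eventuallyEq (by filter_upwards [hu] with z hz; rw [hz])
  have hde' : ∀ a, HasDerivAt (fun z => siteE (γ z) (q z) a) (de a) x := fun a =>
    (hde a).congr_of_eventuallyEq (by filter_upwards [he] with z hz; rw [hz])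
  have hdy' : ∀ a, HasDerivAt (fun z => siteY κ (γ z) (q z) (p z) a) (dy a) x := fun a =>
    (hdy a).congr_of_eventuallyEq (by filter_upwards [hy] with z hz; rw [hz])
  rw [← hu.self_of_nhds, ← he.self_of_nhds, ← hy.self_of_nhds] at hflow
  set ds : Fin N → ℂ := fun i => du (some (some i)) with hds
  have h1 : ∀ i, HasDerivAt (fun z => γ z i) (ds i) x := fun i => hdu' (some (some i))
  have hne : ∀ᶠ z in 𝓝 x, γ z ∈ config N :=
    (continuousAt_pi.2 fun i => (h1 i).continuousAt).eventually (isOpen_config.mem_nhds hs)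
  have hq : ∀ i, HasDerivAt (fun z => q z i)
      (ds i * (q x i / γ x i) + γ x i * de (some (some i))) x := by
    intro i
    have := (h1 i).fun_mul (hde' (some (some i)))
    refine this.congr_of_eventuallyEq ?_
    filter_upwards [hne] with z hz
    have := (hz.1 i).1
    simp only [siteE]
    field_simp
  have hp : ∀ i, HasDerivAt (fun z => p z i)
      ((dy (some (some i)) * γ x i - γ x i * p x i * ds i) / γ x i ^ 2) x := by
    intro i
    have := (hdy' (some (some i))).fun_div (h1 i) (hs.1 i).1
    refine this.congr_of_eventuallyEq ?_
    filter_upwards [hne] with z hz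
    have := (hz.1 i).1
    simp only [siteY]
    field_simp
  have hdu0 : du = siteDU ds := by
    funext a
    rcases a with _ | _ | i
    · exact (hdu' none).unique (hasDerivAt_const x 0)
    · exact (hdu' (some none)).unique (hasDerivAt_const x 1)
    · rfl
  rw [hdu0] at hflow
  have key := field_of_siteFlow κ hs hflow
    (dq := fun i => ds i * (q x i / γ x i) + γ x i * de (some (some i)))
    (dp := fun i => (dy (some (some i)) * γ x i - γ x i * p x i * ds i) / γ x i ^ 2)
    ((hde' (some none)).unique (hasDerivAt_const x (-1)))
    ((hdy' none).unique (hasDerivAt_const x 0))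
    (fun i => by
      have := (hs.1 i).1
      simp only [siteDE]; field_simp; ring)
    (fun i => by
      have := (hs.1 i).1
      simp only [siteDY]; field_simp; ring)
  refine ⟨ds, h1, fun i => ?_, fun i => ?_⟩
  · rw [← (key i).1]; exact hq i
  · rw [← (key i).2]; exact hp i

theorem siteU_injective {s : Fin N → ℂ} (hs : s ∈ config N) : Function.Injective (siteU s) := by
  rintro (_ | _ | i) (_ | _ | j) h
  · rfl
  · exact absurd h zero_ne_one
  · exact absurd h.symm (hs.1 j).1
  · exact absurd h one_ne_zero
  · rfl
  · exact absurd h.symm (hs.1 j).2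
  · exact absurd h (hs.1 i).1
  · exact absurd h (hs.1 i).2
  · by_cases hij : i = j
    · rw [hij]
    · exact absurd h (hs.2 i j hij)

theorem mem_config_of_injective {s : Fin N → ℂ} (h : Function.Injective (siteU s)) :
    s ∈ config N :=
  ⟨fun i => ⟨fun h0 => by simpa using @h (some (some i)) none h0,
    fun h1 => by simpa using @h (some (some i)) (some none) h1⟩,
    fun i j hij h0 => hij (by simpa using @h (some (some i)) (some (some j)) h0)⟩

/-! ### Permutations and changes of sign of the parameter -/

/-- The parameter labels as an iterated option type. -/
def idxEquiv (N : ℕ) : Idx N ≃ Option (Option (Option (Fin N))) where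
  toFun
    | .k0 => none
    | .k1 => some none
    | .kinf => some (some none)
    | .th i => some (some (some i))
  invFun
    | none => .k0
    | some none => .k1
    | some (some none) => .kinf
    | some (some (some i)) => .th i
  left_inv a := by cases a <;> rfl
  right_inv a := by rcases a with _ | _ | _ | i <;> rfl

instance : Fintype (Idx N) := Fintype.ofEquiv _ (idxEquiv N).symm

theorem sum_idx (f : Idx N → ℂ) :
    ∑ a, f a = f .k0 + f .k1 + f .kinf + ∑ i, f (.th i) := by
  rw [← Equiv.sum_comp (idxEquiv N).symm f, Fintype.sum_option, Fintype.sum_option,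
    Fintype.sum_option]
  simp only [idxEquiv, Equiv.coe_fn_symm_mk]
  ring

theorem alpha_eq (κ : Param N) : alpha κ = -(1 / 2) * (∑ a, κ a - 1) := by
  rw [sum_idx]; rfl

theorem alpha_perm (κ : Param N) (π : Equiv.Perm (Idx N)) :
    alpha (fun a => κ (π a)) = alpha κ := by
  rw [alpha_eq, alpha_eq, Equiv.sum_comp π κ]

theorem alpha_update_neg (κ : Param N) (a : Idx N) :
    alpha (Function.update κ a (-κ a)) = alpha κ + κ a := by
  rw [alpha_eq, alpha_eq]
  have h1 := Finset.add_sum_erase Finset.univ κ (Finset.mem_univ a)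
  have h2 := Finset.add_sum_erase Finset.univ (Function.update κ a (-κ a)) (Finset.mem_univ a)
  rw [Finset.sum_congr rfl fun b hb => Function.update_of_ne (Finset.ne_of_mem_erase hb) _ _,
    Function.update_self] at h2
  rw [← h1, ← h2]
  ring

theorem siteIdx_injective : Function.Injective (siteIdx (N := N)) := by
  rintro (_ | _ | i) (_ | _ | j) h <;> simp [siteIdx] at h ⊢
  exact h

theorem siteTh_swap (κ : Param N) (a b : Site N) :
    siteTh (fun c => κ (Equiv.swap (siteIdx a) (siteIdx b) c)) = siteTh κ ∘ Equiv.swap a b := by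
  funext c
  simp only [siteTh, Function.comp_apply]
  rw [siteIdx_injective.swap_apply]

theorem siteTh_update (κ : Param N) (a : Site N) (v : ℂ) :
    siteTh (Function.update κ (siteIdx a) v) = Function.update (siteTh κ) a v := by
  funext c
  simp only [siteTh]
  by_cases h : c = a
  · subst h; simp
  · rw [Function.update_of_ne h, Function.update_of_ne (siteIdx_injective.ne h)]
    rfl

/-! ### The exchange of `κ₀` and `θ_m` -/

/-- On the `z`-plane the transformation is `z ↦ (z - s_m) / (1 - s_m)`, which fixes 1 and moves
`s_m` to 0. -/
theorem sigma_siteU (κ : Param N) (m : Fin N) {x : Pt N} (hs : x.s ∈ config N) (a : Site N) :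
    siteU ((Gen.sigma m).act κ x).s a =
      1 / (1 - x.s m) * siteU x.s (Equiv.swap none (some (some m)) a)
        + -x.s m / (1 - x.s m) := by
  have h1 : 1 - x.s m ≠ 0 := sub_ne_zero.2 (Ne.symm (hs.1 m).2)
  have h2 : x.s m - 1 = -(1 - x.s m) := by ring
  rcases a with _ | _ | i
  · rw [Equiv.swap_apply_left]
    simp only [siteU]
    field_simp
    ring
  · rw [Equiv.swap_apply_of_ne_of_ne (by simp) (by simp)]
    simp only [siteU]
    field_simp
    ring
  · by_cases hi : i = m
    · subst hi
      rw [Equiv.swap_apply_right]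
      simp only [siteU, Gen.act, if_true, h2]
      field_simp
      ring
    · rw [Equiv.swap_apply_of_ne_of_ne (by simp) (by simpa using hi)]
      simp only [siteU, Gen.act, if_neg hi, h2]
      field_simp
      ring

theorem sigma_q_div_s (κ : Param N) (m : Fin N) {x : Pt N} (hs : x.s ∈ config N) (i : Fin N) :
    ((Gen.sigma m).act κ x).q i / ((Gen.sigma m).act κ x).s i =
      if i = m then 1 - x.gs else x.q i / x.s i := by
  have h1 : x.s m - 1 ≠ 0 := sub_ne_zero.2 (hs.1 m).2
  have h0 := (hs.1 m).1
  have hi0 := (hs.1 i).1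
  by_cases hi : i = m
  · simp only [Gen.act, hi, if_true]
    field_simp
  · have h3 : x.s m - x.s i ≠ 0 := sub_ne_zero.2 (hs.2 m i (Ne.symm hi))
    simp only [Gen.act, if_neg hi, coeffR]
    field_simp

theorem sigma_siteE (κ : Param N) (m : Fin N) {x : Pt N} (hs : x.s ∈ config N) (a : Site N) :
    siteE ((Gen.sigma m).act κ x).s ((Gen.sigma m).act κ x).q a =
      siteE x.s x.q (Equiv.swap none (some (some m)) a) := by
  have hq := sigma_q_div_s κ m hs
  rcases a with _ | _ | i
  · rw [Equiv.swap_apply_left]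
    simp only [siteE]
    rw [sum_univ_eq_add_erase _ m, hq m, if_pos rfl, Finset.sum_congr rfl fun i hi => by
      rw [hq i, if_neg (Finset.ne_of_mem_erase hi)], Pt.gs, sum_univ_eq_add_erase _ m]
    ring
  · rw [Equiv.swap_apply_of_ne_of_ne (by simp) (by simp)]
    rfl
  · by_cases hi : i = m
    · subst hi
      rw [Equiv.swap_apply_right]
      simp only [siteE]
      rw [hq i, if_pos rfl]; rfl
    · rw [Equiv.swap_apply_of_ne_of_ne (by simp) (by simpa using hi)]
      simp only [siteE]
      rw [hq i, if_neg hi]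

/-- The subtracted `s_m p_m` is the slope at the pole that moves to 0, so the normalization `y_0 =
0` is restored. The symmetry of `α` under permutations of the parameter enters at the site 1. -/
theorem sigma_siteY (κ : Param N) (m : Fin N) {x : Pt N} (hs : x.s ∈ config N) (a : Site N) :
    siteY ((Gen.sigma m).param κ) ((Gen.sigma m).act κ x).s ((Gen.sigma m).act κ x).q
        ((Gen.sigma m).act κ x).p a =
      siteY κ x.s x.q x.p (Equiv.swap none (some (some m)) a) - x.s m * x.p m := by
  have h1 : x.s m - 1 ≠ 0 := sub_ne_zero.2 (hs.1 m).2
  have hsp : ∀ i, ((Gen.sigma m).act κ x).s i * ((Gen.sigma m).act κ x).p i =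
      (if i = m then 0 else x.s i * x.p i) - x.s m * x.p m := by
    intro i
    by_cases hi : i = m
    · simp only [Gen.act, hi, if_true]
      field_simp
      ring
    · have h3 : x.s m - x.s i ≠ 0 := sub_ne_zero.2 (hs.2 m i (Ne.symm hi))
      have hi0 := (hs.1 i).1
      simp only [Gen.act, if_neg hi, coeffR]
      field_simp
  rcases a with _ | _ | i
  · rw [Equiv.swap_apply_left]
    simp only [siteY]
    ring
  · rw [Equiv.swap_apply_of_ne_of_ne (by simp) (by simp)]
    simp only [siteY]
    have hα : alpha ((Gen.sigma m).param κ) = alpha κ := alpha_perm κ _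
    have hqp : ∀ i, ((Gen.sigma m).act κ x).q i * ((Gen.sigma m).act κ x).p i =
        (if i = m then 1 - x.gs else x.q i / x.s i) *
          ((if i = m then 0 else x.s i * x.p i) - x.s m * x.p m) := by
      intro i
      rw [← hsp i, ← sigma_q_div_s κ m hs i]
      have hS : ((Gen.sigma m).act κ x).s i ≠ 0 := by
        by_cases hi : i = m
        · simp only [Gen.act, hi, if_true]
          exact div_ne_zero (hs.1 m).1 h1
        · simp only [Gen.act, if_neg hi]
          exact div_ne_zero (sub_ne_zero.2 (hs.2 m i (Ne.symm hi))) h1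
      field_simp
    rw [hα, Finset.sum_congr rfl fun i _ => hqp i, sum_univ_eq_add_erase _ m, if_pos rfl,
      if_pos rfl, Finset.sum_congr (g := fun i => x.q i * x.p i - x.s m * x.p m *
        (x.q i / x.s i)) rfl fun i hi => by
        rw [if_neg (Finset.ne_of_mem_erase hi), if_neg (Finset.ne_of_mem_erase hi)]
        have := (hs.1 i).1
        field_simp, Finset.sum_sub_distrib, ← Finset.mul_sum, Pt.gs,
      sum_univ_eq_add_erase (fun i => x.q i / x.s i) m,
      sum_univ_eq_add_erase (fun i => x.q i * x.p i) m]
    have := (hs.1 m).1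
    field_simp
    ring
  · by_cases hi : i = m
    · subst hi
      rw [Equiv.swap_apply_right]
      simp only [siteY]
      rw [hsp i, if_pos rfl]
    · rw [Equiv.swap_apply_of_ne_of_ne (by simp) (by simpa using hi)]
      simp only [siteY]
      rw [hsp i, if_neg hi]

theorem sigma_mem_config (κ : Param N) (m : Fin N) {x : Pt N} (hs : x.s ∈ config N) :
    ((Gen.sigma m).act κ x).s ∈ config N := by
  apply mem_config_of_injective
  intro a b hab
  rw [sigma_siteU κ m hs, sigma_siteU κ m hs] at hab
  have h1 : 1 - x.s m ≠ 0 := sub_ne_zero.2 (Ne.symm (hs.1 m).2)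
  apply (Equiv.swap none (some (some m))).injective
  apply siteU_injective hs
  field_simp at hab
  linear_combination hab

theorem FlowAt.sigma {κ : Param N} {γ q p : ℂ → Fin N → ℂ} {x : ℂ} (h : FlowAt κ γ q p x)
    (hs : γ x ∈ config N) (m : Fin N) :
    FlowAt ((Gen.sigma m).param κ) (fun z => ((Gen.sigma m).act κ ⟨q z, p z, γ z⟩).s)
      (fun z => ((Gen.sigma m).act κ ⟨q z, p z, γ z⟩).q)
      (fun z => ((Gen.sigma m).act κ ⟨q z, p z, γ z⟩).p) x := by
  have hev := h.eventually_config hs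
  obtain ⟨du, de, dy, hu, he, hy, hflow⟩ := h.sites hs
  have h1 : 1 - γ x m ≠ 0 := sub_ne_zero.2 (Ne.symm (hs.1 m).2)
  have hm : DifferentiableAt ℂ (fun z => γ z m) x := (hu (some (some m))).differentiableAt
  have hl : DifferentiableAt ℂ (fun z => 1 / (1 - γ z m)) x := by fun_prop (disch := assumption)
  have hμ : DifferentiableAt ℂ (fun z => -γ z m / (1 - γ z m)) x := by
    fun_prop (disch := assumption)
  set π : Equiv.Perm (Site N) := Equiv.swap none (some (some m))
  refine FlowAt.of_sites (sigma_mem_config κ m (x := ⟨q x, p x, γ x⟩) hs)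
    (u := fun z a => 1 / (1 - γ z m) * siteU (γ z) (π a) + -γ z m / (1 - γ z m))
    (e := fun z a => siteE (γ z) (q z) (π a))
    (y := fun z a => siteY κ (γ z) (q z) (p z) (π a) - γ z m * p z m)
    ?_ ?_ ?_ (fun a => (hl.hasDerivAt.fun_mul (hu (π a))).fun_add hμ.hasDerivAt) (fun a => he (π a))
    (fun a => (hy (π a)).fun_sub (hy (some (some m)))) ?_
  · filter_upwards [hev] with z hz
    exact funext (sigma_siteU κ m (x := ⟨q z, p z, γ z⟩) hz)
  · filter_upwards [hev] with z hz
    exact funext (sigma_siteE κ m (x := ⟨q z, p z, γ z⟩) hz)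
  · filter_upwards [hev] with z hz
    exact funext (sigma_siteY κ m (x := ⟨q z, p z, γ z⟩) hz)
  · have := ((hflow.relabel π).affine ((siteU_injective hs).comp π.injective)
      (by rw [← siteE_sum (γ x) (q x)]; exact Equiv.sum_comp π _)
      (one_div_ne_zero h1) (-γ x m / (1 - γ x m)) (deriv (fun z => 1 / (1 - γ z m)) x)
      (deriv (fun z => -γ z m / (1 - γ z m)) x)).shift (γ x m * p x m) (dy (some (some m)))
    rw [show siteTh ((Gen.sigma m).param κ) = siteTh κ ∘ π from siteTh_swap κ none (some (some m))]
    exact this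


/-! ### The changes of sign at the finite sites -/

/-- The function `k` translates the slopes back to `y_0 = 0`; it is nonzero only for the reflection
at the pole 0 itself. -/
theorem FlowAt.reflect_site {κ : Param N} {γ q p p' : ℂ → Fin N → ℂ} {x : ℂ}
    (h : FlowAt κ γ q p x) (hs : γ x ∈ config N) (d : Site N)
    (hd : siteE (γ x) (q x) d ≠ 0) {k : ℂ → ℂ} (hk : DifferentiableAt ℂ k x)
    (hy : ∀ᶠ z in 𝓝 x, ∀ a,
      siteY (Function.update κ (siteIdx d) (-κ (siteIdx d))) (γ z) (q z) (p' z) a =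
        Function.update (siteY κ (γ z) (q z) (p z)) d
          (siteY κ (γ z) (q z) (p z) d - siteTh κ d / siteE (γ z) (q z) d) a - k z) :
    FlowAt (Function.update κ (siteIdx d) (-κ (siteIdx d))) γ q p' x := by
  obtain ⟨du, de, dy, hu, he, hy', hflow⟩ := h.sites hs
  refine FlowAt.of_sites hs (Eventually.of_forall fun z => rfl)
    (Eventually.of_forall fun z => rfl) (hy.mono fun z hz => funext hz) hu he
    (dy := fun a => Function.update dy d
      (dy d + siteTh κ d * de d / siteE (γ x) (q x) d ^ 2) a - deriv k x) ?_ ?_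
  · intro a
    refine HasDerivAt.fun_sub ?_ hk.hasDerivAt
    by_cases ha : a = d
    · subst ha
      simp only [Function.update_self]
      refine ((hy' a).fun_sub ((hasDerivAt_const x (siteTh κ a)).fun_div (he a) hd)).congr_deriv ?_
      ring
    · simp only [Function.update_of_ne ha]
      exact hy' a
  · rw [siteTh_update]
    exact (hflow.reflect d hd).shift (k x) (deriv k x)

/-- At the site 1 one has `e_1 = -1`, so the exchange of roots adds `κ_∞` to `y_1`. This is exactly
the change of `α`, which is why `q` and `p` do not move. -/
theorem siteY_refl_kinf (κ : Param N) (x : Pt N) (a : Site N) :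
    siteY ((Gen.refl .kinf).param κ) x.s x.q x.p a =
      Function.update (siteY κ x.s x.q x.p) (some none) (siteY κ x.s x.q x.p (some none) -
        siteTh κ (some none) / siteE x.s x.q (some none)) a := by
  rcases a with _ | _ | i
  · simp [siteY]
  · simp only [Function.update_self, siteY, Gen.param, alpha_update_neg, siteTh, siteIdx, siteE]
    ring
  · simp [siteY]

theorem siteY_refl_th (κ : Param N) {x : Pt N} (hs : x.s ∈ config N) {j : Fin N}
    (hj : x.q j ≠ 0) (a : Site N) :
    siteY ((Gen.refl (.th j)).param κ) x.s x.q ((Gen.refl (.th j)).act κ x).p a =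
      Function.update (siteY κ x.s x.q x.p) (some (some j)) (siteY κ x.s x.q x.p (some (some j)) -
        siteTh κ (some (some j)) / siteE x.s x.q (some (some j))) a := by
  have hj0 := (hs.1 j).1
  rcases a with _ | _ | i
  · simp [siteY]
  · rw [Function.update_of_ne (by simp)]
    simp only [siteY, Gen.param, alpha_update_neg, Gen.act]
    rw [sum_univ_eq_add_erase _ j, sum_univ_eq_add_erase (fun i => x.q i * x.p i) j, if_pos rfl,
      Finset.sum_congr rfl fun i hi => by rw [if_neg (Finset.ne_of_mem_erase hi)]]
    field_simp
    ring
  · by_cases hi : i = j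
    · subst hi
      rw [Function.update_self]
      simp only [siteY, siteTh, siteIdx, siteE, Gen.act, if_true]
      field_simp
    · rw [Function.update_of_ne (by simpa using hi)]
      simp [siteY, Gen.act, hi]

theorem siteY_refl_k0 (κ : Param N) {x : Pt N} (hs : x.s ∈ config N)
    (hg : siteE x.s x.q none ≠ 0) (a : Site N) :
    siteY ((Gen.refl .k0).param κ) x.s x.q ((Gen.refl .k0).act κ x).p a =
      Function.update (siteY κ x.s x.q x.p) none (siteY κ x.s x.q x.p none -
        siteTh κ none / siteE x.s x.q none) a - -(κ .k0 / siteE x.s x.q none) := by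
  simp only [siteE] at hg
  have hgs : x.gs - 1 = -(1 - ∑ i, x.q i / x.s i) := by simp [Pt.gs]
  rcases a with _ | _ | i
  · simp [siteY, siteTh, siteIdx]
  · rw [Function.update_of_ne (by simp)]
    simp only [siteY, Gen.param, alpha_update_neg, siteE, Gen.act, hgs]
    have : ∀ i, x.q i * (x.p i - κ .k0 / (x.s i * -(1 - ∑ i, x.q i / x.s i))) =
        x.q i * x.p i + κ .k0 / (1 - ∑ i, x.q i / x.s i) * (x.q i / x.s i) := by
      intro i
      have := (hs.1 i).1
      field_simp
      ring
    simp only [this, Finset.sum_add_distrib, ← Finset.mul_sum]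
    field_simp
    ring
  · rw [Function.update_of_ne (by simp)]
    have := (hs.1 i).1
    simp only [siteY, siteE, Gen.act, hgs]
    field_simp

theorem FlowAt.refl_kinf {κ : Param N} {γ q p : ℂ → Fin N → ℂ} {x : ℂ}
    (h : FlowAt κ γ q p x) (hs : γ x ∈ config N) :
    FlowAt ((Gen.refl .kinf).param κ) γ q p x :=
  h.reflect_site hs (some none) (k := fun _ => 0) (by simp [siteE]) (by fun_prop)
    (Eventually.of_forall fun z a => by
      rw [sub_zero]; exact siteY_refl_kinf κ ⟨q z, p z, γ z⟩ a)

theorem FlowAt.refl_th {κ : Param N} {γ q p : ℂ → Fin N → ℂ} {x : ℂ}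
    (h : FlowAt κ γ q p x) (hs : γ x ∈ config N) (j : Fin N) (hj : q x j ≠ 0) :
    FlowAt ((Gen.refl (.th j)).param κ) γ q
      (fun z => ((Gen.refl (.th j)).act κ ⟨q z, p z, γ z⟩).p) x := by
  refine h.reflect_site hs (some (some j)) (k := fun _ => 0)
    (by simpa only [siteE] using div_ne_zero hj (hs.1 j).1) (by fun_prop) ?_
  have hq : ∀ᶠ z in 𝓝 x, q z j ≠ 0 :=
    ((continuousAt_pi.1 h.continuousAt.2.1) j).eventually_ne hj
  filter_upwards [h.eventually_config hs, hq] with z hz hqz a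
  rw [sub_zero]
  exact siteY_refl_th κ (x := ⟨q z, p z, γ z⟩) hz hqz a

theorem FlowAt.refl_k0 {κ : Param N} {γ q p : ℂ → Fin N → ℂ} {x : ℂ}
    (h : FlowAt κ γ q p x) (hs : γ x ∈ config N) (hg : 1 - ∑ i, q x i / γ x i ≠ 0) :
    FlowAt ((Gen.refl .k0).param κ) γ q
      (fun z => ((Gen.refl .k0).act κ ⟨q z, p z, γ z⟩).p) x := by
  obtain ⟨du, de, dy, hu, he, hy', hflow⟩ := h.sites hs
  have hg' : ∀ᶠ z in 𝓝 x, siteE (γ z) (q z) none ≠ 0 := (he none).continuousAt.eventually_ne hg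
  have hd := (he none).differentiableAt
  refine h.reflect_site hs none (k := fun z => -(κ .k0 / siteE (γ z) (q z) none)) hg
    (by fun_prop (disch := exact hg)) ?_
  filter_upwards [h.eventually_config hs, hg'] with z hz hqz a
  exact siteY_refl_k0 κ (x := ⟨q z, p z, γ z⟩) hz hqz a

/-! ### The exchange of `κ₀` and `κ_∞` -/

/-- The transformation that exchanges `κ₀` and `κ_∞`. -/
def swapAct (κ : Param N) (x : Pt N) : Pt N where
  q i := (1 - x.s i) * (x.q i / x.s i) / (x.gs - 1)
  p i := (x.gs - 1) * (x.s i * x.p i - (alpha κ + ∑ j, x.q j * x.p j)) / (1 - x.s i)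
  s i := 1 - x.s i

theorem swapAct_siteU (κ : Param N) (x : Pt N) (a : Site N) :
    siteU (swapAct κ x).s a = -1 * siteU x.s (Equiv.swap none (some none) a) + 1 := by
  rcases a with _ | _ | i
  · rw [Equiv.swap_apply_left]; simp [siteU]
  · rw [Equiv.swap_apply_right]; simp [siteU]
  · rw [Equiv.swap_apply_of_ne_of_ne (by simp) (by simp)]
    simp only [siteU, swapAct]; ring

theorem swapAct_mem_config (κ : Param N) {x : Pt N} (hs : x.s ∈ config N) :
    (swapAct κ x).s ∈ config N := by
  apply mem_config_of_injective
  intro a b hab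
  rw [swapAct_siteU, swapAct_siteU] at hab
  apply (Equiv.swap none (some none)).injective
  apply siteU_injective hs
  linear_combination -hab

/-- The map `z ↦ 1 - z` exchanges 0 and 1 and puts the entry `1 - g_s` at the site 1; the factor `-1
/ (1 - g_s)` normalizes it to -1 again. -/
theorem swapAct_siteE (κ : Param N) {x : Pt N} (hs : x.s ∈ config N) (hg : 1 - x.gs ≠ 0)
    (a : Site N) :
    siteE (swapAct κ x).s (swapAct κ x).q a =
      -1 / (1 - x.gs) * siteE x.s x.q (Equiv.swap none (some none) a) := by
  have hq : ∀ i, (swapAct κ x).q i / (swapAct κ x).s i = -1 / (1 - x.gs) * (x.q i / x.s i) := by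
    intro i
    have h1 : 1 - x.s i ≠ 0 := sub_ne_zero.2 (Ne.symm (hs.1 i).2)
    have h0 := (hs.1 i).1
    simp only [swapAct]
    rw [show x.gs - 1 = -(1 - x.gs) by ring]
    field_simp
  rcases a with _ | _ | i
  · rw [Equiv.swap_apply_left]
    simp only [siteE, hq, ← Finset.mul_sum]
    change 1 - -1 / (1 - x.gs) * x.gs = _
    field_simp
    ring
  · rw [Equiv.swap_apply_right]
    simp only [siteE]
    change -1 = -1 / (1 - x.gs) * (1 - x.gs)
    field_simp
  · rw [Equiv.swap_apply_of_ne_of_ne (by simp) (by simp)]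
    exact hq i

theorem swapAct_siteY (κ : Param N) {x : Pt N} (hs : x.s ∈ config N) (hg : 1 - x.gs ≠ 0)
    (a : Site N) :
    siteY (fun c => κ (Equiv.swap .k0 .kinf c)) (swapAct κ x).s (swapAct κ x).q
        (swapAct κ x).p a =
      (siteY κ x.s x.q x.p (Equiv.swap none (some none) a) - siteY κ x.s x.q x.p (some none)) /
        (-1 / (1 - x.gs)) := by
  have hg' : x.gs - 1 ≠ 0 := by intro h; apply hg; linear_combination -h
  rcases a with _ | _ | i
  · rw [Equiv.swap_apply_left]; simp [siteY]
  · rw [Equiv.swap_apply_right]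
    simp only [siteY]
    have hqp : ∀ i, (swapAct κ x).q i * (swapAct κ x).p i =
        x.q i * x.p i - (alpha κ + ∑ j, x.q j * x.p j) * (x.q i / x.s i) := by
      intro i
      have h1 : 1 - x.s i ≠ 0 := sub_ne_zero.2 (Ne.symm (hs.1 i).2)
      have h0 := (hs.1 i).1
      simp only [swapAct]
      field_simp
    simp only [hqp, Finset.sum_sub_distrib, ← Finset.mul_sum, alpha_perm]
    change alpha κ + (_ - _ * x.gs) = _
    field_simp
    ring
  · rw [Equiv.swap_apply_of_ne_of_ne (by simp) (by simp)]
    have h1 : 1 - x.s i ≠ 0 := sub_ne_zero.2 (Ne.symm (hs.1 i).2)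
    simp only [siteY, swapAct]
    field_simp
    ring

theorem FlowAt.swapAct {κ : Param N} {γ q p : ℂ → Fin N → ℂ} {x : ℂ} (h : FlowAt κ γ q p x)
    (hs : γ x ∈ config N) (hg : 1 - Pt.gs ⟨q x, p x, γ x⟩ ≠ 0) :
    FlowAt (fun c => κ (Equiv.swap .k0 .kinf c))
      (fun z => (Garnier.swapAct κ ⟨q z, p z, γ z⟩).s)
      (fun z => (Garnier.swapAct κ ⟨q z, p z, γ z⟩).q)
      (fun z => (Garnier.swapAct κ ⟨q z, p z, γ z⟩).p) x := by
  have hev := h.eventually_config hs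
  obtain ⟨du, de, dy, hu, he, hy, hflow⟩ := h.sites hs
  have hgz : ∀ᶠ z in 𝓝 x, 1 - Pt.gs ⟨q z, p z, γ z⟩ ≠ 0 :=
    (he none).continuousAt.eventually_ne hg
  have hd : DifferentiableAt ℂ (fun z => 1 - Pt.gs ⟨q z, p z, γ z⟩) x := (he none).differentiableAt
  have hl : DifferentiableAt ℂ (fun z => -1 / (1 - Pt.gs ⟨q z, p z, γ z⟩)) x :=
    (differentiableAt_const _).fun_div hd hg
  have hl0 : -1 / (1 - Pt.gs ⟨q x, p x, γ x⟩) ≠ 0 := div_ne_zero (by simp) hg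
  set π : Equiv.Perm (Site N) := Equiv.swap none (some none)
  refine FlowAt.of_sites (swapAct_mem_config κ (x := ⟨q x, p x, γ x⟩) hs)
    (u := fun z a => -1 * siteU (γ z) (π a) + 1)
    (e := fun z a => -1 / (1 - Pt.gs ⟨q z, p z, γ z⟩) * siteE (γ z) (q z) (π a))
    (y := fun z a => (siteY κ (γ z) (q z) (p z) (π a) - siteY κ (γ z) (q z) (p z) (some none)) /
      (-1 / (1 - Pt.gs ⟨q z, p z, γ z⟩)))
    ?_ ?_ ?_ (fun a => (((hu (π a)).const_mul (-1)).add_const 1).congr_deriv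
      (g' := 0 * siteU (γ x) (π a) + -1 * du (π a) + 0) (by ring))
    (fun a => hl.hasDerivAt.fun_mul (he (π a)))
    (fun a => (((hy (π a)).fun_sub (hy (some none))).fun_div hl.hasDerivAt hl0).congr_deriv
      (g' := (dy (π a) - dy (some none)) / (-1 / (1 - Pt.gs ⟨q x, p x, γ x⟩)) -
        deriv (fun z => -1 / (1 - Pt.gs ⟨q z, p z, γ z⟩)) x *
          (siteY κ (γ x) (q x) (p x) (π a) - siteY κ (γ x) (q x) (p x) (some none)) /
          (-1 / (1 - Pt.gs ⟨q x, p x, γ x⟩)) ^ 2) ?_) ?_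
  · filter_upwards [hev] with z hz
    exact funext (swapAct_siteU κ ⟨q z, p z, γ z⟩)
  · filter_upwards [hev, hgz] with z hz hgz
    exact funext (swapAct_siteE κ (x := ⟨q z, p z, γ z⟩) hz hgz)
  · filter_upwards [hev, hgz] with z hz hgz
    exact funext (swapAct_siteY κ (x := ⟨q z, p z, γ z⟩) hz hgz)
  · field_simp
  · have := (((hflow.relabel π).affine ((siteU_injective hs).comp π.injective)
      (by rw [← siteE_sum (γ x) (q x)]; exact Equiv.sum_comp π _)
      (l := -1) (by simp) 1 0 0).shift (siteY κ (γ x) (q x) (p x) (some none))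
        (dy (some none))).scale hl0 (deriv (fun z => -1 / (1 - Pt.gs ⟨q z, p z, γ z⟩)) x)
    rw [show siteTh (fun c => κ (Equiv.swap .k0 .kinf c)) = siteTh κ ∘ π from
      siteTh_swap κ none (some none)]
    exact this

/-! ### The exchange of `κ₀` and `κ₁` -/

theorem inv_mem_config {s : Fin N → ℂ} (hs : s ∈ config N) : (fun i => 1 / s i) ∈ config N := by
  refine ⟨fun i => ⟨one_div_ne_zero (hs.1 i).1, fun h => (hs.1 i).2 ?_⟩, fun i j hij h =>
    hs.2 i j hij ?_⟩
  · have := (hs.1 i).1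
    field_simp at h
    exact h.symm
  · simpa using h

section SigmaOne

variable (κ : Param N) {s : Fin N → ℂ} (q p : Fin N → ℂ)

/-- The inversion `z ↦ 1/z` moves the pole at infinity, so it is not an affine change of the finite
sites and is checked on the explicit field. The products `q_k p_k`, and with them `C`, `D` and
`h_k`, are invariant, and `f_k` picks up the factor `s_k`. -/
theorem spinC_sigmaOne (hs : s ∈ config N) :
    spinC (Gen.sigmaOne.param κ) (fun i => q i / s i) (fun i => s i * p i) = spinC κ q p ∧
    spinD (Gen.sigmaOne.param κ) (fun i => q i / s i) (fun i => s i * p i) = spinD κ q p ∧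
    (∀ k, spinH (Gen.sigmaOne.param κ) (fun i => q i / s i) (fun i => s i * p i) k =
      spinH κ q p k) ∧
    ∀ k, spinF (Gen.sigmaOne.param κ) (fun i => q i / s i) (fun i => s i * p i) k =
      s k * spinF κ q p k := by
  have h : ∀ k, q k / s k * (s k * p k) = q k * p k := fun k => by
    have := (hs.1 k).1
    field_simp
  have hα : alpha (Gen.sigmaOne.param κ) = alpha κ := alpha_perm κ _
  have hi : Gen.sigmaOne.param κ .kinf = κ .kinf := by
    simp only [Gen.param]; rw [Equiv.swap_apply_of_ne_of_ne (by simp) (by simp)]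
  have ht : ∀ k, Gen.sigmaOne.param κ (.th k) = κ (.th k) := fun k => by
    simp only [Gen.param]; rw [Equiv.swap_apply_of_ne_of_ne (by simp) (by simp)]
  refine ⟨?_, ?_, fun k => ?_, fun k => ?_⟩
  · simp only [spinC, h, hα, hi]
  · simp only [spinD, h, hα, hi]
  · simp only [spinH, ht]; rw [mul_assoc, h]; ring
  · simp only [spinF, ht, h]; ring

theorem coeff_inv (hs : s ∈ config N) {i j : Fin N} (hij : i ≠ j) :
    coeffR (fun i => 1 / s i) i j = coeffR s i j / s i ∧
      coeffS (fun i => 1 / s i) i j = coeffS s i j * s j / s i ^ 2 := by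
  have hi := (hs.1 i).1
  have hj := (hs.1 j).1
  have h1 : s j - s i ≠ 0 := sub_ne_zero.2 (hs.2 j i (Ne.symm hij))
  have h2 : s i - s j ≠ 0 := sub_ne_zero.2 (hs.2 i j hij)
  have e1 : 1 / s j - 1 / s i = -(s j - s i) / (s i * s j) := by field_simp; ring
  have e2 : 1 / s i - 1 / s j = -(s i - s j) / (s i * s j) := by field_simp; ring
  constructor
  · simp only [coeffR]
    rw [e1]
    field_simp
    ring
  · simp only [coeffS]
    rw [e2]
    field_simp
    ring

theorem field_sigmaOne (hs : s ∈ config N) (i j : Fin N) :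
    -(1 / s j ^ 2) * fieldQ (Gen.sigmaOne.param κ) (fun i => 1 / s i) (fun i => q i / s i)
        (fun i => s i * p i) i j =
      fieldQ κ s q p i j / s i - (if i = j then q i / s i ^ 2 else 0) ∧
    -(1 / s j ^ 2) * fieldP (Gen.sigmaOne.param κ) (fun i => 1 / s i) (fun i => q i / s i)
        (fun i => s i * p i) i j =
      s i * fieldP κ s q p i j + (if i = j then p i else 0) := by
  obtain ⟨hC, hD, hH, hF⟩ := spinC_sigmaOne κ q p hs
  have hi := (hs.1 i).1
  have hj := (hs.1 j).1
  have hj1 : s j - 1 ≠ 0 := sub_ne_zero.2 (hs.1 j).2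
  have ed : 1 / s j * (1 / s j - 1) = -(s j - 1) / s j ^ 2 := by field_simp; ring
  have h1 : Gen.sigmaOne.param κ .k1 = κ .k0 := by simp [Gen.param]
  have h0 : Gen.sigmaOne.param κ .k0 = κ .k1 := by simp [Gen.param]
  simp only [fieldQ, fieldP, hC, hD, hH, hF, h0, h1]
  rw [ed]
  by_cases hij : i = j
  · subst hij
    have s1 : ∑ k ∈ Finset.univ.erase i, coeffS (fun i => 1 / s i) i k * (q k / s k) =
        1 / s i ^ 2 * ∑ k ∈ Finset.univ.erase i, coeffS s i k * q k := by
      rw [Finset.mul_sum]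
      refine Finset.sum_congr rfl fun k hk => ?_
      have := (hs.1 k).1
      rw [(coeff_inv hs (Finset.ne_of_mem_erase hk).symm).2]
      field_simp
    have s2 : ∑ k ∈ Finset.univ.erase i, coeffR (fun i => 1 / s i) i k * spinH κ q p k =
        1 / s i * ∑ k ∈ Finset.univ.erase i, coeffR s i k * spinH κ q p k := by
      rw [Finset.mul_sum]
      refine Finset.sum_congr rfl fun k hk => ?_
      rw [(coeff_inv hs (Finset.ne_of_mem_erase hk).symm).1]
      field_simp
    have s3 : ∑ k ∈ Finset.univ.erase i, coeffR (fun i => 1 / s i) k i * (s k * spinF κ q p k) =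
        ∑ k ∈ Finset.univ.erase i, coeffR s k i * spinF κ q p k := by
      refine Finset.sum_congr rfl fun k hk => ?_
      have := (hs.1 k).1
      rw [(coeff_inv hs (Finset.ne_of_mem_erase hk)).1]
      field_simp
    simp only [if_true, s1, s2, s3]
    generalize ∑ k ∈ Finset.univ.erase i, coeffS s i k * q k = A
    generalize ∑ k ∈ Finset.univ.erase i, coeffR s i k * spinH κ q p k = B
    generalize ∑ k ∈ Finset.univ.erase i, coeffR s k i * spinF κ q p k = B'
    generalize spinC κ q p = C
    generalize spinD κ q p = D
    simp only [spinH]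
    constructor
    · field_simp
      ring
    · field_simp
      ring
  · simp only [if_neg hij, (coeff_inv hs hij).1, (coeff_inv hs (Ne.symm hij)).1,
      (coeff_inv hs (Ne.symm hij)).2]
    constructor
    · field_simp
      ring
    · field_simp
      ring

end SigmaOne

theorem FlowAt.sigmaOne {κ : Param N} {γ q p : ℂ → Fin N → ℂ} {x : ℂ} (h : FlowAt κ γ q p x)
    (hs : γ x ∈ config N) :
    FlowAt (Gen.sigmaOne.param κ) (fun z => (Gen.sigmaOne.act κ ⟨q z, p z, γ z⟩).s)
      (fun z => (Gen.sigmaOne.act κ ⟨q z, p z, γ z⟩).q)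
      (fun z => (Gen.sigmaOne.act κ ⟨q z, p z, γ z⟩).p) x := by
  obtain ⟨ds, h1, h2, h3⟩ := h
  refine ⟨fun j => ds j * -(1 / γ x j ^ 2), fun i => ?_, fun i => ?_, fun i => ?_⟩
  · refine ((hasDerivAt_const x 1).fun_div (h1 i) (hs.1 i).1).congr_deriv ?_
    ring
  · refine ((h2 i).fun_div (h1 i) (hs.1 i).1).congr_deriv ?_
    have : ∀ j, ds j * -(1 / γ x j ^ 2) * fieldQ (Gen.sigmaOne.param κ) (fun i => 1 / γ x i)
        (fun i => q x i / γ x i) (fun i => γ x i * p x i) i j =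
        ds j * fieldQ κ (γ x) (q x) (p x) i j / γ x i
          - (if i = j then ds j * (q x i / γ x i ^ 2) else 0) := by
      intro j
      rw [mul_assoc, (field_sigmaOne κ (q x) (p x) hs i j).1]
      split_ifs <;> ring
    refine Eq.trans ?_ (Finset.sum_congr rfl fun j _ => this j).symm
    rw [Finset.sum_sub_distrib, Finset.sum_ite_eq, if_pos (Finset.mem_univ i), ← Finset.sum_div]
    have := (hs.1 i).1
    field_simp
  · refine ((h1 i).fun_mul (h3 i)).congr_deriv ?_
    have : ∀ j, ds j * -(1 / γ x j ^ 2) * fieldP (Gen.sigmaOne.param κ) (fun i => 1 / γ x i)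
        (fun i => q x i / γ x i) (fun i => γ x i * p x i) i j =
        γ x i * (ds j * fieldP κ (γ x) (q x) (p x) i j)
          + (if i = j then ds j * p x i else 0) := by
      intro j
      rw [mul_assoc, (field_sigmaOne κ (q x) (p x) hs i j).2]
      split_ifs <;> ring
    refine Eq.trans ?_ (Finset.sum_congr rfl fun j _ => this j).symm
    rw [Finset.sum_add_distrib, Finset.sum_ite_eq, if_pos (Finset.mem_univ i), ← Finset.mul_sum]
    ring


/-! ### The transformation `R_τ` -/

section Tau

variable (κ : Param N) {x : Pt N}

theorem Pt.den_eq (x : Pt N) : x.den κ = spinD κ x.q x.p := rfl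

theorem tau_q (i : Fin N) : (Gen.tau.act κ x).q i = x.s i * spinF κ x.q x.p i / x.den κ := by
  simp only [Gen.act, spinF]; ring

theorem tau_mul (hs : x.s ∈ config N) (hr : Gen.tau.Regular κ x) (i : Fin N) :
    (Gen.tau.act κ x).q i * (Gen.tau.act κ x).p i = -(x.q i * x.p i) := by
  obtain ⟨hD, hb⟩ := hr
  have h0 := (hs.1 i).1
  have := hb i
  simp only [Gen.act]
  split_ifs at this ⊢ with h
  · rw [h]; field_simp; simp
  · have hb : x.q i * x.p i - κ (.th i) ≠ 0 := sub_ne_zero.2 this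
    generalize x.q i * x.p i - κ (.th i) = b at hb ⊢
    field_simp

/-- Up to the factors `s_i` and `D`, the transformation interchanges `q_i` with `f_i`: the new `q_i`
is `s_i f_i / D` and the new `f_i` is `q_i D / s_i`. The products `q_i p_i`, `h_i` and `C` change
sign and `D` is invariant. This duality carries the whole computation. -/
theorem tau_spinF (hs : x.s ∈ config N) (hr : Gen.tau.Regular κ x) (i : Fin N) :
    spinF (Gen.tau.param κ) (Gen.tau.act κ x).q (Gen.tau.act κ x).p i =
      x.q i * x.den κ / x.s i := by
  have hm := tau_mul κ hs hr i
  obtain ⟨hD, hb⟩ := hr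
  have h0 := (hs.1 i).1
  have := hb i
  simp only [spinF]
  rw [hm]
  simp only [Gen.act, Gen.param]
  split_ifs at this ⊢ with h
  · rw [h]; field_simp; simp
  · have hb : x.q i * x.p i - κ (.th i) ≠ 0 := sub_ne_zero.2 this
    field_simp
    ring

theorem alpha_tau : alpha (Gen.tau.param κ) = -alpha κ := by
  simp only [alpha, Gen.param, Finset.sum_neg_distrib]; ring

theorem tau_spin (hs : x.s ∈ config N) (hr : Gen.tau.Regular κ x) :
    spinC (Gen.tau.param κ) (Gen.tau.act κ x).q (Gen.tau.act κ x).p = -spinC κ x.q x.p ∧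
    spinD (Gen.tau.param κ) (Gen.tau.act κ x).q (Gen.tau.act κ x).p = spinD κ x.q x.p ∧
    ∀ k, spinH (Gen.tau.param κ) (Gen.tau.act κ x).q (Gen.tau.act κ x).p k =
      -spinH κ x.q x.p k := by
  have hm := tau_mul κ hs hr
  refine ⟨?_, ?_, fun k => ?_⟩
  · rw [spinC, alpha_tau]
    simp only [spinC, hm, Finset.sum_neg_distrib, Gen.param]; ring
  · rw [spinD, alpha_tau]
    simp only [spinD, hm, Finset.sum_neg_distrib, Gen.param]; ring
  · simp only [spinH, mul_assoc, hm, Gen.param]; ring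

theorem coeff_exchange {s : Fin N → ℂ} (i j : Fin N) :
    s i * coeffS s j i = s j * coeffR s i j := by
  simp only [coeffR, coeffS]; ring

/-- The relation `s_i S_{ji} = s_j R_{ij}` turns the sum of the `S_{jk} q_k` into that of the
`R_{kj} f_k` and back. -/
theorem tau_sums (hs : x.s ∈ config N) (hr : Gen.tau.Regular κ x) (j : Fin N) :
    ∑ k ∈ Finset.univ.erase j, coeffS x.s j k * (Gen.tau.act κ x).q k =
      x.s j * (∑ k ∈ Finset.univ.erase j, coeffR x.s k j * spinF κ x.q x.p k) / x.den κ ∧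
    ∑ k ∈ Finset.univ.erase j, coeffR x.s j k *
        spinH (Gen.tau.param κ) (Gen.tau.act κ x).q (Gen.tau.act κ x).p k =
      -∑ k ∈ Finset.univ.erase j, coeffR x.s j k * spinH κ x.q x.p k ∧
    ∑ k ∈ Finset.univ.erase j, coeffR x.s k j *
        spinF (Gen.tau.param κ) (Gen.tau.act κ x).q (Gen.tau.act κ x).p k =
      x.den κ / x.s j * ∑ k ∈ Finset.univ.erase j, coeffS x.s j k * x.q k := by
  have hj := (hs.1 j).1
  refine ⟨?_, ?_, ?_⟩
  · rw [Finset.mul_sum, Finset.sum_div]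
    refine Finset.sum_congr rfl fun k _ => ?_
    rw [tau_q]
    linear_combination spinF κ x.q x.p k / x.den κ * coeff_exchange k j
  · rw [← Finset.sum_neg_distrib]
    exact Finset.sum_congr rfl fun k _ => by rw [(tau_spin κ hs hr).2.2 k]; ring
  · rw [Finset.mul_sum]
    refine Finset.sum_congr rfl fun k _ => ?_
    have hk := (hs.1 k).1
    rw [tau_spinF κ hs hr]
    field_simp
    linear_combination -x.q k * x.den κ * coeff_exchange (s := x.s) k j

/-- The derivative of `∑ q_k p_k` along the flow of `s_j`. -/
def momentRate (s q p : Fin N → ℂ) (j : Fin N) : ℂ :=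
  (-q j * spinD κ q p + s j * spinF κ q p j) / (s j * (s j - 1))

/-- The right-hand side is the product and quotient rule for `s_i f_i / D`, where the derivative of
`D` is `C` times the rate of `∑ q_k p_k`. -/
theorem tau_fieldQ (hs : x.s ∈ config N) (hr : Gen.tau.Regular κ x) (i j : Fin N) :
    fieldQ (Gen.tau.param κ) x.s (Gen.tau.act κ x).q (Gen.tau.act κ x).p i j =
      (if i = j then spinF κ x.q x.p i / spinD κ x.q x.p else 0)
      + x.s i * (fieldP κ x.s x.q x.p i j * spinH κ x.q x.p i
          + x.p i ^ 2 * fieldQ κ x.s x.q x.p i j) / spinD κ x.q x.p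
      - x.s i * spinF κ x.q x.p i * spinC κ x.q x.p * momentRate κ x.s x.q x.p j
          / spinD κ x.q x.p ^ 2 := by
  obtain ⟨hC, hD, hH⟩ := tau_spin κ hs hr
  obtain ⟨s1, s2, s3⟩ := tau_sums κ hs hr j
  have hD0 : spinD κ x.q x.p ≠ 0 := hr.1
  have hj := (hs.1 j).1
  have hj1 : x.s j - 1 ≠ 0 := sub_ne_zero.2 (hs.1 j).2
  have h1 : Gen.tau.param κ .k1 = -κ .k1 + 1 := rfl
  have h0 : Gen.tau.param κ .k0 = -κ .k0 + 1 := rfl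
  simp only [fieldQ, fieldP, momentRate]
  rw [s1, s2, hC, hH, hH, h0, h1, Pt.den_eq, tau_q, tau_q, Pt.den_eq]
  by_cases hij : i = j
  · subst hij
    simp only [if_true]
    generalize ∑ k ∈ Finset.univ.erase i, coeffS x.s i k * x.q k = A
    generalize ∑ k ∈ Finset.univ.erase i, coeffR x.s i k * spinH κ x.q x.p k = B
    generalize ∑ k ∈ Finset.univ.erase i, coeffR x.s k i * spinF κ x.q x.p k = B'
    generalize spinC κ x.q x.p = C at *
    generalize spinD κ x.q x.p = D at *
    simp only [spinH, spinF]
    field_simp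
    ring
  · simp only [if_neg hij]
    have ex := coeff_exchange (s := x.s) i j
    generalize coeffR x.s i j = r1 at *
    generalize coeffR x.s j i = r2 at *
    generalize coeffS x.s j i = r3 at *
    generalize spinC κ x.q x.p = C at *
    generalize spinD κ x.q x.p = D at *
    generalize hfj : spinF κ x.q x.p j = fj at *
    generalize hhj : spinH κ x.q x.p j = hj at *
    simp only [spinH, spinF]
    field_simp
    linear_combination (-(2 * x.q i * x.p i - κ (.th i)) * fj * D) * ex

theorem tau_fieldP (hs : x.s ∈ config N) (hr : Gen.tau.Regular κ x) (i j : Fin N) :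
    fieldP (Gen.tau.param κ) x.s (Gen.tau.act κ x).q (Gen.tau.act κ x).p i j =
      if κ (.th i) = 0 then
        -(spinC κ x.q x.p * momentRate κ x.s x.q x.p j) / (x.s i * x.p i)
        + spinD κ x.q x.p * ((if i = j then x.p i else 0) + x.s i * fieldP κ x.s x.q x.p i j)
          / (x.s i * x.p i) ^ 2
      else
        -(fieldQ κ x.s x.q x.p i j * spinD κ x.q x.p
          + x.q i * (spinC κ x.q x.p * momentRate κ x.s x.q x.p j))
            / (x.s i * (x.q i * x.p i - κ (.th i)))
        + x.q i * spinD κ x.q x.p * ((if i = j then (x.q i * x.p i - κ (.th i)) else 0)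
          + x.s i * (fieldQ κ x.s x.q x.p i j * x.p i + x.q i * fieldP κ x.s x.q x.p i j))
          / (x.s i * (x.q i * x.p i - κ (.th i))) ^ 2 := by
  obtain ⟨hC, hD, hH⟩ := tau_spin κ hs hr
  obtain ⟨s1, s2, s3⟩ := tau_sums κ hs hr j
  have hF := tau_spinF κ hs hr j
  have hm := tau_mul κ hs hr i
  have hD0 : spinD κ x.q x.p ≠ 0 := hr.1
  have hi := (hs.1 i).1
  have hj := (hs.1 j).1
  have hj1 : x.s j - 1 ≠ 0 := sub_ne_zero.2 (hs.1 j).2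
  have h1 : Gen.tau.param κ .k1 = -κ .k1 + 1 := rfl
  have h0 : Gen.tau.param κ .k0 = -κ .k0 + 1 := rfl
  have hb := hr.2 i
  have hPi : (Gen.tau.act κ x).p i = if κ (.th i) = 0 then -spinD κ x.q x.p / (x.s i * x.p i)
        else -x.q i * spinD κ x.q x.p / (x.s i * (x.q i * x.p i - κ (.th i))) := rfl
  simp only [fieldQ, fieldP, momentRate]
  rw [s1, s2, s3, hC, hD, hH, hF, Pt.den_eq]
  by_cases hij : i = j
  · subst hij
    rw [hm, hPi]
    simp only [if_true]
    generalize ∑ k ∈ Finset.univ.erase i, coeffS x.s i k * x.q k = A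
    generalize ∑ k ∈ Finset.univ.erase i, coeffR x.s i k * spinH κ x.q x.p k = B
    generalize ∑ k ∈ Finset.univ.erase i, coeffR x.s k i * spinF κ x.q x.p k = B'
    generalize spinC κ x.q x.p = C at *
    generalize spinD κ x.q x.p = D at *
    split_ifs at hb ⊢ with hθ
    · simp only [spinH, spinF, hθ, h0, h1]
      field_simp
      ring
    · have hb' : x.q i * x.p i - κ (.th i) ≠ 0 := sub_ne_zero.2 hb
      generalize hbe : x.q i * x.p i - κ (.th i) = b at *
      have hth : κ (.th i) = x.q i * x.p i - b := by linear_combination -hbe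
      simp only [spinH, spinF, h0, h1, hth]
      field_simp
      ring
  · rw [hPi, tau_q, Pt.den_eq]
    simp only [if_neg hij]
    have ex := coeff_exchange (s := x.s) i j
    have ex' : coeffS x.s j i = x.s j * coeffR x.s i j / x.s i := by
      field_simp; linear_combination ex
    rw [ex']
    generalize coeffR x.s i j = r1 at *
    generalize coeffR x.s j i = r2 at *
    generalize spinC κ x.q x.p = C at *
    generalize spinD κ x.q x.p = D at *
    generalize hfj : spinF κ x.q x.p j = fj at *
    generalize hhj : spinH κ x.q x.p j = hj' at *
    split_ifs at hb ⊢ with hθ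
    · field_simp
      ring
    · have hb' : x.q i * x.p i - κ (.th i) ≠ 0 := sub_ne_zero.2 hb
      generalize hbe : x.q i * x.p i - κ (.th i) = b at *
      have hth : κ (.th i) = x.q i * x.p i - b := by linear_combination -hbe
      simp only [spinH, hth]
      field_simp
      ring

end Tau

theorem FlowAt.tau {κ : Param N} {γ q p : ℂ → Fin N → ℂ} {x : ℂ} (h : FlowAt κ γ q p x)
    (hs : γ x ∈ config N) (hr : Gen.tau.Regular κ ⟨q x, p x, γ x⟩) :
    FlowAt (Gen.tau.param κ) γ
      (fun z => (Gen.tau.act κ ⟨q z, p z, γ z⟩).q)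
      (fun z => (Gen.tau.act κ ⟨q z, p z, γ z⟩).p) x := by
  obtain ⟨ds, h1, h2, h3⟩ := h
  have hD0 : spinD κ (q x) (p x) ≠ 0 := hr.1
  have hS : HasDerivAt (fun z => ∑ k, q z k * p z k)
      (∑ j, ds j * momentRate κ (γ x) (q x) (p x) j) x := by
    refine (HasDerivAt.fun_sum fun k _ => (h2 k).fun_mul (h3 k)).congr_deriv ?_
    simp only [momentRate, ← sum_field_mul κ (q x) (p x) hs, Finset.mul_sum]
    rw [Finset.sum_comm]
    refine Finset.sum_congr rfl fun k _ => ?_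
    rw [Finset.sum_mul, ← Finset.sum_add_distrib]
    exact Finset.sum_congr rfl fun j _ => by ring
  have hD : HasDerivAt (fun z => spinD κ (q z) (p z))
      (spinC κ (q x) (p x) * ∑ j, ds j * momentRate κ (γ x) (q x) (p x) j) x := by
    refine ((hS.const_add (alpha κ)).fun_mul (hS.const_add (alpha κ + κ .kinf))).congr_deriv ?_
    simp only [spinC]; ring
  -- All derivatives are linear in the velocity `ds`, so it suffices to compare the coefficients of
  -- each `ds j`.
  have key : ∀ (i : Fin N) (A B C E : ℂ), A * ds i + B * ∑ j, ds j * fieldQ κ (γ x) (q x) (p x) i j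
      + C * ∑ j, ds j * fieldP κ (γ x) (q x) (p x) i j
      + E * ∑ j, ds j * momentRate κ (γ x) (q x) (p x) j =
      ∑ j, ds j * (A * (if i = j then 1 else 0) + B * fieldQ κ (γ x) (q x) (p x) i j
        + C * fieldP κ (γ x) (q x) (p x) i j + E * momentRate κ (γ x) (q x) (p x) j) := by
    intro i A B C E
    simp only [mul_add, Finset.sum_add_distrib, Finset.mul_sum]
    congr 1
    · congr 1
      · congr 1
        · simp; ring
        · exact Finset.sum_congr rfl fun j _ => by ring
      · exact Finset.sum_congr rfl fun j _ => by ring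
    · exact Finset.sum_congr rfl fun j _ => by ring
  refine ⟨ds, h1, fun i => ?_, fun i => ?_⟩
  · refine (((((h1 i).fun_mul (h3 i)).fun_mul (((h2 i).fun_mul (h3 i)).sub_const
      (κ (.th i)))).fun_div hD hD0).congr_deriv ?_)
    refine Eq.trans ?_ (Finset.sum_congr rfl fun j _ => by
      rw [tau_fieldQ κ (x := ⟨q x, p x, γ x⟩) hs hr i j]).symm
    refine Eq.trans ?_ ((key i (spinF κ (q x) (p x) i / spinD κ (q x) (p x))
      (γ x i * p x i ^ 2 / spinD κ (q x) (p x))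
      (γ x i * spinH κ (q x) (p x) i / spinD κ (q x) (p x))
      (-(γ x i * spinF κ (q x) (p x) i * spinC κ (q x) (p x) / spinD κ (q x) (p x) ^ 2))).trans
        (Finset.sum_congr rfl fun j _ => ?_))
    · generalize ∑ j, ds j * fieldQ κ (γ x) (q x) (p x) i j = X
      generalize ∑ j, ds j * fieldP κ (γ x) (q x) (p x) i j = Y
      simp only [spinF, spinH]
      field_simp
      ring
    · dsimp only
      split_ifs <;> ring
  · have hb := hr.2 i
    have hi := (hs.1 i).1
    refine HasDerivAt.congr_deriv (f' := if κ (.th i) = 0 then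
        (-(spinC κ (q x) (p x) * ∑ j, ds j * momentRate κ (γ x) (q x) (p x) j) * (γ x i * p x i)
          + spinD κ (q x) (p x) * (ds i * p x i
            + γ x i * ∑ j, ds j * fieldP κ (γ x) (q x) (p x) i j)) / (γ x i * p x i) ^ 2
      else (-((∑ j, ds j * fieldQ κ (γ x) (q x) (p x) i j) * spinD κ (q x) (p x)
          + q x i * (spinC κ (q x) (p x) * ∑ j, ds j * momentRate κ (γ x) (q x) (p x) j)) *
            (γ x i * (q x i * p x i - κ (.th i)))
          + q x i * spinD κ (q x) (p x) * (ds i * (q x i * p x i - κ (.th i))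
            + γ x i * ((∑ j, ds j * fieldQ κ (γ x) (q x) (p x) i j) * p x i
              + q x i * ∑ j, ds j * fieldP κ (γ x) (q x) (p x) i j))) /
            (γ x i * (q x i * p x i - κ (.th i))) ^ 2) ?_ ?_
    · simp only [Gen.act]
      split_ifs at hb ⊢ with hθ
      · refine (hD.fun_neg.fun_div ((h1 i).fun_mul (h3 i)) (mul_ne_zero hi hb)).congr_deriv ?_
        ring
      · have hb' : q x i * p x i - κ (.th i) ≠ 0 := sub_ne_zero.2 hb
        refine (((h2 i).fun_neg.fun_mul hD).fun_div ((h1 i).fun_mul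
          (((h2 i).fun_mul (h3 i)).sub_const (κ (.th i)))) (mul_ne_zero hi hb')).congr_deriv ?_
        ring
    · refine Eq.trans ?_ (Finset.sum_congr rfl fun j _ => by
        rw [tau_fieldP κ (x := ⟨q x, p x, γ x⟩) hs hr i j]).symm
      split_ifs at hb ⊢ with hθ
      · refine Eq.trans ?_ ((key i
          (spinD κ (q x) (p x) * p x i / (γ x i * p x i) ^ 2) 0
          (spinD κ (q x) (p x) * γ x i / (γ x i * p x i) ^ 2)
          (-spinC κ (q x) (p x) / (γ x i * p x i))).trans
            (Finset.sum_congr rfl fun j _ => ?_))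
        · dsimp only at hb
          field_simp
          ring
        · dsimp only
          split_ifs <;> ring
      · have hb' : q x i * p x i - κ (.th i) ≠ 0 := sub_ne_zero.2 hb
        refine Eq.trans ?_ ((key i
          (q x i * spinD κ (q x) (p x) * (q x i * p x i - κ (.th i))
            / (γ x i * (q x i * p x i - κ (.th i))) ^ 2)
          (-spinD κ (q x) (p x) / (γ x i * (q x i * p x i - κ (.th i)))
            + q x i * spinD κ (q x) (p x) * γ x i * p x i
              / (γ x i * (q x i * p x i - κ (.th i))) ^ 2)
          (q x i * spinD κ (q x) (p x) * γ x i * q x i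
              / (γ x i * (q x i * p x i - κ (.th i))) ^ 2)
          (-(q x i * spinC κ (q x) (p x)) / (γ x i * (q x i * p x i - κ (.th i))))).trans
            (Finset.sum_congr rfl fun j _ => ?_))
        · generalize q x i * p x i - κ (.th i) = b at *
          field_simp
          ring
        · dsimp only
          split_ifs <;> ring


/-! ### All generators acting on algebraic solutions -/

theorem sigmaInf_act_eq (κ : Param N) {x : Pt N} (hs : x.s ∈ config N) :
    Gen.sigmaInf.act κ x =
      Gen.sigmaOne.act (fun c => Gen.sigmaOne.param κ (Equiv.swap .k0 .kinf c))
        (swapAct (Gen.sigmaOne.param κ) (Gen.sigmaOne.act κ x)) := by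
  have h0 := fun i => (hs.1 i).1
  have h1 : ∀ i, x.s i - 1 ≠ 0 := fun i => sub_ne_zero.2 (hs.1 i).2
  have h2 : ∀ i, 1 - 1 / x.s i = (x.s i - 1) / x.s i := fun i => by
    have := h0 i; field_simp
  have hg : (Gen.sigmaOne.act κ x).gs = x.g1 := by
    simp only [Pt.gs, Pt.g1, Gen.act]
    exact Finset.sum_congr rfl fun i _ => by have := h0 i; field_simp
  have hS : ∑ j, (Gen.sigmaOne.act κ x).q j * (Gen.sigmaOne.act κ x).p j =
      ∑ j, x.q j * x.p j := by
    simp only [Gen.act]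
    exact Finset.sum_congr rfl fun i _ => by have := h0 i; field_simp
  have hα : alpha (Gen.sigmaOne.param κ) = alpha κ := alpha_perm κ _
  ext i
  · simp only [Gen.act, swapAct, h2] at hg ⊢
    rw [hg]
    have := h0 i
    have := h1 i
    field_simp
  · simp only [Gen.act, swapAct, h2] at hg hS hα ⊢
    rw [hg, hS, hα]
    have := h0 i
    have := h1 i
    field_simp
    ring
  · simp only [Gen.act, swapAct, h2]
    have := h0 i
    have := h1 i
    field_simp

theorem sigmaInf_param_eq (κ : Param N) :
    Gen.sigmaInf.param κ = Gen.sigmaOne.param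
      (fun c => Gen.sigmaOne.param κ (Equiv.swap .k0 .kinf c)) := by
  funext a
  cases a <;> simp [Gen.param, Equiv.swap_apply_def]

/-- As `sigmaInf` is the conjugate of the exchange of `κ₀` and `κ_∞` by the inversion, the
reflection at infinity is the conjugate of the reflection at 0. -/
theorem refl_k1_act_eq (κ : Param N) {x : Pt N} (hs : x.s ∈ config N) :
    (Gen.refl .k1).act κ x =
      Gen.sigmaOne.act ((Gen.refl .k0).param (Gen.sigmaOne.param κ))
        ((Gen.refl .k0).act (Gen.sigmaOne.param κ) (Gen.sigmaOne.act κ x)) := by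
  have h0 := fun i => (hs.1 i).1
  have hg : (Gen.sigmaOne.act κ x).gs = x.g1 := by
    simp only [Pt.gs, Pt.g1, Gen.act]
    exact Finset.sum_congr rfl fun i _ => by have := h0 i; field_simp
  have hk : Gen.sigmaOne.param κ .k0 = κ .k1 := by simp [Gen.param]
  ext i
  · simp only [Gen.act]
    have := h0 i
    field_simp
  · simp only [Gen.act] at hg ⊢
    rw [hg, hk]
    have := h0 i
    -- No regularity is assumed: at `g₁ = 1` the correction is a division by zero, hence 0, on both
    -- sides.
    by_cases hg1 : x.g1 - 1 = 0
    · rw [hg1]; simp; field_simp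
    · field_simp
  · simp only [Gen.act]
    simp

theorem refl_k1_param_eq (κ : Param N) :
    (Gen.refl .k1).param κ = Gen.sigmaOne.param
      ((Gen.refl .k0).param (Gen.sigmaOne.param κ)) := by
  funext a
  cases a <;> simp [Gen.param, Equiv.swap_apply_def]

theorem refl_act_of_eq_zero {κ : Param N} {a : Idx N} (h : κ a = 0) (x : Pt N) :
    (Gen.refl a).act κ x = x := by
  cases a with
  | k0 => simp [Gen.act, h]
  | k1 => simp [Gen.act, h]
  | kinf => rfl
  | th j =>
    ext i
    · rfl
    · simp only [Gen.act, h]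
      split_ifs with hi
      · simp [hi]
      · rfl
    · rfl

theorem refl_param_of_eq_zero {κ : Param N} {a : Idx N} (h : κ a = 0) :
    (Gen.refl a).param κ = κ := by
  simp only [Gen.param, h, neg_zero]
  conv_lhs => rw [← h]
  exact Function.update_eq_self a κ

/-- The action of a generator on the independent variables. -/
def Gen.mapS : Gen N → (Fin N → ℂ) → Fin N → ℂ
  | .sigma m, s => fun i => if i = m then s m / (s m - 1) else (s m - s i) / (s m - 1)
  | .sigmaOne, s => fun i => 1 / s i
  | .sigmaInf, s => fun i => s i / (s i - 1)
  | .refl _, s => s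
  | .tau, s => s

theorem Gen.act_s (g : Gen N) (κ : Param N) (x : Pt N) : (g.act κ x).s = g.mapS x.s := by
  rcases g with m | _ | _ | (_ | _ | _ | j) | _ <;> rfl

theorem FlowAt.act {κ : Param N} {γ q p : ℂ → Fin N → ℂ} {x : ℂ} (h : FlowAt κ γ q p x)
    (hs : γ x ∈ config N) (g : Gen N) (hr : g.Regular κ ⟨q x, p x, γ x⟩) :
    FlowAt (g.param κ) (fun z => (g.act κ ⟨q z, p z, γ z⟩).s)
      (fun z => (g.act κ ⟨q z, p z, γ z⟩).q) (fun z => (g.act κ ⟨q z, p z, γ z⟩).p) x := by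
  have hev := h.eventually_config hs
  have hg1 : ∀ z, γ z ∈ config N →
      Pt.gs ⟨(Gen.sigmaOne.act κ ⟨q z, p z, γ z⟩).q, (Gen.sigmaOne.act κ ⟨q z, p z, γ z⟩).p,
        (Gen.sigmaOne.act κ ⟨q z, p z, γ z⟩).s⟩ = Pt.g1 ⟨q z, p z, γ z⟩ := by
    intro z hz
    simp only [Pt.gs, Pt.g1, Gen.act]
    exact Finset.sum_congr rfl fun i _ => by have := (hz.1 i).1; field_simp
  cases g with
  | sigma m => exact h.sigma hs m
  | sigmaOne => exact h.sigmaOne hs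
  | sigmaInf =>
    have h1 := h.sigmaOne hs
    have h2 := h1.swapAct (inv_mem_config hs) (by
      rw [hg1 x hs]; exact sub_ne_zero.2 (Ne.symm hr))
    have h3 := h2.sigmaOne (swapAct_mem_config _ (x := ⟨_, _, _⟩) (inv_mem_config hs))
    rw [sigmaInf_param_eq]
    refine h3.congr ?_ ?_ ?_ <;> filter_upwards [hev] with z hz <;>
      rw [sigmaInf_act_eq κ (x := ⟨q z, p z, γ z⟩) hz]
  | tau => exact h.tau hs hr
  | refl a =>
    -- For a zero component regularity says nothing about the denominator, but the change of sign is
    -- then the identity.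
    by_cases ha : κ a = 0
    · rw [refl_param_of_eq_zero ha]
      simp only [refl_act_of_eq_zero ha]
      exact h
    cases a with
    | kinf => exact h.refl_kinf hs
    | th j => exact h.refl_th hs j (hr.resolve_left ha)
    | k0 => exact h.refl_k0 hs (sub_ne_zero.2 (Ne.symm (hr.resolve_left ha)))
    | k1 =>
      have h1 := h.sigmaOne hs
      have h2 := h1.refl_k0 (inv_mem_config hs) (sub_ne_zero.2 (Ne.symm (by
        have := hg1 x hs
        rw [Pt.gs] at this
        rw [this]; exact hr.resolve_left ha)))
      have h3 := h2.sigmaOne (inv_mem_config hs)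
      rw [refl_k1_param_eq]
      refine h3.congr ?_ ?_ ?_ <;> filter_upwards [hev] with z hz <;>
        rw [refl_k1_act_eq κ (x := ⟨q z, p z, γ z⟩) hz] <;> rfl

theorem Gen.mapS_mem (g : Gen N) {s : Fin N → ℂ} (hs : s ∈ config N) : g.mapS s ∈ config N := by
  cases g with
  | sigma m => exact sigma_mem_config 0 m (x := ⟨0, 0, s⟩) hs
  | sigmaOne => exact inv_mem_config hs
  | sigmaInf =>
    have := inv_mem_config (swapAct_mem_config 0 (x := ⟨0, 0, _⟩) (inv_mem_config hs))
    convert this using 1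
    have h := congrArg Pt.s (sigmaInf_act_eq 0 (x := ⟨0, 0, s⟩) hs)
    rwa [Gen.act_s] at h
  | refl a => exact hs
  | tau => exact hs

theorem Gen.mapS_mapS (g : Gen N) {s : Fin N → ℂ} (hs : s ∈ config N) :
    g.mapS (g.mapS s) = s := by
  cases g with
  | sigma m =>
    funext i
    have h1 : s m - 1 ≠ 0 := sub_ne_zero.2 (hs.1 m).2
    have h2 : s m / (s m - 1) - 1 = 1 / (s m - 1) := by field_simp; ring
    by_cases hi : i = m
    · simp only [Gen.mapS, hi, if_true, h2]
      field_simp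
    · simp only [Gen.mapS, hi, if_true, if_false, h2]
      field_simp
      ring
  | sigmaOne => funext i; simp [Gen.mapS]
  | sigmaInf =>
    funext i
    have h1 : s i - 1 ≠ 0 := sub_ne_zero.2 (hs.1 i).2
    have h2 : s i / (s i - 1) - 1 = 1 / (s i - 1) := by field_simp; ring
    simp only [Gen.mapS, h2]
    field_simp
  | refl a => rfl
  | tau => rfl

theorem Gen.mapS_differentiableOn (g : Gen N) : DifferentiableOn ℂ g.mapS (config N) := by
  refine differentiableOn_pi.2 fun i s hs => DifferentiableAt.differentiableWithinAt ?_
  have h0 := (hs.1 i).1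
  have h1 : ∀ i, s i - 1 ≠ 0 := fun i => sub_ne_zero.2 (hs.1 i).2
  cases g with
  | sigma m =>
    simp only [Gen.mapS]
    split_ifs <;> fun_prop (disch := exact h1 m)
  | sigmaOne => simp only [Gen.mapS]; fun_prop (disch := assumption)
  | sigmaInf => simp only [Gen.mapS]; fun_prop (disch := exact h1 i)
  | refl a => simp only [Gen.mapS]; fun_prop
  | tau => simp only [Gen.mapS]; fun_prop

theorem Gen.mapS_rational (g : Gen N) : ∃ (A : Fin N → MvPolynomial (Fin N) ℂ)
    (D : MvPolynomial (Fin N) ℂ), (∀ s ∈ config N, MvPolynomial.eval s D ≠ 0) ∧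
      ∀ s ∈ config N, ∀ i, g.mapS s i = MvPolynomial.eval s (A i) / MvPolynomial.eval s D := by
  cases g with
  | sigma m =>
    refine ⟨fun i => if i = m then .X m else .X m - .X i, .X m - 1, fun s hs => ?_,
      fun s hs i => ?_⟩
    · simpa using sub_ne_zero.2 (hs.1 m).2
    · simp only [Gen.mapS]; split_ifs <;> simp
  | sigmaOne =>
    have hP : ∀ s ∈ config N, ∀ t : Finset (Fin N), ∏ k ∈ t, s k ≠ 0 := fun s hs t =>
      Finset.prod_ne_zero_iff.2 fun k _ => (hs.1 k).1
    refine ⟨fun i => ∏ k ∈ Finset.univ.erase i, .X k, ∏ k, .X k, fun s hs => ?_, fun s hs i => ?_⟩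
    · simpa using hP s hs Finset.univ
    · simp only [map_prod, MvPolynomial.eval_X, Gen.mapS]
      rw [← Finset.mul_prod_erase _ _ (Finset.mem_univ i)]
      have := hP s hs (Finset.univ.erase i)
      have := (hs.1 i).1
      field_simp
  | sigmaInf =>
    have hP : ∀ s ∈ config N, ∀ t : Finset (Fin N), ∏ k ∈ t, (s k - 1) ≠ 0 := fun s hs t =>
      Finset.prod_ne_zero_iff.2 fun k _ => sub_ne_zero.2 (hs.1 k).2
    refine ⟨fun i => .X i * ∏ k ∈ Finset.univ.erase i, (.X k - 1), ∏ k, (.X k - 1),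
      fun s hs => ?_, fun s hs i => ?_⟩
    · simpa using hP s hs Finset.univ
    · simp only [map_prod, map_mul, map_sub, map_one, MvPolynomial.eval_X, Gen.mapS]
      rw [← Finset.mul_prod_erase _ _ (Finset.mem_univ i)]
      have := hP s hs (Finset.univ.erase i)
      have := sub_ne_zero.2 (hs.1 i).2
      field_simp
  | refl a => exact ⟨.X, 1, by simp, by simp [Gen.mapS]⟩
  | tau => exact ⟨.X, 1, by simp, by simp [Gen.mapS]⟩

theorem Gen.act_algebraic (g : Gen N) (κ : Param N) {U : Set (Fin N → ℂ)}
    {q p : (Fin N → ℂ) → Fin N → ℂ} (hq : ∀ i, IsAlgebraicFunction U fun s => q s i)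
    (hp : ∀ i, IsAlgebraicFunction U fun s => p s i) (i : Fin N) :
    IsAlgebraicFunction U (fun s => (g.act κ ⟨q s, p s, s⟩).q i) ∧
      IsAlgebraicFunction U (fun s => (g.act κ ⟨q s, p s, s⟩).p i) := by
  rcases g with m | _ | _ | (_ | _ | _ | j) | _ <;>
    simp only [Gen.act, Pt.gs, Pt.g1, Pt.den, coeffR] <;> constructor <;>
    repeat' first
      | exact hq _
      | exact hp _
      | exact IsAlgebraicFunction.coord _
      | exact IsAlgebraicFunction.const _
      | refine IsAlgebraicFunction.ite _ (fun _ => ?_) (fun _ => ?_)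
      | refine IsAlgebraicFunction.sum _ (fun k _ => ?_)
      | apply IsAlgebraicFunction.sub
      | apply IsAlgebraicFunction.add
      | apply IsAlgebraicFunction.div
      | apply IsAlgebraicFunction.mul
      | apply IsAlgebraicFunction.neg

theorem Gen.act_differentiableAt (g : Gen N) (κ : Param N) {s : Fin N → ℂ}
    {q p : (Fin N → ℂ) → Fin N → ℂ} (hq : DifferentiableAt ℂ q s)
    (hp : DifferentiableAt ℂ p s) (hs : s ∈ config N) (hr : g.Regular κ ⟨q s, p s, s⟩) :
    DifferentiableAt ℂ (fun s => (g.act κ ⟨q s, p s, s⟩).q) s ∧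
      DifferentiableAt ℂ (fun s => (g.act κ ⟨q s, p s, s⟩).p) s := by
  have hq' := fun i => (differentiableAt_pi.1 hq i)
  have hp' := fun i => (differentiableAt_pi.1 hp i)
  have h0 := fun i => (hs.1 i).1
  have h1 : ∀ i, s i - 1 ≠ 0 := fun i => sub_ne_zero.2 (hs.1 i).2
  have hgs : DifferentiableAt ℂ (fun s => ∑ j, q s j / s j) s :=
    DifferentiableAt.fun_sum fun i _ => by fun_prop (disch := exact h0 i)
  have hg1 : DifferentiableAt ℂ (fun s => ∑ j, q s j) s := by fun_prop
  have hsg : DifferentiableAt ℂ (fun s => ∑ j, q s j * p s j) s := by fun_prop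
  cases g with
  | sigma m =>
    constructor <;> refine differentiableAt_pi.2 fun i => ?_
    · simp only [Gen.act, Pt.gs]
      by_cases hi : i = m
      · simp only [hi, if_true]; fun_prop (disch := exact h1 m)
      · simp only [hi, if_false, coeffR]
        have h2 : s m - s i ≠ 0 := sub_ne_zero.2 (hs.2 m i (Ne.symm hi))
        have h3 : s i * (s m - 1) / (s m - s i) ≠ 0 :=
          div_ne_zero (mul_ne_zero (h0 i) (h1 m)) h2
        fun_prop (disch := assumption)
    · simp only [Gen.act]
      by_cases hi : i = m
      · simp only [hi, if_true]; fun_prop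
      · simp only [hi, if_false, coeffR]
        have h2 : s m - s i ≠ 0 := sub_ne_zero.2 (hs.2 m i (Ne.symm hi))
        have h3 := h0 i
        fun_prop (disch := assumption)
  | sigmaOne =>
    constructor <;> refine differentiableAt_pi.2 fun i => ?_ <;> simp only [Gen.act] <;>
      fun_prop (disch := exact h0 i)
  | sigmaInf =>
    have h3 : ∑ j, q s j - 1 ≠ 0 := sub_ne_zero.2 hr
    constructor <;> refine differentiableAt_pi.2 fun i => ?_ <;>
      simp only [Gen.act, Pt.g1] <;> fun_prop (disch := exact h3)
  | refl a =>
    by_cases ha : κ a = 0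
    · simp only [refl_act_of_eq_zero ha]
      exact ⟨hq, hp⟩
    cases a with
    | kinf => exact ⟨hq, hp⟩
    | k0 =>
      refine ⟨hq, differentiableAt_pi.2 fun i => ?_⟩
      have h3 : s i * (∑ j, q s j / s j - 1) ≠ 0 :=
        mul_ne_zero (h0 i) (sub_ne_zero.2 (hr.resolve_left ha))
      simp only [Gen.act, Pt.gs]
      fun_prop (disch := assumption)
    | k1 =>
      refine ⟨hq, differentiableAt_pi.2 fun i => ?_⟩
      have h3 : ∑ j, q s j - 1 ≠ 0 := sub_ne_zero.2 (hr.resolve_left ha)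
      simp only [Gen.act, Pt.g1]
      fun_prop (disch := assumption)
    | th j =>
      refine ⟨hq, differentiableAt_pi.2 fun i => ?_⟩
      have h3 : q s j ≠ 0 := hr.resolve_left ha
      simp only [Gen.act]
      split_ifs
      · fun_prop (disch := assumption)
      · exact hp' i
  | tau =>
    have hD : (alpha κ + ∑ j, q s j * p s j) * (alpha κ + κ .kinf + ∑ j, q s j * p s j) ≠ 0 := hr.1
    constructor <;> refine differentiableAt_pi.2 fun i => ?_
    · simp only [Gen.act, Pt.den]
      fun_prop (disch := assumption)
    · have hb := hr.2 i
      simp only [Gen.act, Pt.den]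
      split_ifs at hb ⊢
      · have h3 : s i * p s i ≠ 0 := mul_ne_zero (h0 i) hb
        fun_prop (disch := assumption)
      · have h3 : s i * (q s i * p s i - κ (.th i)) ≠ 0 :=
          mul_ne_zero (h0 i) (sub_ne_zero.2 hb)
        fun_prop (disch := assumption)

theorem IsSolution.of_flowAt {κ : Param N} {U : Set (Fin N → ℂ)}
    {q p : (Fin N → ℂ) → Fin N → ℂ} (hU : IsOpen U) (hc : IsConnected U) (hs : U ⊆ config N)
    (hq : DifferentiableOn ℂ q U) (hp : DifferentiableOn ℂ p U)
    (h : ∀ s ∈ U, ∀ j, FlowAt κ (fun x => Function.update s j x)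
      (fun x => q (Function.update s j x)) (fun x => p (Function.update s j x)) (s j)) :
    IsSolution κ U q p := by
  have key : ∀ s ∈ U, ∀ i j, HasDerivAt (fun x => q (Function.update s j x) i)
        (fieldQ κ s (q s) (p s) i j) (s j) ∧
      HasDerivAt (fun x => p (Function.update s j x) i) (fieldP κ s (q s) (p s) i j) (s j) := by
    intro s hs i j
    obtain ⟨ds, h1, h2, h3⟩ := h s hs j
    have hds : ∀ k, ds k = (Pi.single j (1 : ℂ) : Fin N → ℂ) k := fun k =>
      (h1 k).unique (hasDerivAt_pi.1 (hasDerivAt_update s j (s j)) k)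
    have h2 := h2 i
    have h3 := h3 i
    simp only [Function.update_eq_self, hds] at h2 h3
    constructor
    · simpa [Pi.single_apply] using h2
    · simpa [Pi.single_apply] using h3
  exact ⟨hU, hc, hs, hq, hp, fun s hs i j => by rw [deriv_hamiltonian_p]; exact (key s hs i j).1,
    fun s hs i j => by rw [deriv_hamiltonian_q]; exact (key s hs i j).2⟩

theorem IsSolution.flowAt {κ : Param N} {U : Set (Fin N → ℂ)}
    {q p : (Fin N → ℂ) → Fin N → ℂ} (h : IsSolution κ U q p) {γ : ℂ → Fin N → ℂ} {x : ℂ}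
    (hγ : DifferentiableAt ℂ γ x) (hx : γ x ∈ U) :
    FlowAt κ γ (fun z => q (γ z)) (fun z => p (γ z)) x :=
  ⟨deriv γ x, fun i => hasDerivAt_pi.1 hγ.hasDerivAt i,
    fun i => (h.hasDerivAt_comp hγ.hasDerivAt hx i).1,
    fun i => (h.hasDerivAt_comp hγ.hasDerivAt hx i).2⟩

/-- The image of an algebraic solution under a generator. -/
theorem IsAlgebraicSolution.transport {κ : Param N} {U : Set (Fin N → ℂ)}
    {q p : (Fin N → ℂ) → Fin N → ℂ} (h : IsAlgebraicSolution κ U q p) (g : Gen N)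
    (hr : ∀ s ∈ U, g.Regular κ ⟨q s, p s, s⟩) :
    ∃ (U' : Set (Fin N → ℂ)) (q' p' : (Fin N → ℂ) → Fin N → ℂ),
      IsAlgebraicSolution (g.param κ) U' q' p' ∧
      (fun s => (⟨q' s, p' s, s⟩ : Pt N)) '' U' = (fun s => g.act κ ⟨q s, p s, s⟩) '' U := by
  set φ := g.mapS
  -- The action on `s` is an involution of `config N`, so the image of `U` is a preimage: it is
  -- open, and the new functions are composites with the same map.
  set U' := config N ∩ φ ⁻¹' U with hU'
  have hUc := h.subset_config
  have hφφ : ∀ s ∈ config N, φ (φ s) = s := fun s hs => g.mapS_mapS hs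
  have himg : φ '' U = U' := by
    ext S
    constructor
    · rintro ⟨s, hs, rfl⟩
      refine ⟨g.mapS_mem (hUc hs), ?_⟩
      rw [Set.mem_preimage, hφφ s (hUc hs)]; exact hs
    · rintro ⟨hS, hS'⟩
      exact ⟨φ S, hS', g.mapS_mapS hS⟩
  have hopen : IsOpen U' := g.mapS_differentiableOn.continuousOn.isOpen_inter_preimage
    isOpen_config h.isOpen
  have hφd : ∀ S ∈ U', DifferentiableAt ℂ φ S := fun S hS =>
    g.mapS_differentiableOn.differentiableAt (isOpen_config.mem_nhds hS.1)
  have hdiff : ∀ S ∈ U', _ := fun S hS => g.act_differentiableAt κ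
    (h.differentiableOn_q.differentiableAt (h.isOpen.mem_nhds hS.2))
    (h.differentiableOn_p.differentiableAt (h.isOpen.mem_nhds hS.2)) (hUc hS.2) (hr _ hS.2)
  obtain ⟨A, D, hD, hA⟩ := g.mapS_rational
  refine ⟨U', fun S => (g.act κ ⟨q (φ S), p (φ S), φ S⟩).q,
    fun S => (g.act κ ⟨q (φ S), p (φ S), φ S⟩).p, ⟨IsSolution.of_flowAt hopen ?_
      Set.inter_subset_left ?_ ?_ ?_, fun i => ?_, fun i => ?_⟩, ?_⟩
  · rw [← himg]
    exact h.isConnected.image φ (g.mapS_differentiableOn.continuousOn.mono hUc)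
  · exact fun S hS => ((hdiff S hS).1.comp S (hφd S hS)).differentiableWithinAt
  · exact fun S hS => ((hdiff S hS).2.comp S (hφd S hS)).differentiableWithinAt
  · intro S hS j
    have hup : DifferentiableAt ℂ (fun x => Function.update S j x) (S j) :=
      (hasDerivAt_update S j (S j)).differentiableAt
    have hγ : DifferentiableAt ℂ (fun x => φ (Function.update S j x)) (S j) := by
      refine DifferentiableAt.comp (g := φ) (S j) ?_ hup
      rw [Function.update_eq_self]; exact hφd S hS
    have hx : φ (Function.update S j (S j)) ∈ U := by
      rw [Function.update_eq_self]; exact hS.2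
    have h1 := (h.flowAt hγ hx).act (hUc hx) g (hr _ hx)
    refine h1.congr ?_ (Eventually.of_forall fun z => rfl) (Eventually.of_forall fun z => rfl)
    have : ∀ᶠ z in 𝓝 (S j), Function.update S j z ∈ config N :=
      hup.continuousAt.eventually (isOpen_config.mem_nhds (by
        dsimp only; rw [Function.update_eq_self]; exact hS.1))
    filter_upwards [this] with z hz
    rw [Gen.act_s]
    exact (g.mapS_mapS hz).symm
  · exact (g.act_algebraic κ h.algebraic_q h.algebraic_p i).1.comp h.isOpen h.isConnected.1 A D
      (fun s hs => hD s hs.1) (fun s hs => hA s hs.1) (fun s hs => hs.2)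
      fun s hs => ⟨φ s, ⟨g.mapS_mem (hUc hs), by
        rw [Set.mem_preimage, hφφ s (hUc hs)]; exact hs⟩, g.mapS_mapS (hUc hs)⟩
  · exact (g.act_algebraic κ h.algebraic_q h.algebraic_p i).2.comp h.isOpen h.isConnected.1 A D
      (fun s hs => hD s hs.1) (fun s hs => hA s hs.1) (fun s hs => hs.2)
      fun s hs => ⟨φ s, ⟨g.mapS_mem (hUc hs), by
        rw [Set.mem_preimage, hφφ s (hUc hs)]; exact hs⟩, g.mapS_mapS (hUc hs)⟩
  · rw [← himg, Set.image_image]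
    refine Set.image_congr fun s hs => ?_
    dsimp only
    rw [hφφ s (hUc hs)]
    ext1
    · rfl
    · rfl
    · exact (g.act_s κ ⟨q s, p s, s⟩).symm


/-! ### The seed -/

section Seed

variable {κ : Param N} {t : Fin N → ℂ}

theorem seed_mul (hκ : κ .kinf ≠ 0) (ht : ∀ i, t i ≠ 0) (i : Fin N) :
    seedQ κ t i * seedP κ t i = κ (.th i) / 2 := by
  have := ht i
  simp only [seedQ, seedP]
  field_simp

theorem seed_alpha (hκ : IsSeedParam κ) :
    alpha κ = -(κ .kinf + ∑ i, κ (.th i)) / 2 := by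
  simp only [alpha, hκ.1, hκ.2.1]; ring

/-- Each `q_k p_k = θ_k / 2` is the midpoint between the two roots 0 and `θ_k` of `q_k f_k` as a
function of the product, and `∑ q_k p_k` is the midpoint between the roots of `D`; thus `h_k` and
`C` vanish and only `D` and `f_k` remain. -/
theorem seed_spin (hκ : IsSeedParam κ) (ht : ∀ i, t i ≠ 0) :
    spinC κ (seedQ κ t) (seedP κ t) = 0 ∧
    spinD κ (seedQ κ t) (seedP κ t) = -κ .kinf ^ 2 / 4 ∧
    (∀ k, spinH κ (seedQ κ t) (seedP κ t) k = 0) ∧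
    ∀ k, spinF κ (seedQ κ t) (seedP κ t) k = -κ .kinf * κ (.th k) / (4 * t k) := by
  have hm := seed_mul hκ.2.2 ht
  refine ⟨?_, ?_, fun k => ?_, fun k => ?_⟩
  · simp only [spinC, hm, seed_alpha hκ, ← Finset.sum_div]; ring
  · simp only [spinD, hm, seed_alpha hκ, ← Finset.sum_div]; ring
  · simp only [spinH, mul_assoc, hm]; ring
  · rw [spinF, hm]
    simp only [seedP]
    have := ht k
    field_simp
    ring

/-- On the seed the system decouples. The off-diagonal part of `fieldQ` contains only `C` and `h`,
and in `fieldP` the contributions of `f` and of `q` cancel pair by pair after substituting `s_i =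
t_i ^ 2`. -/
theorem seed_field {s : Fin N → ℂ} (hs : s ∈ config N) (hκ : IsSeedParam κ)
    (hts : ∀ i, t i ^ 2 = s i) (i j : Fin N) :
    fieldQ κ s (seedQ κ t) (seedP κ t) i j =
      (if i = j then κ (.th i) / (2 * t i * κ .kinf) else 0) ∧
    fieldP κ s (seedQ κ t) (seedP κ t) i j =
      if i = j then -κ .kinf / (4 * t i ^ 3) else 0 := by
  have ht : ∀ i, t i ≠ 0 := fun i h => (hs.1 i).1 (by rw [← hts i, h]; ring)
  obtain ⟨hC, hD, hH, hF⟩ := seed_spin hκ ht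
  have hj0 := (hs.1 j).1
  have hj1 : s j - 1 ≠ 0 := sub_ne_zero.2 (hs.1 j).2
  have hti := ht i
  have htj := ht j
  have hk := hκ.2.2
  have hcancel : ∀ k, k ≠ j → coeffR s k j * (-κ .kinf * κ (.th k) / (4 * t k))
      + seedP κ t j ^ 2 * (coeffS s j k * seedQ κ t k) = 0 := by
    intro k hkj
    have hkt := ht k
    have h1 : t j ^ 2 - t k ^ 2 ≠ 0 := by
      rw [hts, hts]; exact sub_ne_zero.2 (hs.2 j k (Ne.symm hkj))
    simp only [coeffR, coeffS, seedP, seedQ, ← hts]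
    field_simp
    ring
  simp only [fieldQ, fieldP, hC, hD, hH, hF, hκ.1, hκ.2.1]
  by_cases hij : i = j
  · subst hij
    simp only [if_true]
    constructor
    · simp only [mul_zero, zero_mul, Finset.sum_const_zero, seedQ]
      rw [← hts] at hj1 hj0 ⊢
      field_simp
      ring
    · have h0 : ∑ k ∈ Finset.univ.erase i, coeffR s k i * (-κ .kinf * κ (.th k) / (4 * t k))
          + seedP κ t i ^ 2 * ∑ k ∈ Finset.univ.erase i, coeffS s i k * seedQ κ t k = 0 := by
        rw [Finset.mul_sum, ← Finset.sum_add_distrib]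
        exact Finset.sum_eq_zero fun k hk => hcancel k (Finset.ne_of_mem_erase hk)
      have e : -κ .kinf ^ 2 / 4 + seedQ κ t i * seedP κ t i * 0 + s i * seedP κ t i ^ 2
          - ∑ k ∈ Finset.univ.erase i, coeffR s k i * (-κ .kinf * κ (.th k) / (4 * t k))
          - seedP κ t i ^ 2 * ∑ k ∈ Finset.univ.erase i, coeffS s i k * seedQ κ t k =
          0 := by
        have : s i * seedP κ t i ^ 2 = κ .kinf ^ 2 / 4 := by
          simp only [seedP, ← hts]; field_simp; norm_num
        linear_combination -h0 + this
      rw [e]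
      simp only [mul_zero, zero_mul, Finset.sum_const_zero, seedP]
      rw [← hts] at hj1 hj0 ⊢
      field_simp
      ring
  · simp only [if_neg hij]
    have h1 : t j ^ 2 - t i ^ 2 ≠ 0 := by
      rw [hts, hts]; exact sub_ne_zero.2 (hs.2 j i (Ne.symm hij))
    constructor
    · ring
    · have : coeffS s j i * (-κ .kinf * κ (.th j) / (4 * t j))
          + coeffR s i j * seedP κ t i ^ 2 * seedQ κ t j = 0 := by
        simp only [coeffR, coeffS, seedP, seedQ, ← hts]
        field_simp
        ring
      rw [div_eq_zero_iff]
      left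
      linear_combination this

end Seed

theorem IsSqrtBranch.ne_zero {U : Set (Fin N → ℂ)} {t : (Fin N → ℂ) → Fin N → ℂ}
    (h : IsSqrtBranch U t) {s : Fin N → ℂ} (hs : s ∈ U) (i : Fin N) : t s i ≠ 0 :=
  fun h0 => ((h.subset_config hs).1 i).1 (by rw [← h.sq_eq s hs i, h0]; ring)

theorem IsSqrtBranch.hasDerivAt {U : Set (Fin N → ℂ)} {t : (Fin N → ℂ) → Fin N → ℂ}
    (h : IsSqrtBranch U t) {s : Fin N → ℂ} (hs : s ∈ U) (i j : Fin N) :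
    HasDerivAt (fun x => t (Function.update s j x) i) (if i = j then 1 / (2 * t s i) else 0)
      (s j) := by
  have hup := hasDerivAt_update s j (s j)
  have hd : DifferentiableAt ℂ (fun x => t (Function.update s j x) i) (s j) := by
    have h1 : DifferentiableAt ℂ t (Function.update s j (s j)) := by
      rw [Function.update_eq_self]
      exact h.differentiableOn.differentiableAt (h.isOpen.mem_nhds hs)
    exact differentiableAt_pi.1 (DifferentiableAt.comp (g := t) (s j) h1 hup.differentiableAt) i
  -- The derivative of the branch is found by differentiating `t_i ^ 2 = s_i`.
  have h2 := hd.hasDerivAt.fun_pow 2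
  have h3 := hasDerivAt_pi.1 hup i
  have hev : (fun x => t (Function.update s j x) i ^ 2) =ᶠ[𝓝 (s j)]
      fun x => Function.update s j x i := by
    have : ∀ᶠ x in 𝓝 (s j), Function.update s j x ∈ U :=
      hup.continuousAt.eventually (h.isOpen.mem_nhds (by rwa [Function.update_eq_self]))
    filter_upwards [this] with x hx
    exact h.sq_eq _ hx i
  have h4 := h2.unique (h3.congr_of_eventuallyEq hev)
  refine hd.hasDerivAt.congr_deriv ?_
  have h0 := h.ne_zero hs i
  rw [Function.update_eq_self] at h4
  split_ifs with hij
  · subst hij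
    rw [Pi.single_eq_same] at h4
    field_simp
    push_cast at h4
    linear_combination h4
  · rw [Pi.single_eq_of_ne hij] at h4
    push_cast at h4
    have : t s i * deriv (fun x => t (Function.update s j x) i) (s j) = 0 := by
      linear_combination h4 / 2
    exact (mul_eq_zero.1 this).resolve_left h0

theorem IsSqrtBranch.algebraic {U : Set (Fin N → ℂ)} {t : (Fin N → ℂ) → Fin N → ℂ}
    (h : IsSqrtBranch U t) (i : Fin N) : IsAlgebraicFunction U fun s => t s i := by
  refine ⟨Polynomial.X ^ 2 - Polynomial.C (MvPolynomial.X i),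
    (Polynomial.monic_X_pow_sub_C _ two_ne_zero).ne_zero, fun s hs => ?_⟩
  simp [h.sq_eq s hs i]

theorem seed_isAlgebraicSolution {κ : Param N} (hκ : IsSeedParam κ) {U : Set (Fin N → ℂ)}
    {t : (Fin N → ℂ) → Fin N → ℂ} (h : IsSqrtBranch U t) :
    IsAlgebraicSolution κ U (fun s => seedQ κ (t s)) (fun s => seedP κ (t s)) := by
  have hd : ∀ i, DifferentiableOn ℂ (fun s => t s i) U := differentiableOn_pi.1 h.differentiableOn
  have hk := hκ.2.2
  refine ⟨⟨h.isOpen, h.isConnected, h.subset_config, ?_, ?_, fun s hs i j => ?_,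
    fun s hs i j => ?_⟩, fun i => ?_, fun i => ?_⟩
  · refine differentiableOn_pi.2 fun i => ?_
    have := hd i
    simp only [seedQ]
    fun_prop (disch := assumption)
  · refine differentiableOn_pi.2 fun i s hs => ?_
    have h1 := (hd i).differentiableAt (h.isOpen.mem_nhds hs)
    have h0 : 2 * t s i ≠ 0 := mul_ne_zero two_ne_zero (h.ne_zero hs i)
    refine DifferentiableAt.differentiableWithinAt ?_
    simp only [seedP]
    fun_prop (disch := assumption)
  · rw [deriv_hamiltonian_p, (seed_field (h.subset_config hs) hκ (h.sq_eq s hs) i j).1]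
    refine (((h.hasDerivAt hs i j).const_mul (κ (.th i))).div_const (κ .kinf)).congr_deriv ?_
    have h0 := h.ne_zero hs i
    split_ifs
    · field_simp
    · simp
  · rw [deriv_hamiltonian_q, (seed_field (h.subset_config hs) hκ (h.sq_eq s hs) i j).2]
    have h0 := h.ne_zero hs i
    have h0' : t (Function.update s j (s j)) i ≠ 0 := by rwa [Function.update_eq_self]
    refine ((hasDerivAt_const (s j) (κ .kinf)).fun_div ((h.hasDerivAt hs i j).const_mul 2)
      (mul_ne_zero two_ne_zero h0')).congr_deriv ?_
    rw [Function.update_eq_self]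
    split_ifs
    · field_simp; ring
    · simp
  · exact ((IsAlgebraicFunction.const _).mul (h.algebraic i)).div (.const _)
  · exact (IsAlgebraicFunction.const _).div ((IsAlgebraicFunction.const _).mul (h.algebraic i))

/-- The parameter after the change of sign of the `θ_i` for `i` in the list. -/
def negTheta (l : List (Fin N)) (κ : Param N) : Param N
  | .th i => if i ∈ l then -κ (.th i) else κ (.th i)
  | a => κ a

/-- The point after the change of sign of the `θ_i` for `i` in the list. -/
def reflTheta (l : List (Fin N)) (κ : Param N) (x : Pt N) : Pt N where
  q := x.q
  p i := if i ∈ l then x.p i - κ (.th i) / x.q i else x.p i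
  s := x.s

/-- Since the list has no repetitions, the reflections do not interfere: each one meets the original
`θ_i`, `q_i` and `p_i`. The continuation `w` is carried along for the induction and for the final
`R_τ`. -/
theorem word_reflTheta (l : List (Fin N)) (hl : l.Nodup) (w : List (Gen N)) (κ : Param N)
    (x : Pt N) (hx : ∀ i ∈ l, κ (.th i) = 0 ∨ x.q i ≠ 0) :
    wordParam (l.map (fun i => Gen.refl (.th i)) ++ w) κ = wordParam w (negTheta l κ) ∧
    wordAct (l.map (fun i => Gen.refl (.th i)) ++ w) κ x =
      wordAct w (negTheta l κ) (reflTheta l κ x) ∧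
    (WordRegular w (negTheta l κ) (reflTheta l κ x) →
      WordRegular (l.map (fun i => Gen.refl (.th i)) ++ w) κ x) := by
  induction l generalizing κ x with
  | nil =>
    have h1 : negTheta [] κ = κ := by funext a; cases a <;> simp [negTheta]
    have h2 : reflTheta [] κ x = x := by ext <;> simp [reflTheta]
    rw [h1, h2]
    exact ⟨rfl, rfl, id⟩
  | cons j l ih =>
    rw [List.nodup_cons] at hl
    have hth : ∀ i, i ≠ j → (Gen.refl (.th j)).param κ (.th i) = κ (.th i) := fun i hi => by
      simp [Gen.param, hi]
    have hne : ∀ i ∈ l, i ≠ j := fun i hi h => hl.1 (h ▸ hi)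
    have := ih hl.2 ((Gen.refl (.th j)).param κ) ((Gen.refl (.th j)).act κ x) (fun i hi => by
      rw [hth i (hne i hi)]
      exact hx i (List.mem_cons_of_mem _ hi))
    have h1 : negTheta l ((Gen.refl (.th j)).param κ) = negTheta (j :: l) κ := by
      funext a
      cases a with
      | th i =>
        by_cases hi : i = j
        · subst hi
          simp [negTheta, hl.1, Gen.param]
        · simp [negTheta, hth i hi, hi]
      | _ => simp [negTheta, Gen.param]
    have h2 : reflTheta l ((Gen.refl (.th j)).param κ) ((Gen.refl (.th j)).act κ x) =
        reflTheta (j :: l) κ x := by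
      ext i
      · rfl
      · by_cases hi : i = j
        · subst hi
          simp [reflTheta, hl.1, Gen.act]
        · simp [reflTheta, hth i hi, hi, Gen.act]
      · rfl
    rw [h1, h2] at this
    exact ⟨this.1, this.2.1, fun h => ⟨hx j (by simp), this.2.2 h⟩⟩

/-- If `θ_i ≠ 0`, the reflection replaces `p_i` by `-p_i`, and `R_τ`, with `D = -κ_∞² / 4` and `s_i
= t_i ^ 2`, reverses this and reproduces `q_i`. If `θ_i = 0`, then `q_i = 0`, the reflection is the
identity, and `R_τ` fixes `p_i` through its formula in lowest terms. -/
theorem seed_fixed {κ : Param N} (hκ : IsSeedParam κ) {s t : Fin N → ℂ} (hs : s ∈ config N)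
    (hts : ∀ i, t i ^ 2 = s i) :
    wordParam (w0 N) κ = κ ∧ WordRegular (w0 N) κ ⟨seedQ κ t, seedP κ t, s⟩ ∧
      wordAct (w0 N) κ ⟨seedQ κ t, seedP κ t, s⟩ = ⟨seedQ κ t, seedP κ t, s⟩ := by
  have ht : ∀ i, t i ≠ 0 := fun i h => (hs.1 i).1 (by rw [← hts i, h]; ring)
  have hk := hκ.2.2
  set κ' := (Gen.refl .kinf).param κ with hκ'
  have hth : ∀ i, κ' (.th i) = κ (.th i) := fun i => by simp [hκ', Gen.param]
  have hW := word_reflTheta (List.finRange N).reverse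
    (List.nodup_reverse.2 (List.nodup_finRange N)) [.tau] κ' ⟨seedQ κ t, seedP κ t, s⟩
    (fun i _ => by
      rw [hth]
      by_cases h : κ (.th i) = 0
      · exact Or.inl h
      · exact Or.inr (div_ne_zero (mul_ne_zero h (ht i)) hk))
  set κ2 := negTheta (List.finRange N).reverse κ' with hκ2
  set y := reflTheta (List.finRange N).reverse κ' ⟨seedQ κ t, seedP κ t, s⟩ with hy
  have k0 : κ2 .k0 = 1 / 2 := by simp [hκ2, negTheta, hκ', Gen.param, hκ.1]
  have k1 : κ2 .k1 = 1 / 2 := by simp [hκ2, negTheta, hκ', Gen.param, hκ.2.1]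
  have ki : κ2 .kinf = -κ .kinf := by simp [hκ2, negTheta, hκ', Gen.param]
  have kt : ∀ i, κ2 (.th i) = -κ (.th i) := fun i => by
    simp [hκ2, negTheta, hth]
  have yq : ∀ i, y.q i = κ (.th i) * t i / κ .kinf := fun i => rfl
  have yp : ∀ i, y.p i = if κ (.th i) = 0 then κ .kinf / (2 * t i)
      else -κ .kinf / (2 * t i) := by
    intro i
    have : y.p i = seedP κ t i - κ (.th i) / seedQ κ t i := by
      simp [hy, reflTheta, hth]
    rw [this]
    have := ht i
    simp only [seedP, seedQ]
    split_ifs with h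
    · rw [h]; simp
    · field_simp; ring
  have ys : ∀ i, y.s i = t i ^ 2 := fun i => (hts i).symm
  have yqp : ∀ i, y.q i * y.p i = -κ (.th i) / 2 := by
    intro i
    have := ht i
    rw [yq, yp]
    split_ifs with h
    · rw [h]; simp
    · field_simp
  have hden : y.den κ2 = -κ .kinf ^ 2 / 4 := by
    have hα : alpha κ2 = (κ .kinf + ∑ i, κ (.th i)) / 2 := by
      simp only [alpha, k0, k1, ki, kt, Finset.sum_neg_distrib]; ring
    simp only [Pt.den, yqp, hα, ki, neg_div, Finset.sum_neg_distrib, ← Finset.sum_div]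
    ring
  have hr : Gen.tau.Regular κ2 y := by
    refine ⟨?_, fun i => ?_⟩
    · rw [hden]
      exact div_ne_zero (neg_ne_zero.2 (pow_ne_zero 2 hk)) (by norm_num)
    · rw [kt, yqp, yp]
      have := ht i
      by_cases h : κ (.th i) = 0
      · simp only [h, neg_zero, if_true]
        exact div_ne_zero hk (mul_ne_zero two_ne_zero this)
      · rw [if_neg (neg_ne_zero.2 h)]
        intro h2
        apply h
        linear_combination 2 * h2
  refine ⟨?_, ⟨trivial, hW.2.2 ⟨hr, trivial⟩⟩, ?_⟩
  · refine Eq.trans hW.1 ?_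
    funext a
    cases a with
    | k0 => simp only [wordParam, Gen.param, k0, hκ.1]; norm_num
    | k1 => simp only [wordParam, Gen.param, k1, hκ.2.1]; norm_num
    | kinf => simp only [wordParam, Gen.param, ki, neg_neg]
    | th i => simp only [wordParam, Gen.param, kt, neg_neg]
  · refine Eq.trans hW.2.1 ?_
    ext i
    · have := ht i
      simp only [wordAct, Gen.act, hden, yqp, kt, ys, seedQ]
      rw [yp]
      split_ifs with h
      · rw [h]; simp
      · field_simp; ring
    · have := ht i
      simp only [wordAct, Gen.act, hden, yqp, kt, ys, seedP, neg_eq_zero]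
      rw [yp, yq]
      split_ifs with h
      · field_simp; norm_num
      · field_simp; ring
    · rfl

theorem exists_sqrtBranch (N : ℕ) :
    ∃ (U : Set (Fin N → ℂ)) (t : (Fin N → ℂ) → Fin N → ℂ), IsSqrtBranch U t := by
  -- Around the centre (2, 3, …, N + 1) a ball of radius 1/2 in the sup norm keeps the coordinates
  -- distinct and their real parts above 3/2, so the principal square roots are holomorphic.
  set c : Fin N → ℂ := fun i => ((i : ℕ) : ℂ) + 2 with hc
  have hre : ∀ s ∈ Metric.ball c (1 / 2), ∀ i, |(s i).re - ((i : ℕ) + 2)| < 1 / 2 := by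
    intro s hs i
    have h1 := (dist_pi_lt_iff (by norm_num)).1 (Metric.mem_ball.1 hs) i
    rw [dist_eq_norm] at h1
    have h2 := (Complex.abs_re_le_norm (s i - c i)).trans_lt h1
    simpa [hc] using h2
  refine ⟨Metric.ball c (1 / 2), fun s i => s i ^ ((2 : ℕ)⁻¹ : ℂ), Metric.isOpen_ball,
    ⟨⟨c, Metric.mem_ball_self (by norm_num)⟩, (convex_ball c _).isPreconnected⟩, ?_, ?_, ?_⟩
  · intro s hs
    refine ⟨fun i => ⟨fun h => ?_, fun h => ?_⟩, fun i j hij h => hij ?_⟩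
    · have := hre s hs i
      rw [h] at this
      rw [abs_lt] at this
      have h3 : (0 : ℝ) ≤ (i : ℕ) := Nat.cast_nonneg _
      simp at this
      linarith [this.1]
    · have := hre s hs i
      rw [h] at this
      rw [abs_lt] at this
      have h3 : (0 : ℝ) ≤ (i : ℕ) := Nat.cast_nonneg _
      simp at this
      linarith [this.1]
    · have h1 := abs_lt.1 (hre s hs i)
      have h2 := abs_lt.1 (hre s hs j)
      rw [h] at h1
      have h3 : ((i : ℕ) : ℝ) < (j : ℕ) + 1 := by linarith [h1.1, h1.2, h2.1, h2.2]
      have h4 : ((j : ℕ) : ℝ) < (i : ℕ) + 1 := by linarith [h1.1, h1.2, h2.1, h2.2]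
      have h5 : (i : ℕ) < j + 1 := by exact_mod_cast h3
      have h6 : (j : ℕ) < i + 1 := by exact_mod_cast h4
      exact Fin.ext (by omega)
  · refine differentiableOn_pi.2 fun i s hs => DifferentiableAt.differentiableWithinAt ?_
    have hsl : s i ∈ Complex.slitPlane := by
      left
      have := abs_lt.1 (hre s hs i)
      have h3 : (0 : ℝ) ≤ (i : ℕ) := Nat.cast_nonneg _
      linarith [this.1]
    have hci : DifferentiableAt ℂ (fun s : Fin N → ℂ => s i) s := by fun_prop
    exact hci.cpow_const hsl
  · intro s hs i
    exact Complex.cpow_nat_inv_pow _ two_ne_zero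


/-! ### Generic regularity -/

theorem IsSolution.hasDerivAt_q {κ : Param N} {U : Set (Fin N → ℂ)}
    {q p : (Fin N → ℂ) → Fin N → ℂ} (h : IsSolution κ U q p) {s : Fin N → ℂ} (hs : s ∈ U)
    (i j : Fin N) : HasDerivAt (fun x => q (Function.update s j x) i)
      (fieldQ κ s (q s) (p s) i j) (s j) := by
  rw [← deriv_hamiltonian_p]; exact h.eq_q s hs i j

theorem IsSolution.hasDerivAt_p {κ : Param N} {U : Set (Fin N → ℂ)}
    {q p : (Fin N → ℂ) → Fin N → ℂ} (h : IsSolution κ U q p) {s : Fin N → ℂ} (hs : s ∈ U)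
    (i j : Fin N) : HasDerivAt (fun x => p (Function.update s j x) i)
      (fieldP κ s (q s) (p s) i j) (s j) := by
  rw [← deriv_hamiltonian_q]; exact h.eq_p s hs i j

theorem deriv_eq_zero_of_const {V : Set (Fin N → ℂ)} (hV : IsOpen V) {F : (Fin N → ℂ) → ℂ} {c : ℂ}
    (hF : ∀ s ∈ V, F s = c) {s : Fin N → ℂ} (hs : s ∈ V) {j : Fin N} {d : ℂ}
    (hd : HasDerivAt (fun x => F (Function.update s j x)) d (s j)) : d = 0 := by
  have hev : ∀ᶠ x in 𝓝 (s j), Function.update s j x ∈ V :=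
    (hasDerivAt_update s j (s j)).continuousAt.eventually
      (hV.mem_nhds (by rwa [Function.update_eq_self]))
  exact hd.unique ((hasDerivAt_const (s j) c).congr_of_eventuallyEq
    (hev.mono fun x hx => hF _ hx))

/-- If finitely many continuous functions have a zero at each point of an open set, then one of
them vanishes on a smaller open set. -/
theorem exists_open_zero {ι X : Type*} [TopologicalSpace X] [Finite ι] {U : Set X} (hU : IsOpen U)
    (hne : U.Nonempty) {F : ι → X → ℂ} (hF : ∀ k, ContinuousOn (F k) U)
    (h0 : ∀ s ∈ U, ∃ k, F k s = 0) :
    ∃ k, ∃ V ⊆ U, IsOpen V ∧ V.Nonempty ∧ ∀ s ∈ V, F k s = 0 := by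
  by_contra! hcon
  have key : ∀ T : Finset ι, ∃ V ⊆ U, IsOpen V ∧ V.Nonempty ∧ ∀ s ∈ V, ∀ k ∈ T, F k s ≠ 0 := by
    classical
    intro T
    induction T using Finset.induction_on with
    | empty => exact ⟨U, subset_rfl, hU, hne, by simp⟩
    | insert k T _ ih =>
      obtain ⟨V, hVU, hV, hVne, hVT⟩ := ih
      obtain ⟨s, hs, hks⟩ := hcon k V hVU hV hVne
      refine ⟨V ∩ F k ⁻¹' {0}ᶜ, Set.inter_subset_left.trans hVU,
        ((hF k).mono hVU).isOpen_inter_preimage hV isOpen_compl_singleton, ⟨s, hs, hks⟩,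
        fun s' hs' j hj => ?_⟩
      rcases Finset.mem_insert.1 hj with rfl | hj
      · exact hs'.2
      · exact hVT s' hs'.1 j hj
  have := Fintype.ofFinite ι
  obtain ⟨V, hVU, hV, ⟨s, hs⟩, hVT⟩ := key Finset.univ
  obtain ⟨k, hk⟩ := h0 s (hVU hs)
  exact hVT s hs k (Finset.mem_univ k) hk

/-- If `q_j` vanished identically, the equations for `∂q_j/∂s_i` would give `R_{ji} θ_j q_i = 0`,
hence `q = 0`, and then the equation for `∂q_j/∂s_j` would reduce to `s_j θ_j = 0`. -/
theorem IsSolution.exists_q_ne {κ : Param N} {U : Set (Fin N → ℂ)}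
    {q p : (Fin N → ℂ) → Fin N → ℂ} (h : IsSolution κ U q p) {j : Fin N}
    (hj : κ (.th j) ≠ 0) : ∃ s ∈ U, q s j ≠ 0 := by
  by_contra! hcon
  obtain ⟨s, hs⟩ := h.isConnected.1
  have hc := h.subset_config hs
  have hf : ∀ i, fieldQ κ s (q s) (p s) j i = 0 := fun i =>
    deriv_eq_zero_of_const h.isOpen hcon hs (h.hasDerivAt_q hs j i)
  have hq0 := hcon s hs
  have hH : spinH κ (q s) (p s) j = -κ (.th j) := by simp [spinH, hq0]
  have hd : ∀ i, s i * (s i - 1) ≠ 0 := fun i =>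
    mul_ne_zero (hc.1 i).1 (sub_ne_zero.2 (hc.1 i).2)
  have hqi : ∀ i, q s i = 0 := by
    intro i
    by_cases hij : j = i
    · rw [← hij]; exact hq0
    have h1 := hf i
    rw [fieldQ, div_eq_zero_iff, or_iff_left (hd i), if_neg hij, hq0, hH] at h1
    have hR : coeffR s j i ≠ 0 := div_ne_zero (mul_ne_zero (hc.1 j).1
      (sub_ne_zero.2 (hc.1 i).2)) (sub_ne_zero.2 (hc.2 i j (Ne.symm hij)))
    have h2 : coeffR s j i * κ (.th j) * q s i = 0 := by linear_combination h1
    exact (mul_eq_zero.1 h2).resolve_left (mul_ne_zero hR hj)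
  have h1 := hf j
  rw [fieldQ, div_eq_zero_iff, or_iff_left (hd j), if_pos rfl, hH] at h1
  simp only [hqi, mul_zero, Finset.sum_const_zero] at h1
  exact mul_ne_zero (hc.1 j).1 hj (by linear_combination -h1)

/-- The exchange of `κ₀` and `θ_m` makes `1 - g_s`, up to a nonvanishing factor, the new `q_m`, so
the previous lemma applies. Without any `θ_m` the sum `g_s` is empty. -/
theorem IsAlgebraicSolution.exists_gs_ne {κ : Param N} {U : Set (Fin N → ℂ)}
    {q p : (Fin N → ℂ) → Fin N → ℂ} (h : IsAlgebraicSolution κ U q p)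
    (h0 : κ .k0 ≠ 0) : ∃ s ∈ U, Pt.gs ⟨q s, p s, s⟩ ≠ 1 := by
  rcases isEmpty_or_nonempty (Fin N) with hN | ⟨⟨m⟩⟩
  · obtain ⟨s, hs⟩ := h.isConnected.1
    exact ⟨s, hs, by simp [Pt.gs]⟩
  obtain ⟨U', q', p', h', hg⟩ := h.transport (.sigma m) fun _ _ => trivial
  have hk : (Gen.sigma m).param κ (.th m) = κ .k0 := by simp [Gen.param]
  obtain ⟨S, hS, hSq⟩ := h'.exists_q_ne (j := m) (by rwa [hk])
  obtain ⟨s, hs, hse⟩ := hg.subset ⟨S, hS, rfl⟩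
  refine ⟨s, hs, fun h1 => hSq ?_⟩
  have := congrFun (congrArg Pt.q hse) m
  simp only [Gen.act, if_true] at this
  rw [← this, h1]; simp

theorem IsAlgebraicSolution.exists_g1_ne {κ : Param N} {U : Set (Fin N → ℂ)}
    {q p : (Fin N → ℂ) → Fin N → ℂ} (h : IsAlgebraicSolution κ U q p)
    (h0 : κ .k1 ≠ 0) : ∃ s ∈ U, Pt.g1 ⟨q s, p s, s⟩ ≠ 1 := by
  obtain ⟨U', q', p', h', hg⟩ := h.transport .sigmaOne fun _ _ => trivial
  have hk : Gen.sigmaOne.param κ .k0 = κ .k1 := by simp [Gen.param]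
  obtain ⟨S, hS, hSq⟩ := h'.exists_gs_ne (by rwa [hk])
  obtain ⟨s, hs, hse⟩ := hg.subset ⟨S, hS, rfl⟩
  refine ⟨s, hs, fun h1 => hSq ?_⟩
  dsimp only at hse
  rw [← hse, ← h1]
  simp only [Pt.gs, Pt.g1, Gen.act]
  exact Finset.sum_congr rfl fun i _ => by
    have := ((h.subset_config hs).1 i).1
    field_simp

theorem IsAlgebraicSolution.exists_refl_regular {κ : Param N} {U : Set (Fin N → ℂ)}
    {q p : (Fin N → ℂ) → Fin N → ℂ} (h : IsAlgebraicSolution κ U q p) (a : Idx N) :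
    ∃ s ∈ U, (Gen.refl a).Regular κ ⟨q s, p s, s⟩ := by
  by_cases ha : κ a = 0
  · obtain ⟨s, hs⟩ := h.isConnected.1
    refine ⟨s, hs, ?_⟩
    cases a with
    | kinf => trivial
    | _ => exact Or.inl ha
  cases a with
  | kinf => exact h.isConnected.1.imp fun s hs => ⟨hs, trivial⟩
  | k0 => exact (h.exists_gs_ne ha).imp fun s hs => ⟨hs.1, Or.inr hs.2⟩
  | k1 => exact (h.exists_g1_ne ha).imp fun s hs => ⟨hs.1, Or.inr hs.2⟩
  | th j => exact (h.exists_q_ne ha).imp fun s hs => ⟨hs.1, Or.inr hs.2⟩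

/-- The point is a zero of all the quantities that carry the irreducible part of the flow. -/
def Degenerate (κ : Param N) (x : Pt N) : Prop :=
  (∀ i, spinF κ x.q x.p i = 0) ∧ spinD κ x.q x.p = 0

/-- The rate of `q_i p_i` in the direction `s_j` involves only `f_i` and `f_j`; so if `q_i p_i` is
constantly `θ_i ≠ 0`, all other `f_j` vanish. -/
theorem moment_field (κ : Param N) {s : Fin N → ℂ} (q p : Fin N → ℂ) {i j : Fin N} (hij : i ≠ j) :
    fieldQ κ s q p i j * p i + q i * fieldP κ s q p i j =
      (-coeffR s i j * q j * spinF κ q p i + coeffS s j i * q i * spinF κ q p j) /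
        (s j * (s j - 1)) := by
  simp only [fieldQ, fieldP, if_neg hij]
  rw [div_mul_eq_mul_div, mul_div_assoc', ← add_div]
  congr 1
  simp only [spinF, spinH]
  ring

/-- One of the finitely many denominators vanishes on an open set. Its derivatives in all directions
`s_j` vanish there too, and the field equations turn this into `f_j = 0` for all `j` and `D = 0`,
whichever denominator it was. -/
theorem IsSolution.degenerate_of_tau {κ : Param N} {U : Set (Fin N → ℂ)}
    {q p : (Fin N → ℂ) → Fin N → ℂ} (h : IsSolution κ U q p)
    (hr : ∀ s ∈ U, ¬Gen.tau.Regular κ ⟨q s, p s, s⟩) :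
    ∃ s ∈ U, Degenerate κ ⟨q s, p s, s⟩ := by
  have hqc := h.differentiableOn_q.continuousOn
  have hpc := h.differentiableOn_p.continuousOn
  have hqi : ∀ i, ContinuousOn (fun s => q s i) U := continuousOn_pi.1 hqc
  have hpi : ∀ i, ContinuousOn (fun s => p s i) U := continuousOn_pi.1 hpc
  set F : Option (Option (Fin N)) → (Fin N → ℂ) → ℂ := fun k s => match k with
    | none => alpha κ + ∑ j, q s j * p s j
    | some none => alpha κ + κ .kinf + ∑ j, q s j * p s j
    | some (some i) => if κ (.th i) = 0 then p s i else q s i * p s i - κ (.th i) with hF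
  have hFc : ∀ k, ContinuousOn (F k) U := by
    rintro (_ | _ | i)
    · exact continuousOn_const.add (continuousOn_finsetSum _ fun i _ => (hqi i).mul (hpi i))
    · exact continuousOn_const.add (continuousOn_finsetSum _ fun i _ => (hqi i).mul (hpi i))
    · simp only [hF]
      split_ifs
      · exact hpi i
      · exact ((hqi i).mul (hpi i)).sub continuousOn_const
  obtain ⟨k, V, hVU, hV, ⟨s, hs⟩, hk⟩ := exists_open_zero h.isOpen h.isConnected.1 hFc (by
    intro s hs
    by_contra! hne
    refine hr s hs ⟨mul_ne_zero (hne none) (hne (some none)), fun i => ?_⟩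
    have := hne (some (some i))
    simp only [hF] at this
    split_ifs at this ⊢ with hθ
    · exact this
    · exact sub_ne_zero.1 this)
  have hsU := hVU hs
  have hc := h.subset_config hsU
  have hd : ∀ i, s i * (s i - 1) ≠ 0 := fun i =>
    mul_ne_zero (hc.1 i).1 (sub_ne_zero.2 (hc.1 i).2)
  have hqp : ∀ i j, HasDerivAt (fun x => q (Function.update s j x) i * p (Function.update s j x) i)
      (fieldQ κ s (q s) (p s) i j * p s i + q s i * fieldP κ s (q s) (p s) i j) (s j) := by
    intro i j
    refine ((h.hasDerivAt_q hsU i j).fun_mul (h.hasDerivAt_p hsU i j)).congr_deriv ?_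
    rw [Function.update_eq_self]
  have hSg : ∀ j, HasDerivAt (fun x => ∑ i, q (Function.update s j x) i *
      p (Function.update s j x) i) ((-q s j * spinD κ (q s) (p s) + s j * spinF κ (q s) (p s) j) /
        (s j * (s j - 1))) (s j) := by
    intro j
    rw [← sum_field_mul κ (q s) (p s) hc j]
    exact HasDerivAt.fun_sum fun i _ => hqp i j
  have hDcase : spinD κ (q s) (p s) = 0 → (∀ j, (-q s j * spinD κ (q s) (p s)
      + s j * spinF κ (q s) (p s) j) / (s j * (s j - 1)) = 0) →
      Degenerate κ ⟨q s, p s, s⟩ := by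
    intro hD h1
    refine ⟨fun j => ?_, hD⟩
    have h2 := h1 j
    rw [hD, div_eq_zero_iff, or_iff_left (hd j)] at h2
    have h3 : s j * spinF κ (q s) (p s) j = 0 := by linear_combination h2
    exact (mul_eq_zero.1 h3).resolve_left (hc.1 j).1
  refine ⟨s, hsU, ?_⟩
  rcases k with _ | _ | i
  · refine hDcase ?_ fun j => deriv_eq_zero_of_const hV hk hs ((hSg j).const_add (alpha κ))
    have := hk s hs
    simp only [hF] at this
    simp [spinD, this]
  · refine hDcase ?_ fun j => deriv_eq_zero_of_const hV hk hs ((hSg j).const_add (alpha κ + κ .kinf))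
    have := hk s hs
    simp only [hF] at this
    simp [spinD, this]
  · simp only [hF] at hk
    by_cases hθ : κ (.th i) = 0
    · simp only [if_pos hθ] at hk
      have hp0 := hk s hs
      have hP : ∀ j, fieldP κ s (q s) (p s) i j = 0 := fun j =>
        deriv_eq_zero_of_const hV hk hs (h.hasDerivAt_p hsU i j)
      have hf : ∀ j, spinF κ (q s) (p s) j = 0 := by
        intro j
        by_cases hij : i = j
        · rw [← hij]; simp [spinF, hp0]
        · have h1 := hP j
          rw [fieldP, div_eq_zero_iff, or_iff_left (hd j), if_neg hij, hp0] at h1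
          have hS : coeffS s j i ≠ 0 := div_ne_zero (hd j)
            (sub_ne_zero.2 (hc.2 j i (Ne.symm hij)))
          have h2 : coeffS s j i * spinF κ (q s) (p s) j = 0 := by linear_combination h1
          exact (mul_eq_zero.1 h2).resolve_left hS
      refine ⟨hf, ?_⟩
      have h1 := hP i
      rw [fieldP, div_eq_zero_iff, or_iff_left (hd i), if_pos rfl, hp0] at h1
      simp only [hf, mul_zero, Finset.sum_const_zero] at h1
      change spinD κ (q s) (p s) = 0
      linear_combination -h1
    · simp only [if_neg hθ] at hk
      have hb := hk s hs
      have hq0 : q s i ≠ 0 := fun h0 => hθ (by rw [h0] at hb; linear_combination -hb)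
      have hfi : spinF κ (q s) (p s) i = 0 := by simp [spinF, hb]
      have hm : ∀ j, fieldQ κ s (q s) (p s) i j * p s i + q s i * fieldP κ s (q s) (p s) i j = 0 :=
        fun j => deriv_eq_zero_of_const hV hk hs ((hqp i j).sub_const (κ (.th i)))
      have hf : ∀ j, spinF κ (q s) (p s) j = 0 := by
        intro j
        by_cases hij : i = j
        · rw [← hij]; exact hfi
        · have h1 := hm j
          rw [moment_field κ (q s) (p s) hij, div_eq_zero_iff, or_iff_left (hd j), hfi] at h1
          have hS : coeffS s j i ≠ 0 := div_ne_zero (hd j)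
            (sub_ne_zero.2 (hc.2 j i (Ne.symm hij)))
          have h2 : coeffS s j i * q s i * spinF κ (q s) (p s) j = 0 := by linear_combination h1
          exact (mul_eq_zero.1 h2).resolve_left (mul_ne_zero hS hq0)
      refine ⟨hf, ?_⟩
      have h1 := sum_field_mul κ (q s) (p s) hc i
      rw [Finset.sum_eq_zero, eq_comm, div_eq_zero_iff, or_iff_left (hd i), hfi] at h1
      · change spinD κ (q s) (p s) = 0
        have h2 : q s i * spinD κ (q s) (p s) = 0 := by linear_combination -h1
        exact (mul_eq_zero.1 h2).resolve_left hq0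
      · intro k _
        by_cases hki : k = i
        · rw [hki]; exact hm i
        · rw [moment_field κ (q s) (p s) hki, hf, hf]; simp

/-- A relation `κ₀ + κ₁ ± κ_∞ ± θ₁ ± ⋯ ± θ_N = 1`. -/
def Resonant (κ : Param N) : Prop :=
  ∃ (ε : ℤˣ) (η : Fin N → ℤˣ),
    κ .k0 + κ .k1 + ((ε : ℤ) : ℂ) * κ .kinf + ∑ i, ((η i : ℤ) : ℂ) * κ (.th i) = 1

/-- `f_i = 0` means that `q_i p_i` is 0 or `θ_i` wherever it matters, and `D = 0` that `∑ q_k p_k`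
is `-α` or `-α - κ_∞`. Each alternative is the choice of a sign, and the definition of `α` combines
them into the relation. -/
theorem Degenerate.resonant {κ : Param N} {x : Pt N} (h : Degenerate κ x) : Resonant κ := by
  obtain ⟨hf, hD⟩ := h
  have h1 : ∀ i, ∃ η : ℤˣ, 2 * (x.q i * x.p i) = κ (.th i) - ((η : ℤ) : ℂ) * κ (.th i) := by
    intro i
    rcases mul_eq_zero.1 (hf i) with h0 | h0
    · exact ⟨1, by rw [h0]; simp⟩
    · exact ⟨-1, by push_cast; linear_combination 2 * h0⟩
  choose η hη using h1
  have hS : 2 * ∑ i, x.q i * x.p i =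
      ∑ i, κ (.th i) - ∑ i, ((η i : ℤ) : ℂ) * κ (.th i) := by
    rw [Finset.mul_sum, ← Finset.sum_sub_distrib]
    exact Finset.sum_congr rfl fun i _ => hη i
  have hα := two_mul_alpha κ
  rcases mul_eq_zero.1 hD with h0 | h0
  · exact ⟨1, η, by push_cast; linear_combination -2 * h0 + hS + hα⟩
  · exact ⟨-1, η, by push_cast; linear_combination -2 * h0 + hS + hα⟩


/-! ### Words and families of solutions -/

theorem IsAlgebraicSolution.mono {κ : Param N} {U V : Set (Fin N → ℂ)}
    {q p : (Fin N → ℂ) → Fin N → ℂ} (h : IsAlgebraicSolution κ U q p) (hVU : V ⊆ U)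
    (hV : IsOpen V) (hc : IsConnected V) : IsAlgebraicSolution κ V q p where
  isOpen := hV
  isConnected := hc
  subset_config := hVU.trans h.subset_config
  differentiableOn_q := h.differentiableOn_q.mono hVU
  differentiableOn_p := h.differentiableOn_p.mono hVU
  eq_q s hs := h.eq_q s (hVU hs)
  eq_p s hs := h.eq_p s (hVU hs)
  algebraic_q i := (h.algebraic_q i).mono hVU
  algebraic_p i := (h.algebraic_p i).mono hVU

theorem exists_ball_subset {V : Set (Fin N → ℂ)} {s : Fin N → ℂ} (h : V ∈ 𝓝 s) :
    ∃ W ⊆ V, IsOpen W ∧ IsConnected W ∧ s ∈ W := by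
  obtain ⟨ε, hε, hb⟩ := Metric.mem_nhds_iff.1 h
  exact ⟨Metric.ball s ε, hb, Metric.isOpen_ball,
    ⟨⟨s, Metric.mem_ball_self hε⟩, (convex_ball s ε).isPreconnected⟩, Metric.mem_ball_self hε⟩

theorem IsSolution.eventually_regular {κ : Param N} {U : Set (Fin N → ℂ)}
    {q p : (Fin N → ℂ) → Fin N → ℂ} (h : IsSolution κ U q p) {g : Gen N} {s : Fin N → ℂ}
    (hs : s ∈ U) (hr : g.Regular κ ⟨q s, p s, s⟩) :
    ∀ᶠ s' in 𝓝 s, s' ∈ U ∧ g.Regular κ ⟨q s', p s', s'⟩ := by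
  have hU := h.isOpen.mem_nhds hs
  refine (eventually_mem_set.2 hU).and ?_
  have hq : ∀ i, ContinuousAt (fun s => q s i) s := fun i =>
    continuousAt_pi.1 (h.differentiableOn_q.continuousOn.continuousAt hU) i
  have hp : ∀ i, ContinuousAt (fun s => p s i) s := fun i =>
    continuousAt_pi.1 (h.differentiableOn_p.continuousOn.continuousAt hU) i
  have h0 := fun i => ((h.subset_config hs).1 i).1
  have hg1 : ContinuousAt (fun s => Pt.g1 ⟨q s, p s, s⟩) s :=
    tendsto_finsetSum _ fun i _ => hq i
  have hgs : ContinuousAt (fun s => Pt.gs ⟨q s, p s, s⟩) s :=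
    tendsto_finsetSum _ fun i _ => (hq i).div₀ (continuous_apply i).continuousAt (h0 i)
  have hSg : ContinuousAt (fun s => ∑ i, q s i * p s i) s :=
    tendsto_finsetSum _ fun i _ => (hq i).mul (hp i)
  rcases g with m | _ | _ | (_ | _ | _ | j) | _
  · exact Eventually.of_forall fun _ => trivial
  · exact Eventually.of_forall fun _ => trivial
  · exact hg1.eventually_ne hr
  · rcases hr with hr | hr
    · exact Eventually.of_forall fun _ => Or.inl hr
    · exact (hgs.eventually_ne hr).mono fun _ => Or.inr
  · rcases hr with hr | hr
    · exact Eventually.of_forall fun _ => Or.inl hr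
    · exact (hg1.eventually_ne hr).mono fun _ => Or.inr
  · exact Eventually.of_forall fun _ => trivial
  · rcases hr with hr | hr
    · exact Eventually.of_forall fun _ => Or.inl hr
    · exact ((hq j).eventually_ne hr).mono fun _ => Or.inr
  · refine ContinuousAt.eventually_ne (g := fun s => Pt.den κ ⟨q s, p s, s⟩) ?_ hr.1 |>.and
      (eventually_all.2 fun i => ?_)
    · exact (continuousAt_const.add hSg).mul (continuousAt_const.add hSg)
    · have := hr.2 i
      split_ifs at this ⊢
      · exact (hp i).eventually_ne this
      · exact ((hq i).mul (hp i)).eventually_ne this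

theorem IsAlgebraicSolution.transport_word (w : List (Gen N)) {κ : Param N}
    {U : Set (Fin N → ℂ)} {q p : (Fin N → ℂ) → Fin N → ℂ} (h : IsAlgebraicSolution κ U q p)
    (hr : ∀ s ∈ U, WordRegular w κ ⟨q s, p s, s⟩) :
    ∃ (U' : Set (Fin N → ℂ)) (q' p' : (Fin N → ℂ) → Fin N → ℂ),
      IsAlgebraicSolution (wordParam w κ) U' q' p' ∧
      (fun s => (⟨q' s, p' s, s⟩ : Pt N)) '' U' = (fun s => wordAct w κ ⟨q s, p s, s⟩) '' U := by
  induction w generalizing κ U q p with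
  | nil => exact ⟨U, q, p, h, rfl⟩
  | cons g w ih =>
    obtain ⟨U1, q1, p1, h1, hg1⟩ := h.transport g fun s hs => (hr s hs).1
    obtain ⟨U2, q2, p2, h2, hg2⟩ := ih h1 fun S hS => by
      obtain ⟨s, hs, hse⟩ := hg1.subset ⟨S, hS, rfl⟩
      dsimp only at hse
      rw [← hse]
      exact (hr s hs).2
    refine ⟨U2, q2, p2, h2, hg2.trans ?_⟩
    have := congrArg (fun A => wordAct w (g.param κ) '' A) hg1
    simp only [Set.image_image] at this
    exact this

theorem wordParam_append (w : List (Gen N)) (g : Gen N) (κ : Param N) :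
    wordParam (w ++ [g]) κ = g.param (wordParam w κ) := by
  induction w generalizing κ with
  | nil => rfl
  | cons a w ih => exact ih _

theorem wordAct_append (w : List (Gen N)) (g : Gen N) (κ : Param N) (x : Pt N) :
    wordAct (w ++ [g]) κ x = g.act (wordParam w κ) (wordAct w κ x) := by
  induction w generalizing κ x with
  | nil => rfl
  | cons a w ih => exact ih _ _

theorem wordRegular_append (w : List (Gen N)) (g : Gen N) (κ : Param N) (x : Pt N) :
    WordRegular (w ++ [g]) κ x ↔
      WordRegular w κ x ∧ g.Regular (wordParam w κ) (wordAct w κ x) := by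
  induction w generalizing κ x with
  | nil => simp [WordRegular, wordParam, wordAct]
  | cons a w ih => simp only [List.cons_append, WordRegular, ih, and_assoc]; rfl

/-- The independent variables are transformed without reference to `κ`, `q`, `p`; continuity of this
map lets neighbourhoods be pulled back to the domain of the seed. -/
theorem exists_word_mapS (w : List (Gen N)) :
    ∃ ψ : (Fin N → ℂ) → Fin N → ℂ, ContinuousOn ψ (config N) ∧
      ∀ (κ : Param N) (x : Pt N), (wordAct w κ x).s = ψ x.s := by
  induction w with
  | nil => exact ⟨id, continuousOn_id, fun κ x => rfl⟩
  | cons g w ih =>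
    obtain ⟨ψ, hψ, h⟩ := ih
    refine ⟨ψ ∘ g.mapS, hψ.comp g.mapS_differentiableOn.continuousOn fun s hs => g.mapS_mem hs,
      fun κ x => ?_⟩
    rw [wordAct, h, g.act_s]; rfl

/-- A class of algebraic solutions that is stable under the generators. -/
structure StepClosed (𝓕 : Param N → Set (Fin N → ℂ) → ((Fin N → ℂ) → Fin N → ℂ) →
    ((Fin N → ℂ) → Fin N → ℂ) → Prop) : Prop where
  sol : ∀ {κ U q p}, 𝓕 κ U q p → IsAlgebraicSolution κ U q p
  step : ∀ {κ U q p}, 𝓕 κ U q p → ∀ (g : Gen N), ∀ s ∈ U, g.Regular κ ⟨q s, p s, s⟩ →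
    ∃ U' q' p', 𝓕 (g.param κ) U' q' p' ∧ ∀ S ∈ U', ∃ s ∈ U, g.Regular κ ⟨q s, p s, s⟩ ∧
      (⟨q' S, p' S, S⟩ : Pt N) = g.act κ ⟨q s, p s, s⟩

theorem stepClosed_isAlgebraicSolution : StepClosed (N := N) IsAlgebraicSolution where
  sol := id
  step {κ U q p} h g s hs hr := by
    obtain ⟨V, hV, hVo, hVc, hsV⟩ := exists_ball_subset (h.eventually_regular hs hr)
    obtain ⟨U', q', p', h', hg⟩ := (h.mono (fun s hs => (hV hs).1) hVo hVc).transport g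
      fun s hs => (hV hs).2
    refine ⟨U', q', p', h', fun S hS => ?_⟩
    obtain ⟨s, hs, hse⟩ := hg.subset ⟨S, hS, rfl⟩
    exact ⟨s, (hV hs).1, (hV hs).2, hse.symm⟩

theorem IsSqrtBranch.mono {U V : Set (Fin N → ℂ)} {t : (Fin N → ℂ) → Fin N → ℂ}
    (h : IsSqrtBranch U t) (hVU : V ⊆ U) (hV : IsOpen V) (hc : IsConnected V) :
    IsSqrtBranch V t :=
  ⟨hV, hc, hVU.trans h.subset_config, h.differentiableOn.mono hVU, fun s hs => h.sq_eq s (hVU hs)⟩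

/-- The word is extended by `g`. The domain of the seed is shrunk around a preimage of the given
point, so that `g` is regular on its image; the equality of graphs identifies the values there with
those of `q` and `p`. -/
theorem stepClosed_obtainedFromSeed : StepClosed (N := N) fun κ U q p =>
    IsAlgebraicSolution κ U q p ∧ ObtainedFromSeed κ U q p where
  sol h := h.1
  step {κ U q p} h g s hs hr := by
    obtain ⟨h, w, κ', V, t, hseed, rfl, ht, hw, hgr⟩ := h
    obtain ⟨v, hv, hvs⟩ := hgr.subset ⟨s, hs, rfl⟩
    obtain ⟨ψ, hψ, hψs⟩ := exists_word_mapS (N := N) w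
    have hsv : s = ψ v := by
      rw [← hψs κ' ⟨seedQ κ' (t v), seedP κ' (t v), v⟩]
      exact (congrArg Pt.s hvs).symm
    have hcont : ContinuousAt ψ v :=
      hψ.continuousAt (isOpen_config.mem_nhds (ht.subset_config hv))
    have hev := hcont.eventually (hsv ▸ h.eventually_regular hs hr)
    obtain ⟨V', hV', hVo, hVc, -⟩ := exists_ball_subset
      ((eventually_mem_set.2 (ht.isOpen.mem_nhds hv)).and hev)
    have hreg : ∀ v' ∈ V', ∃ s' ∈ U, g.Regular (wordParam w κ') ⟨q s', p s', s'⟩ ∧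
        (⟨q s', p s', s'⟩ : Pt N) = wordAct w κ' ⟨seedQ κ' (t v'), seedP κ' (t v'), v'⟩ := by
      intro v' hv'
      obtain ⟨s', hs', hse⟩ := hgr.superset ⟨v', (hV' hv').1, rfl⟩
      have : s' = ψ v' := by
        rw [← hψs κ' ⟨seedQ κ' (t v'), seedP κ' (t v'), v'⟩]
        exact congrArg Pt.s hse
      refine ⟨s', hs', ?_, hse⟩
      rw [this]
      exact (hV' hv').2.2
    have ht' := ht.mono (fun v' hv' => (hV' hv').1) hVo hVc
    have hw' : ∀ v' ∈ V', WordRegular (w ++ [g]) κ'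
        ⟨seedQ κ' (t v'), seedP κ' (t v'), v'⟩ := by
      intro v' hv'
      rw [wordRegular_append]
      refine ⟨hw v' (hV' hv').1, ?_⟩
      obtain ⟨s', -, hr', he'⟩ := hreg v' hv'
      rwa [← he']
    obtain ⟨U', q', p', h', hg⟩ := (seed_isAlgebraicSolution hseed ht').transport_word _ hw'
    rw [wordParam_append] at h'
    refine ⟨U', q', p', ⟨h', w ++ [g], κ', V', t, hseed, wordParam_append _ _ _, ht', hw', hg⟩,
      fun S hS => ?_⟩
    obtain ⟨v', hv', hve⟩ := hg.subset ⟨S, hS, rfl⟩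
    obtain ⟨s', hs', hr', he'⟩ := hreg v' hv'
    refine ⟨s', hs', hr', ?_⟩
    dsimp only at hve
    rw [← hve, wordAct_append, he']

section Moves

variable {𝓕 : Param N → Set (Fin N → ℂ) → ((Fin N → ℂ) → Fin N → ℂ) →
    ((Fin N → ℂ) → Fin N → ℂ) → Prop}

/-- The class `𝓕` has a member with the parameter `κ`. -/
def Has (𝓕 : Param N → Set (Fin N → ℂ) → ((Fin N → ℂ) → Fin N → ℂ) →
    ((Fin N → ℂ) → Fin N → ℂ) → Prop) (κ : Param N) : Prop := ∃ U q p, 𝓕 κ U q p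

theorem StepClosed.has_step (H : StepClosed 𝓕) {κ : Param N} {U : Set (Fin N → ℂ)}
    {q p : (Fin N → ℂ) → Fin N → ℂ} (h : 𝓕 κ U q p) {g : Gen N}
    (hr : ∃ s ∈ U, g.Regular κ ⟨q s, p s, s⟩) : Has 𝓕 (g.param κ) := by
  obtain ⟨s, hs, hr⟩ := hr
  obtain ⟨U', q', p', h', -⟩ := H.step h g s hs hr
  exact ⟨U', q', p', h'⟩

theorem StepClosed.has_refl (H : StepClosed 𝓕) {κ : Param N} (h : Has 𝓕 κ) (a : Idx N) :
    Has 𝓕 (Function.update κ a (-κ a)) := by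
  obtain ⟨U, q, p, h⟩ := h
  exact H.has_step (g := .refl a) h ((H.sol h).exists_refl_regular a)

theorem StepClosed.has_swap_k0 (H : StepClosed 𝓕) {κ : Param N} (h : Has 𝓕 κ) {a : Idx N}
    (ha : a ≠ .kinf) : Has 𝓕 (κ ∘ Equiv.swap .k0 a) := by
  obtain ⟨U, q, p, h'⟩ := h
  obtain ⟨s, hs⟩ := (H.sol h').isConnected.1
  cases a with
  | kinf => exact absurd rfl ha
  | k0 => rw [Equiv.swap_self]; exact ⟨U, q, p, h'⟩
  | k1 => exact H.has_step (g := .sigmaOne) h' ⟨s, hs, trivial⟩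
  | th m => exact H.has_step (g := .sigma m) h' ⟨s, hs, trivial⟩

theorem StepClosed.has_swap_of_ne (H : StepClosed 𝓕) {κ : Param N} (h : Has 𝓕 κ) {a b : Idx N}
    (ha : a ≠ .kinf) (hb : b ≠ .kinf) : Has 𝓕 (κ ∘ Equiv.swap a b) := by
  by_cases hab : a = b
  · rw [hab, Equiv.swap_self]; exact h
  by_cases ha0 : a = .k0
  · rw [ha0]; exact H.has_swap_k0 h hb
  by_cases hb0 : b = .k0
  · rw [hb0, Equiv.swap_comm]; exact H.has_swap_k0 h ha
  have h3 := H.has_swap_k0 (H.has_swap_k0 (H.has_swap_k0 h ha) hb) ha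
  convert h3 using 1
  rw [Function.comp_assoc, Function.comp_assoc]
  congr 1
  rw [← Equiv.Perm.coe_mul, ← Equiv.Perm.coe_mul, Equiv.swap_comm .k0 b,
    ← mul_assoc, Equiv.swap_mul_swap_mul_swap hb0 (Ne.symm hab)]

/-- `sigmaInf` needs `g₁ ≠ 1`, which holds somewhere as soon as `κ₁ ≠ 0`. So `κ_∞` is exchanged with
the component `c` by conjugating `sigmaInf` with the unconditional exchange of `κ₁` and `c`,
provided `κ c ≠ 0`. Assuming both components nonzero keeps the statement symmetric. -/
theorem StepClosed.has_swap (H : StepClosed 𝓕) {κ : Param N} (h : Has 𝓕 κ) {a b : Idx N}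
    (ha : κ a ≠ 0) (hb : κ b ≠ 0) : Has 𝓕 (κ ∘ Equiv.swap a b) := by
  have key : ∀ {c : Idx N}, κ c ≠ 0 → Has 𝓕 (κ ∘ Equiv.swap .kinf c) := by
    intro c hc
    by_cases hci : c = .kinf
    · rw [hci, Equiv.swap_self]; exact h
    obtain ⟨U, q, p, h1⟩ := H.has_swap_of_ne h (a := .k1) (by simp) hci
    have h2 := H.has_step (g := .sigmaInf) h1 ((H.sol h1).exists_g1_ne (by simpa using hc))
    have h3 := H.has_swap_of_ne h2 (a := .k1) (by simp) hci
    convert h3 using 1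
    change _ = ((κ ∘ Equiv.swap .k1 c) ∘ Equiv.swap .k1 .kinf) ∘ Equiv.swap .k1 c
    by_cases hc1 : c = .k1
    · subst hc1
      rw [Equiv.swap_self, Equiv.swap_comm]; rfl
    rw [Function.comp_assoc, Function.comp_assoc]
    congr 1
    rw [← Equiv.Perm.coe_mul, ← Equiv.Perm.coe_mul, Equiv.swap_comm Idx.k1 Idx.kinf,
      ← mul_assoc, Equiv.swap_mul_swap_mul_swap (by simp) (Ne.symm hci), Equiv.swap_comm]
  by_cases hai : a = .kinf
  · rw [hai]; exact key hb
  by_cases hbi : b = .kinf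
  · rw [hbi, Equiv.swap_comm]; exact key ha
  exact H.has_swap_of_ne h hai hbi

theorem StepClosed.has_tau (H : StepClosed 𝓕) {κ : Param N} (h : Has 𝓕 κ) (hκ : ¬Resonant κ) :
    Has 𝓕 (Gen.tau.param κ) := by
  obtain ⟨U, q, p, h⟩ := h
  refine H.has_step h ?_
  by_contra! hr
  obtain ⟨s, -, hs⟩ := (H.sol h).degenerate_of_tau hr
  exact hκ hs.resonant

end Moves


/-! ### The Riccati equation of the linear system -/

/-- The right hand side of the Riccati equation, homogenized: `η = a / b`. -/
def riccati (θ u e y : Site N → ℂ) (a b z : ℂ) : ℂ :=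
  ∑ c, (a - y c * b) * (e c * (a - y c * b) + θ c * b) / (z - u c)

theorem riccati_reflect {θ u e y : Site N → ℂ} {d : Site N} (hd : e d ≠ 0) (a b z : ℂ) :
    riccati (Function.update θ d (-θ d)) u e (Function.update y d (y d - θ d / e d)) a b z =
      riccati θ u e y a b z := by
  refine Finset.sum_congr rfl fun c _ => ?_
  by_cases hc : c = d
  · subst hc
    rw [Function.update_self, Function.update_self]
    congr 1
    field_simp
    ring
  · rw [Function.update_of_ne hc, Function.update_of_ne hc]

theorem riccati_shift (θ u e y : Site N → ℂ) (k a b z : ℂ) :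
    riccati θ u e (fun c => y c - k) (a - k * b) b z = riccati θ u e y a b z := by
  refine Finset.sum_congr rfl fun c _ => ?_
  congr 1
  ring

/-- The point carries a solution of its Riccati equation that is rational in `w = √z` but not
in `z`. -/
def Dihedral (κ : Param N) (x : Pt N) : Prop :=
  ∃ A B : Polynomial ℂ, A * B.comp (-Polynomial.X) - A.comp (-Polynomial.X) * B ≠ 0 ∧
    ∀ w : ℂ, (∀ c, w ^ 2 - siteU x.s c ≠ 0) →
      (A.derivative * B - A * B.derivative).eval w =
        2 * w * riccati (siteTh κ) (siteU x.s) (siteE x.s x.q) (siteY κ x.s x.q x.p)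
          (A.eval w) (B.eval w) (w ^ 2)

theorem siteEY_sum (κ : Param N) {x : Pt N} (hs : x.s ∈ config N) :
    ∑ c, siteE x.s x.q c * siteY κ x.s x.q x.p c = -alpha κ := by
  rw [Fintype.sum_option, Fintype.sum_option]
  simp only [siteE, siteY]
  rw [Finset.sum_congr rfl fun i _ => show x.q i / x.s i * (x.s i * x.p i) = x.q i * x.p i by
    have := (hs.1 i).1
    field_simp]
  ring

theorem siteEU_sum {x : Pt N} (hs : x.s ∈ config N) :
    ∑ c, siteE x.s x.q c * siteU x.s c = x.g1 - 1 := by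
  rw [Fintype.sum_option, Fintype.sum_option]
  simp only [siteE, siteU]
  rw [Finset.sum_congr rfl fun i _ => show x.q i / x.s i * x.s i = x.q i by
    have := (hs.1 i).1
    field_simp, Pt.g1]
  ring

theorem siteTh_sum (κ : Param N) : ∑ c, siteTh κ c = 1 - κ .k1 - 2 * alpha κ := by
  rw [Fintype.sum_option, Fintype.sum_option, two_mul_alpha]
  simp only [siteTh, siteIdx]
  ring

theorem siteY_refl_k1 (κ : Param N) {x : Pt N} (hg : x.g1 ≠ 1) (c : Site N) :
    siteY ((Gen.refl .k1).param κ) x.s x.q ((Gen.refl .k1).act κ x).p c =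
      siteY κ x.s x.q x.p c + -κ .k1 / (x.g1 - 1) * siteU x.s c := by
  have hg' : x.g1 - 1 ≠ 0 := sub_ne_zero.2 hg
  rcases c with _ | _ | i
  · simp [siteY, siteU]
  · simp only [siteY, siteU, Gen.param, alpha_update_neg, Gen.act, mul_sub,
      Finset.sum_sub_distrib, ← Finset.sum_mul]
    change _ + (_ - x.g1 * _) = _
    field_simp
    ring
  · simp only [siteY, siteU, Gen.act]
    ring

theorem siteTh_refl_k1 (κ : Param N) : siteTh ((Gen.refl .k1).param κ) = siteTh κ := by
  funext c
  rcases c with _ | _ | i <;> simp [siteTh, siteIdx, Gen.param]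

/-- The reflection at infinity is the gauge transformation `η ↦ η + d z` with `d = -κ₁ / (g₁ - 1)`.
The terms without poles are evaluated by the sums of `e`, `e y`, `e u` and `θ`, and the surplus `d b
^ 2` is the derivative of `d z`. -/
theorem riccati_refl_k1 (κ : Param N) {x : Pt N} (hs : x.s ∈ config N) (hg : x.g1 ≠ 1)
    {a b z : ℂ} (hz : ∀ c, z - siteU x.s c ≠ 0) :
    riccati (siteTh ((Gen.refl .k1).param κ)) (siteU x.s) (siteE x.s x.q)
        (siteY ((Gen.refl .k1).param κ) x.s x.q ((Gen.refl .k1).act κ x).p)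
        (a + -κ .k1 / (x.g1 - 1) * z * b) b z =
      riccati (siteTh κ) (siteU x.s) (siteE x.s x.q) (siteY κ x.s x.q x.p) a b z
        + -κ .k1 / (x.g1 - 1) * b ^ 2 := by
  have hg' : x.g1 - 1 ≠ 0 := sub_ne_zero.2 hg
  rw [siteTh_refl_k1]
  set d := -κ .k1 / (x.g1 - 1) with hd
  have h1 : ∀ c, (a + d * z * b - siteY ((Gen.refl .k1).param κ) x.s x.q
        ((Gen.refl .k1).act κ x).p c * b) *
      (siteE x.s x.q c * (a + d * z * b - siteY ((Gen.refl .k1).param κ) x.s x.q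
        ((Gen.refl .k1).act κ x).p c * b) + siteTh κ c * b) / (z - siteU x.s c) =
      (a - siteY κ x.s x.q x.p c * b) * (siteE x.s x.q c * (a - siteY κ x.s x.q x.p c * b)
          + siteTh κ c * b) / (z - siteU x.s c)
        + (2 * d * b * a * siteE x.s x.q c
          - 2 * d * b ^ 2 * (siteE x.s x.q c * siteY κ x.s x.q x.p c)
          + d * b ^ 2 * siteTh κ c + d ^ 2 * b ^ 2 * z * siteE x.s x.q c
          - d ^ 2 * b ^ 2 * (siteE x.s x.q c * siteU x.s c)) := by
    intro c
    have := hz c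
    rw [siteY_refl_k1 κ hg c, ← hd]
    field_simp
    ring
  simp only [riccati]
  rw [Finset.sum_congr rfl fun c _ => h1 c, Finset.sum_add_distrib]
  congr 1
  simp only [Finset.sum_add_distrib, Finset.sum_sub_distrib, ← Finset.mul_sum, siteE_sum,
    siteEY_sum κ hs, siteEU_sum hs, siteTh_sum]
  have : d * (x.g1 - 1) = -κ .k1 := by rw [hd]; field_simp
  linear_combination -d * b ^ 2 * this

/-- On solutions of the Riccati equation `R_τ` acts by `η ↦ -D z / η`; the last term on the right
comes from differentiating the factor `z`. -/
theorem riccati_tau (κ : Param N) {x : Pt N} (hs : x.s ∈ config N) (hr : Gen.tau.Regular κ x)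
    {a b z : ℂ} (hz : ∀ c, z - siteU x.s c ≠ 0) :
    riccati (siteTh (Gen.tau.param κ)) (siteU x.s) (siteE x.s (Gen.tau.act κ x).q)
        (siteY (Gen.tau.param κ) x.s (Gen.tau.act κ x).q (Gen.tau.act κ x).p)
        (-x.den κ * z * b) a z =
      x.den κ * z * riccati (siteTh κ) (siteU x.s) (siteE x.s x.q) (siteY κ x.s x.q x.p) a b z
        - x.den κ * a * b := by
  have hz0 : z ≠ 0 := by simpa [siteU] using hz none
  have hz1 : z - 1 ≠ 0 := by simpa [siteU] using hz (some none)
  have hD : x.den κ ≠ 0 := hr.1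
  have hDe : x.den κ = (alpha κ + ∑ j, x.q j * x.p j) *
    (alpha κ + κ .kinf + ∑ j, x.q j * x.p j) := rfl
  have hm := tau_mul κ hs hr
  have hF := tau_spinF κ hs hr
  simp only [riccati, Fintype.sum_option]
  have h1 : ∀ i, (-x.den κ * z * b - siteY (Gen.tau.param κ) x.s (Gen.tau.act κ x).q
        (Gen.tau.act κ x).p (some (some i)) * a) *
      (siteE x.s (Gen.tau.act κ x).q (some (some i)) * (-x.den κ * z * b -
        siteY (Gen.tau.param κ) x.s (Gen.tau.act κ x).q (Gen.tau.act κ x).p (some (some i)) * a)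
        + siteTh (Gen.tau.param κ) (some (some i)) * a) / (z - siteU x.s (some (some i))) =
      x.den κ * z * ((a - siteY κ x.s x.q x.p (some (some i)) * b) *
        (siteE x.s x.q (some (some i)) * (a - siteY κ x.s x.q x.p (some (some i)) * b)
          + siteTh κ (some (some i)) * b) / (z - siteU x.s (some (some i))))
      + x.den κ * z * b ^ 2 * spinF κ x.q x.p i - x.den κ * a ^ 2 * (x.q i / x.s i) := by
    intro i
    have h0 := (hs.1 i).1
    have hzi : z - x.s i ≠ 0 := by simpa [siteU] using hz (some (some i))
    have hFi := hF i
    have hmi := hm i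
    have hQ := tau_q κ (x := x) i
    simp only [siteY, siteE, siteTh, siteIdx, siteU]
    simp only [spinF] at hFi hQ ⊢
    have ht : Gen.tau.param κ (.th i) = -κ (.th i) := rfl
    rw [ht] at hFi ⊢
    have e1 : (-x.den κ * z * b - x.s i * (Gen.tau.act κ x).p i * a) *
        ((Gen.tau.act κ x).q i / x.s i *
          (-x.den κ * z * b - x.s i * (Gen.tau.act κ x).p i * a) + -κ (.th i) * a) =
        x.den κ ^ 2 * z ^ 2 * b ^ 2 * ((Gen.tau.act κ x).q i / x.s i)
        + x.den κ * z * b * a * (2 * ((Gen.tau.act κ x).q i * (Gen.tau.act κ x).p i) + κ (.th i))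
        + x.s i * a ^ 2 * ((Gen.tau.act κ x).p i *
          ((Gen.tau.act κ x).q i * (Gen.tau.act κ x).p i - -κ (.th i))) := by
      field_simp
      ring
    rw [e1, hFi, hmi, hQ]
    field_simp
    ring
  rw [Finset.sum_congr rfl fun i _ => h1 i, Finset.sum_sub_distrib, Finset.sum_add_distrib,
    ← Finset.mul_sum, ← Finset.mul_sum, ← Finset.mul_sum]
  have hα := alpha_tau κ
  have hQs : ∑ i, (Gen.tau.act κ x).q i / x.s i = (∑ i, spinF κ x.q x.p i) / x.den κ := by
    rw [Finset.sum_div]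
    refine Finset.sum_congr rfl fun i _ => ?_
    rw [tau_q]
    have := (hs.1 i).1
    field_simp
  have hk0 : Gen.tau.param κ .k0 = -κ .k0 + 1 := rfl
  have hki : Gen.tau.param κ .kinf = -κ .kinf := rfl
  simp only [siteY, siteE, siteTh, siteIdx, siteU, hm, hα, hQs, hk0, hki, Finset.sum_neg_distrib]
  generalize (∑ i, (a - x.s i * x.p i * b) * (x.q i / x.s i * (a - x.s i * x.p i * b)
    + κ (.th i) * b) / (z - x.s i)) = T
  generalize ∑ i, spinF κ x.q x.p i = F
  generalize ∑ i, x.q i / x.s i = E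
  generalize hSg : ∑ i, x.q i * x.p i = S at hDe ⊢
  generalize x.den κ = D at *
  have e2 : (-D * z * b - (-alpha κ + -S) * a) * (-1 * (-D * z * b - (-alpha κ + -S) * a)
      + -κ .kinf * a) / (z - 1) =
      D * z * ((a - (alpha κ + S) * b) * (-1 * (a - (alpha κ + S) * b) + κ .kinf * b) / (z - 1))
      - D ^ 2 * z * b ^ 2 + D * a ^ 2 := by
    field_simp
    rw [hDe]
    ring
  rw [e2]
  field_simp
  ring

theorem Dihedral.tau {κ : Param N} {x : Pt N} (h : Dihedral κ x) (hs : x.s ∈ config N)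
    (hr : Gen.tau.Regular κ x) : Dihedral (Gen.tau.param κ) (Gen.tau.act κ x) := by
  obtain ⟨A, B, hne, hw⟩ := h
  refine ⟨Polynomial.C (-x.den κ) * Polynomial.X ^ 2 * B, A, ?_, fun w hwu => ?_⟩
  · have : Polynomial.C (-x.den κ) * Polynomial.X ^ 2 * B * A.comp (-Polynomial.X)
        - (Polynomial.C (-x.den κ) * Polynomial.X ^ 2 * B).comp (-Polynomial.X) * A =
        Polynomial.C (x.den κ) * Polynomial.X ^ 2 *
          (A * B.comp (-Polynomial.X) - A.comp (-Polynomial.X) * B) := by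
      simp only [Polynomial.mul_comp, Polynomial.C_comp, Polynomial.pow_comp, Polynomial.X_comp]
      rw [map_neg]
      ring
    rw [this]
    exact mul_ne_zero (mul_ne_zero (Polynomial.C_ne_zero.2 hr.1)
      (pow_ne_zero 2 Polynomial.X_ne_zero)) hne
  · have h1 := riccati_tau κ hs hr (a := A.eval w) (b := B.eval w) hwu
    have h2 := hw w hwu
    have hs' : (Gen.tau.act κ x).s = x.s := rfl
    rw [hs']
    simp only [Polynomial.eval_sub, Polynomial.eval_mul, Polynomial.derivative_mul,
      Polynomial.derivative_C, Polynomial.derivative_X_pow, Polynomial.eval_add,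
      Polynomial.eval_C, Polynomial.eval_pow, Polynomial.eval_X, Polynomial.eval_zero] at h2 ⊢
    rw [h1]
    push_cast
    linear_combination x.den κ * w ^ 2 * h2

theorem riccati_refl_k0 (κ : Param N) {x : Pt N} (hs : x.s ∈ config N)
    (hg : siteE x.s x.q none ≠ 0) (a b z : ℂ) :
    riccati (siteTh ((Gen.refl .k0).param κ)) (siteU x.s) (siteE x.s x.q)
        (siteY ((Gen.refl .k0).param κ) x.s x.q ((Gen.refl .k0).act κ x).p)
        (a - -(κ .k0 / siteE x.s x.q none) * b) b z =
      riccati (siteTh κ) (siteU x.s) (siteE x.s x.q) (siteY κ x.s x.q x.p) a b z := by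
  have hT : siteTh ((Gen.refl .k0).param κ) = Function.update (siteTh κ) none (-siteTh κ none) :=
    siteTh_update κ none _
  rw [funext (siteY_refl_k0 κ hs hg), riccati_shift, hT, riccati_reflect hg]

theorem Dihedral.refl {κ : Param N} {x : Pt N} (h : Dihedral κ x) (hs : x.s ∈ config N)
    (a : Idx N) (hr : (Gen.refl a).Regular κ x) :
    Dihedral ((Gen.refl a).param κ) ((Gen.refl a).act κ x) := by
  by_cases ha : κ a = 0
  · rw [refl_param_of_eq_zero ha, refl_act_of_eq_zero ha]; exact h
  obtain ⟨A, B, hne, hw⟩ := h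
  cases a with
  | kinf =>
    refine ⟨A, B, hne, fun w hwu => ?_⟩
    rw [hw w hwu, ← riccati_reflect (d := some none) (by simp [siteE]),
      ← siteTh_update κ (some none), ← funext (siteY_refl_kinf κ x)]
    rfl
  | th j =>
    have hj : x.q j ≠ 0 := hr.resolve_left ha
    refine ⟨A, B, hne, fun w hwu => ?_⟩
    have hw' := hw w hwu
    rw [← riccati_reflect (d := some (some j))
      (by simpa only [siteE] using div_ne_zero hj (hs.1 j).1), ← siteTh_update κ (some (some j)),
      ← funext (siteY_refl_th κ hs hj)] at hw'
    exact hw'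
  | k0 =>
    have hg : siteE x.s x.q none ≠ 0 := sub_ne_zero.2 (Ne.symm (hr.resolve_left ha))
    obtain ⟨k, hk⟩ : ∃ k, k = -(κ .k0 / siteE x.s x.q none) := ⟨_, rfl⟩
    refine ⟨A - Polynomial.C k * B, B, ?_, fun w hwu => ?_⟩
    · convert hne using 1
      simp only [Polynomial.mul_comp, Polynomial.C_comp, Polynomial.sub_comp]
      ring
    · have h1 := riccati_refl_k0 κ hs hg (A.eval w) (B.eval w) (w ^ 2)
      have e : (A - Polynomial.C k * B).derivative * B -
          (A - Polynomial.C k * B) * B.derivative = A.derivative * B - A * B.derivative := by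
        simp only [Polynomial.derivative_sub, Polynomial.derivative_mul, Polynomial.derivative_C]
        ring
      rw [← hk] at h1
      rw [e, hw w hwu, Polynomial.eval_sub, Polynomial.eval_mul, Polynomial.eval_C, ← h1]
      rfl
  | k1 =>
    have hg : x.g1 ≠ 1 := hr.resolve_left ha
    set d := -κ .k1 / (x.g1 - 1) with hd
    refine ⟨A + Polynomial.C d * Polynomial.X ^ 2 * B, B, ?_, fun w hwu => ?_⟩
    · convert hne using 1
      simp only [Polynomial.mul_comp, Polynomial.C_comp, Polynomial.add_comp, Polynomial.pow_comp,
        Polynomial.X_comp]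
      ring
    · have hw' := hw w hwu
      have h1 := riccati_refl_k1 κ hs hg (a := A.eval w) (b := B.eval w) hwu
      rw [← hd] at h1
      have hs' : ((Gen.refl .k1).act κ x).s = x.s := rfl
      have hq' : ((Gen.refl .k1).act κ x).q = x.q := rfl
      rw [hs', hq', Polynomial.eval_add, Polynomial.eval_mul, Polynomial.eval_mul,
        Polynomial.eval_C, Polynomial.eval_pow, Polynomial.eval_X, h1]
      simp only [Polynomial.eval_sub, Polynomial.eval_mul, Polynomial.derivative_mul,
        Polynomial.derivative_C, Polynomial.derivative_X_pow, Polynomial.eval_add,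
        Polynomial.derivative_add, Polynomial.eval_C, Polynomial.eval_pow, Polynomial.eval_X,
        Polynomial.eval_zero] at hw' ⊢
      push_cast
      linear_combination hw'

/-- The solution is `η = κ_∞ √z / 2`. Its value at `z = s_i`, for the chosen root, is the slope `y_i
= κ_∞ √s_i / 2`, so the pole of the Riccati equation at `s_i` cancels. -/
theorem seed_dihedral {κ : Param N} (hκ : IsSeedParam κ) {s t : Fin N → ℂ} (hs : s ∈ config N)
    (hts : ∀ i, t i ^ 2 = s i) : Dihedral κ ⟨seedQ κ t, seedP κ t, s⟩ := by
  have ht : ∀ i, t i ≠ 0 := fun i h => (hs.1 i).1 (by rw [← hts i, h]; ring)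
  have hk := hκ.2.2
  refine ⟨Polynomial.C (κ .kinf / 2) * Polynomial.X, 1, ?_, fun w hwu => ?_⟩
  · have : Polynomial.C (κ .kinf / 2) * Polynomial.X * (1 : Polynomial ℂ).comp (-Polynomial.X)
        - (Polynomial.C (κ .kinf / 2) * Polynomial.X).comp (-Polynomial.X) * 1 =
        Polynomial.C (κ .kinf) * Polynomial.X := by
      simp only [Polynomial.one_comp, Polynomial.mul_comp, Polynomial.C_comp, Polynomial.X_comp]
      rw [show κ .kinf = κ .kinf / 2 + κ .kinf / 2 by ring, map_add]
      ring_nf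
    rw [this]
    exact mul_ne_zero (Polynomial.C_ne_zero.2 hk) Polynomial.X_ne_zero
  · have hw0 : w ≠ 0 := by
      intro h; exact hwu none (by simp [siteU, h])
    have hw1 : w ^ 2 - 1 ≠ 0 := by simpa [siteU] using hwu (some none)
    have hm := seed_mul hk ht
    simp only [riccati, Fintype.sum_option]
    have h1 : ∀ i, (Polynomial.eval w (Polynomial.C (κ .kinf / 2) * Polynomial.X)
          - siteY κ s (seedQ κ t) (seedP κ t) (some (some i)) * Polynomial.eval w 1) *
        (siteE s (seedQ κ t) (some (some i)) *
          (Polynomial.eval w (Polynomial.C (κ .kinf / 2) * Polynomial.X)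
          - siteY κ s (seedQ κ t) (seedP κ t) (some (some i)) * Polynomial.eval w 1)
          + siteTh κ (some (some i)) * Polynomial.eval w 1) /
        (w ^ 2 - siteU s (some (some i))) =
        κ .kinf ^ 2 / 4 * (seedQ κ t i / s i) := by
      intro i
      have h0 := ht i
      have h2 : w ^ 2 - t i ^ 2 ≠ 0 := by simpa [siteU, hts] using hwu (some (some i))
      simp only [siteY, siteE, siteTh, siteIdx, siteU, seedQ, seedP, ← hts, Polynomial.eval_mul,
        Polynomial.eval_C, Polynomial.eval_X, Polynomial.eval_one]
      field_simp
      ring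
    rw [Finset.sum_congr rfl fun i _ => h1 i, ← Finset.mul_sum]
    simp only [siteY, siteE, siteTh, siteIdx, siteU, hm, seed_alpha hκ, ← Finset.sum_div, hκ.1,
      Polynomial.eval_mul, Polynomial.eval_C, Polynomial.eval_X, Polynomial.eval_one,
      Polynomial.derivative_mul, Polynomial.derivative_C, Polynomial.derivative_X,
      Polynomial.derivative_one, Polynomial.eval_sub, Polynomial.eval_add, Polynomial.eval_zero]
    generalize ∑ i, seedQ κ t i / s i = E
    generalize ∑ i, κ (.th i) = T
    field_simp
    ring


section Residue

open Polynomial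

/-- The hypothesis says that the logarithmic derivative of `A / B` is `G / ((X - r) P)`. Its residue
at `r` is the order of `A / B` there, the difference of two root multiplicities. -/
theorem exists_int_residue {A B P G : ℂ[X]} {r : ℂ} (hA : A ≠ 0) (hB : B ≠ 0)
    (h : (X - C r) * P * (derivative A * B - A * derivative B) = G * A * B) :
    ∃ k : ℤ, G.eval r = k * P.eval r := by
  have hfac : ∀ A : ℂ[X], A ≠ 0 → ∃ (n : ℕ) (A1 : ℂ[X]), A1.eval r ≠ 0 ∧
      A = (X - C r) ^ n * A1 ∧
      (X - C r) * derivative A = (X - C r) ^ n * ((n : ℂ[X]) * A1 + (X - C r) * derivative A1) := by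
    intro A hA
    obtain ⟨A1, h1, h2⟩ := exists_eq_pow_rootMultiplicity_mul_and_not_dvd A hA r
    refine ⟨rootMultiplicity r A, A1, fun h0 => h2 (dvd_iff_isRoot.2 h0), h1, ?_⟩
    conv_lhs => rw [h1]
    generalize rootMultiplicity r A = n
    rw [derivative_mul, derivative_X_sub_C_pow]
    cases n with
    | zero => simp
    | succ n =>
      simp only [Nat.add_sub_cancel, map_natCast]
      ring
  obtain ⟨n, A1, hA1, eA, dA⟩ := hfac A hA
  obtain ⟨m, B1, hB1, eB, dB⟩ := hfac B hB
  have key : P * (((n : ℂ[X]) * A1 + (X - C r) * derivative A1) * B1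
      - A1 * ((m : ℂ[X]) * B1 + (X - C r) * derivative B1)) = G * A1 * B1 := by
    have hX : (X - C r) ^ (n + m) ≠ 0 := pow_ne_zero _ (X_sub_C_ne_zero r)
    apply mul_left_cancel₀ hX
    have h1 : P * (((X - C r) * derivative A) * B - A * ((X - C r) * derivative B)) =
        G * A * B := by rw [← h]; ring
    rw [dA, dB, eA, eB] at h1
    rw [pow_add]
    linear_combination h1
  have h2 := congrArg (eval r) key
  simp only [eval_mul, eval_sub, eval_add, eval_X, eval_C, eval_natCast, sub_self, zero_mul,
    add_zero] at h2
  refine ⟨(n : ℤ) - m, ?_⟩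
  push_cast
  apply mul_right_cancel₀ (mul_ne_zero hA1 hB1)
  linear_combination -h2

/-- Degeneracy says that every residue `f_c` vanishes at `η = 0`, so the right-hand side is
divisible by `η`. -/
theorem riccati_degenerate {κ : Param N} {x : Pt N} (hs : x.s ∈ config N)
    (hd : Degenerate κ x) (a b z : ℂ) :
    riccati (siteTh κ) (siteU x.s) (siteE x.s x.q) (siteY κ x.s x.q x.p) a b z =
      a * ((∑ c, siteE x.s x.q c / (z - siteU x.s c)) * a + (∑ c, (siteTh κ c -
        2 * siteE x.s x.q c * siteY κ x.s x.q x.p c) / (z - siteU x.s c)) * b) := by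
  have h0 : ∀ c, siteY κ x.s x.q x.p c *
      (siteE x.s x.q c * siteY κ x.s x.q x.p c - siteTh κ c) = 0 := by
    rintro (_ | _ | i)
    · simp [siteY]
    · have := hd.2
      simp only [spinD] at this
      simp only [siteY, siteE, siteTh, siteIdx]
      linear_combination -this
    · have := hd.1 i
      have h1 := (hs.1 i).1
      simp only [spinF] at this
      simp only [siteY, siteE, siteTh, siteIdx]
      field_simp
      linear_combination x.s i * this
  simp only [riccati, Finset.sum_mul, ← Finset.sum_add_distrib, Finset.mul_sum]
  refine Finset.sum_congr rfl fun c _ => ?_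
  linear_combination b ^ 2 / (z - siteU x.s c) * h0 c

/-- As `η = 0` is a solution, `1/η` satisfies an inhomogeneous linear equation. In the variable `w =
√z` the difference of its values at `w` and `-w`, which is not zero, satisfies `δ' = -2wFδ`. The
residue of `-2wF` at `w = 1` is `±κ_∞`, and it is an integer since `δ` is rational. -/
theorem Dihedral.int_of_degenerate {κ : Param N} {x : Pt N} (h : Dihedral κ x)
    (hs : x.s ∈ config N) (hd : Degenerate κ x) : ∃ k : ℤ, κ .kinf = k := by
  obtain ⟨A, B, hne, hw⟩ := h
  set A' := A.comp (-X) with hA'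
  set B' := B.comp (-X) with hB'
  have hA0 : A ≠ 0 := by
    rintro rfl
    simp [hA'] at hne
  have hA'0 : A' ≠ 0 := by
    intro h0
    apply hA0
    have : A'.comp (-X) = A := by
      rw [hA', comp_assoc]; simp
    rw [← this, h0, zero_comp]
  set u := siteU x.s with hu
  set co : Site N → ℂ := fun c => siteTh κ c - 2 * siteE x.s x.q c * siteY κ x.s x.q x.p c with hco
  set E : ℂ → ℂ := fun w => ∑ c, siteE x.s x.q c / (w ^ 2 - u c)
  set F : ℂ → ℂ := fun w => ∑ c, co c / (w ^ 2 - u c) with hF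
  have hw' : ∀ w : ℂ, (∀ c, w ^ 2 - u c ≠ 0) → (derivative A * B - A * derivative B).eval w =
      2 * w * (A.eval w * (E w * A.eval w + F w * B.eval w)) := by
    intro w hwu
    rw [hw w hwu, riccati_degenerate hs hd]
  set P0 : ℂ[X] := ∏ c, (X ^ 2 - C (u c)) with hP0
  set Q : ℂ[X] := ∑ c, C (co c) * ∏ d ∈ Finset.univ.erase c, (X ^ 2 - C (u d)) with hQ
  have hPF : ∀ w : ℂ, (∀ c, w ^ 2 - u c ≠ 0) → Q.eval w = P0.eval w * F w := by
    intro w hwu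
    simp only [hQ, hP0, hF, eval_finsetSum, eval_prod, eval_mul, eval_C, Finset.mul_sum]
    refine Finset.sum_congr rfl fun c _ => ?_
    rw [← Finset.mul_prod_erase _ _ (Finset.mem_univ c)]
    have := hwu c
    simp only [eval_sub, eval_pow, eval_X, eval_C]
    field_simp
  have hP0ne : P0 ≠ 0 := Finset.prod_ne_zero_iff.2 fun c _ =>
    (monic_X_pow_sub_C (u c) two_ne_zero).ne_zero
  have hid : P0 * (derivative (A * B' - A' * B) * (A * A') - (A * B' - A' * B) *
      derivative (A * A')) = (-2 * X * Q) * (A * B' - A' * B) * (A * A') := by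
    -- The additional factor `P0` makes both sides vanish at the poles, where the differential
    -- equation is not available.
    apply mul_left_cancel₀ hP0ne
    apply Polynomial.funext
    intro w
    by_cases hPw : P0.eval w = 0
    · simp only [eval_mul, hPw, zero_mul]
    have hwu : ∀ c, w ^ 2 - u c ≠ 0 := by
      intro c
      rw [hP0, eval_prod] at hPw
      have := (Finset.prod_ne_zero_iff.1 hPw) c (Finset.mem_univ c)
      simpa using this
    have e1 := hw' w hwu
    have hwu' : ∀ c, (-w) ^ 2 - u c ≠ 0 := fun c => by rw [neg_sq]; exact hwu c
    have e2 := hw' (-w) hwu'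
    have hEm : E (-w) = E w := by simp only [E, neg_sq]
    have hFm : F (-w) = F w := by simp only [hF, neg_sq]
    rw [hEm, hFm] at e2
    have a1 : A'.eval w = A.eval (-w) := by simp [hA']
    have b1 : B'.eval w = B.eval (-w) := by simp [hB']
    have a2 : (derivative A').eval w = -(derivative A).eval (-w) := by
      simp [hA', derivative_comp]
    have b2 : (derivative B').eval w = -(derivative B).eval (-w) := by
      simp [hB', derivative_comp]
    simp only [eval_mul, eval_sub, eval_add, derivative_mul, derivative_sub, eval_neg, eval_X,
      eval_ofNat, a1, b1, a2, b2, hPF w hwu] at e1 e2 ⊢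
    linear_combination P0.eval w ^ 2 * (A.eval (-w) ^ 2 * e1 + A.eval w ^ 2 * e2)
  -- The residue is taken at `w = 1`, one of the two points above the site 1, which carries `κ_∞`;
  -- `P1` is `P0` without the factor `X - 1`.
  set P1 : ℂ[X] := (X + 1) * ∏ c ∈ Finset.univ.erase (some none), (X ^ 2 - C (u c)) with hP1
  have hfac : P0 = (X - C 1) * P1 := by
    rw [hP0, hP1, ← Finset.mul_prod_erase _ _ (Finset.mem_univ (some none))]
    simp only [hu, siteU]
    rw [map_one]
    ring
  have hprod : ∏ c ∈ Finset.univ.erase (some none), (1 - u c) ≠ 0 :=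
    Finset.prod_ne_zero_iff.2 fun c hc => by
      have : u (some none) ≠ u c := (siteU_injective hs).ne (Finset.ne_of_mem_erase hc).symm
      exact sub_ne_zero.2 this
  have hP1e : P1.eval 1 = 2 * ∏ c ∈ Finset.univ.erase (some none), (1 - u c) := by
    simp [hP1, eval_prod]; norm_num
  have hQe : Q.eval 1 = co (some none) * ∏ c ∈ Finset.univ.erase (some none), (1 - u c) := by
    rw [hQ, eval_finsetSum, Finset.sum_eq_single (some none)]
    · simp [eval_prod]
    · intro c _ hc
      rw [eval_mul, eval_prod]
      apply mul_eq_zero_of_right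
      apply Finset.prod_eq_zero (i := some none)
      · simp [hc.symm]
      · simp [hu, siteU]
    · simp
  rw [hfac] at hid
  obtain ⟨k, hk⟩ := exists_int_residue hne (mul_ne_zero hA0 hA'0) hid
  have hk' : -co (some none) = k := by
    rw [hP1e] at hk
    simp only [eval_mul, eval_neg, eval_ofNat, eval_X, hQe] at hk
    apply mul_right_cancel₀ (mul_ne_zero two_ne_zero hprod)
    linear_combination hk
  simp only [hco, siteE, siteY, siteTh, siteIdx] at hk'
  rcases mul_eq_zero.1 hd.2 with h0 | h0
  · exact ⟨-k, by push_cast; linear_combination -hk' - 2 * h0⟩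
  · exact ⟨k, by linear_combination hk' + 2 * h0⟩

end Residue

/-! ### The case of a parameter that is not an integer -/

section NonInteger

variable {𝓕 : Param N → Set (Fin N → ℂ) → ((Fin N → ℂ) → Fin N → ℂ) →
    ((Fin N → ℂ) → Fin N → ℂ) → Prop}

/-- The class `𝓕` has a member with the parameter `κ` and dihedral linear system. -/
def HasDihedral (𝓕 : Param N → Set (Fin N → ℂ) → ((Fin N → ℂ) → Fin N → ℂ) →
    ((Fin N → ℂ) → Fin N → ℂ) → Prop) (κ : Param N) : Prop :=
  ∃ U q p, 𝓕 κ U q p ∧ ∀ s ∈ U, Dihedral κ ⟨q s, p s, s⟩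

theorem StepClosed.hasDihedral_refl (H : StepClosed 𝓕) {κ : Param N} (h : HasDihedral 𝓕 κ)
    (a : Idx N) : HasDihedral 𝓕 (Function.update κ a (-κ a)) := by
  obtain ⟨U, q, p, h, hd⟩ := h
  obtain ⟨s, hs, hr⟩ := (H.sol h).exists_refl_regular a
  obtain ⟨U', q', p', h', hg⟩ := H.step h (.refl a) s hs hr
  refine ⟨U', q', p', h', fun S hS => ?_⟩
  obtain ⟨s, hs, hr, he⟩ := hg S hS
  rw [he]
  exact (hd s hs).refl ((H.sol h).subset_config hs) a hr

/-- If `R_τ` were nowhere regular, some point would be degenerate as well as dihedral, and `κ_∞`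
would be an integer. -/
theorem StepClosed.hasDihedral_tau (H : StepClosed 𝓕) {κ : Param N} (h : HasDihedral 𝓕 κ)
    (hκ : ∀ m : ℤ, κ .kinf ≠ m) : HasDihedral 𝓕 (Gen.tau.param κ) := by
  obtain ⟨U, q, p, h, hd⟩ := h
  have hreg : ∃ s ∈ U, Gen.tau.Regular κ ⟨q s, p s, s⟩ := by
    by_contra! hr
    obtain ⟨s, hs, hdeg⟩ := (H.sol h).degenerate_of_tau hr
    obtain ⟨k, hk⟩ := (hd s hs).int_of_degenerate ((H.sol h).subset_config hs) hdeg
    exact hκ k hk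
  obtain ⟨s, hs, hr⟩ := hreg
  obtain ⟨U', q', p', h', hg⟩ := H.step h .tau s hs hr
  refine ⟨U', q', p', h', fun S hS => ?_⟩
  obtain ⟨s, hs, hr, he⟩ := hg S hS
  rw [he]
  exact (hd s hs).tau ((H.sol h).subset_config hs) hr

/-- The parameter with new values of `κ₀` and `κ₁`. -/
def setHalf (κ : Param N) (x y : ℂ) : Param N
  | .k0 => x
  | .k1 => y
  | a => κ a

/-- A property that is stable under changes of sign and under the `R_τ` allowed by `T` is stable
under `(κ₀, κ₁) ↦ (1 - κ₀, 1 - κ₁)`. -/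
theorem one_sub_of_refl_tau {T P : Param N → Prop}
    (hr : ∀ κ a, P κ → P (Function.update κ a (-κ a)))
    (ht : ∀ κ, T κ → P κ → P (Gen.tau.param κ)) {κ : Param N} (hT : T κ) (h : P κ) :
    P (setHalf κ (1 - κ .k0) (1 - κ .k1)) := by
  have key : ∀ l : List (Fin N), l.Nodup → ∀ κ, P κ → P (negTheta l κ) := by
    intro l
    induction l with
    | nil =>
      intro _ κ h
      convert h using 1
      funext a; cases a <;> simp [negTheta]
    | cons j l ih =>
      intro hl κ h
      rw [List.nodup_cons] at hl
      have h1 := ih hl.2 _ (hr κ (.th j) h)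
      convert h1 using 1
      funext a
      cases a with
      | th i =>
        by_cases hi : i = j
        · subst hi
          simp [negTheta, hl.1]
        · simp [negTheta, hi]
      | _ => simp [negTheta]
  have h1 := hr _ .kinf (key _ (List.nodup_finRange N) _ (ht κ hT h))
  convert h1 using 1
  funext a
  cases a with
  | k0 => simp [setHalf, negTheta, Gen.param]; ring
  | k1 => simp [setHalf, negTheta, Gen.param]; ring
  | kinf => simp [setHalf, negTheta, Gen.param]
  | th i => simp [setHalf, negTheta, Gen.param]

theorem setHalf_setHalf (κ : Param N) (x y x' y' : ℂ) :
    setHalf (setHalf κ x y) x' y' = setHalf κ x' y' := by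
  funext a; cases a <;> rfl

theorem setHalf_self (κ : Param N) : setHalf κ (κ .k0) (κ .k1) = κ := by
  funext a; cases a <;> rfl

theorem update_setHalf_k0 (κ : Param N) (x y : ℂ) :
    Function.update (setHalf κ x y) .k0 (-setHalf κ x y .k0) = setHalf κ (-x) y := by
  funext a; cases a <;> simp [setHalf]

theorem update_setHalf_k1 (κ : Param N) (x y : ℂ) :
    Function.update (setHalf κ x y) .k1 (-setHalf κ x y .k1) = setHalf κ x (-y) := by
  funext a; cases a <;> simp [setHalf]

/-- All the pairs of half-integers are reached from `(1/2, 1/2)`. -/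
theorem half_induction {P : ℂ → ℂ → Prop} (h0 : P (1 / 2) (1 / 2))
    (hx : ∀ x y, P x y → P (-x) y) (hy : ∀ x y, P x y → P x (-y))
    (ht : ∀ x y, P x y → P (1 - x) (1 - y)) (m n : ℤ) : P (m + 1 / 2) (n + 1 / 2) := by
  have hadd : ∀ x y, P x y → P (x + 1) (y + 1) := fun x y h => by
    have := ht _ _ (hy _ _ (hx _ _ h))
    convert this using 1 <;> ring
  have hsub : ∀ x y, P x y → P (x - 1) (y - 1) := fun x y h => by
    have := hy _ _ (hx _ _ (ht _ _ h))
    convert this using 1 <;> ring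
  have hmix : ∀ x y, P x y → P (x + 1) (y - 1) := fun x y h => by
    have := hy _ _ (ht _ _ (hx _ _ h))
    convert this using 1 <;> ring
  -- Changing 1/2 to -1/2 before a simultaneous shift restores the first entry, so that only the
  -- second one moves.
  have key : ∀ n : ℤ, P (1 / 2) (n + 1 / 2) := by
    intro n
    induction n using Int.induction_on with
    | zero => simpa using h0
    | succ k ih =>
      have := hadd _ _ (hx _ _ ih)
      convert this using 1
      · norm_num
      · push_cast; ring
    | pred k ih =>
      have := hmix _ _ (hx _ _ ih)
      convert this using 1
      · norm_num
      · push_cast; ring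
  revert n
  induction m using Int.induction_on with
  | zero => intro n; simpa using key n
  | succ k ih =>
    intro n
    have := hadd _ _ (ih (n - 1))
    convert this using 1
    · push_cast; ring
    · push_cast; ring
  | pred k ih =>
    intro n
    have := hsub _ _ (ih (n + 1))
    convert this using 1
    · push_cast; ring
    · push_cast; ring

/-- The steps alter only signs and the pair `(κ₀, κ₁)`, so the condition on `κ_∞` persists, and with
the dihedral solution it makes every `R_τ` on the way applicable. -/
theorem hasDihedral_half {κ : Param N} (h0 : IsHalfInteger (κ .k0)) (h1 : IsHalfInteger (κ .k1))
    (hi : ∀ m : ℤ, κ .kinf ≠ m) :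
    HasDihedral (fun κ U q p => IsAlgebraicSolution κ U q p ∧ ObtainedFromSeed κ U q p) κ := by
  set 𝓕 : Param N → Set (Fin N → ℂ) → ((Fin N → ℂ) → Fin N → ℂ) →
    ((Fin N → ℂ) → Fin N → ℂ) → Prop :=
    fun κ U q p => IsAlgebraicSolution κ U q p ∧ ObtainedFromSeed κ U q p with h𝓕
  have H : StepClosed 𝓕 := stepClosed_obtainedFromSeed
  obtain ⟨m, hm⟩ := h0
  obtain ⟨n, hn⟩ := h1
  have hseed : IsSeedParam (setHalf κ (1 / 2) (1 / 2)) :=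
    ⟨rfl, rfl, fun h => hi 0 (by rw [Int.cast_zero]; exact h)⟩
  have := half_induction (P := fun x y => HasDihedral 𝓕 (setHalf κ x y)) ?_ ?_ ?_ ?_ m n
  · rwa [← hm, ← hn, setHalf_self] at this
  · obtain ⟨U, t, ht⟩ := exists_sqrtBranch N
    exact ⟨U, _, _, ⟨seed_isAlgebraicSolution hseed ht, [], _, U, t, hseed, rfl, ht,
      fun _ _ => trivial, rfl⟩, fun s hs => seed_dihedral hseed (ht.subset_config hs)
        (ht.sq_eq s hs)⟩
  · intro x y h
    rw [← update_setHalf_k0]; exact H.hasDihedral_refl h _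
  · intro x y h
    rw [← update_setHalf_k1]; exact H.hasDihedral_refl h _
  · intro x y h
    have := one_sub_of_refl_tau (T := fun κ => ∀ m : ℤ, κ .kinf ≠ m) (P := HasDihedral 𝓕)
      (fun κ a h => H.hasDihedral_refl h a) (fun κ hT h => H.hasDihedral_tau h hT)
      (κ := setHalf κ x y) hi h
    rwa [setHalf_setHalf] at this

/-- Only the exchange of `c` with the place of `κ_∞` is conditional, and the two nonzero components
make it available; the places of `κ₀` and `κ₁` are reached by unconditional exchanges. -/
theorem StepClosed.exists_perm (H : StepClosed 𝓕) (κ : Param N) {a b c : Idx N} (hab : a ≠ b)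
    (hac : a ≠ c) (hbc : b ≠ c) (hi : κ .kinf ≠ 0) (hc : κ c ≠ 0) :
    ∃ π : Equiv.Perm (Idx N), π .k0 = a ∧ π .k1 = b ∧ π .kinf = c ∧
      (Has 𝓕 (κ ∘ π) → Has 𝓕 κ) := by
  set π1 := Equiv.swap c .kinf with hπ1
  have ha1 : π1 a ≠ .kinf := fun h => hac (by
    rw [← π1.injective.eq_iff, h, hπ1, Equiv.swap_apply_left])
  have hb1 : π1 b ≠ .kinf := fun h => hbc (by
    rw [← π1.injective.eq_iff, h, hπ1, Equiv.swap_apply_left])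
  set π2 := Equiv.swap .k0 (π1 a) with hπ2
  have hb2 : π2 (π1 b) ≠ .kinf := fun h => hb1 (by
    have : π2 .kinf = .kinf := Equiv.swap_apply_of_ne_of_ne (by simp) (Ne.symm ha1)
    rw [← π2.injective.eq_iff, h, this])
  have hb2' : π2 (π1 b) ≠ .k0 := fun h => hab (by
    have : π2 (π1 a) = .k0 := Equiv.swap_apply_right _ _
    exact (π1.injective (π2.injective (h.trans this.symm))).symm)
  set π3 := Equiv.swap .k1 (π2 (π1 b)) with hπ3
  have e11 : ∀ d, π1 (π1 d) = d := fun d => Equiv.swap_apply_self _ _ d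
  have e22 : ∀ d, π2 (π2 d) = d := fun d => Equiv.swap_apply_self _ _ d
  have e33 : ∀ d, π3 (π3 d) = d := fun d => Equiv.swap_apply_self _ _ d
  refine ⟨π1 * π2 * π3, ?_, ?_, ?_, fun h => ?_⟩
  · simp only [Equiv.Perm.mul_apply]
    rw [hπ3, Equiv.swap_apply_of_ne_of_ne (by simp) (Ne.symm hb2'), hπ2, Equiv.swap_apply_left, e11]
  · simp only [Equiv.Perm.mul_apply]
    rw [hπ3, Equiv.swap_apply_left, e22, e11]
  · simp only [Equiv.Perm.mul_apply]
    rw [hπ3, Equiv.swap_apply_of_ne_of_ne (by simp) (Ne.symm hb2), hπ2,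
      Equiv.swap_apply_of_ne_of_ne (by simp) (Ne.symm ha1), hπ1, Equiv.swap_apply_right]
  · have h3 := H.has_swap_of_ne (H.has_swap_of_ne h (a := .k1) (b := π2 (π1 b)) (by simp) hb2)
      (a := .k0) (b := π1 a) (by simp) ha1
    have e1 : ((κ ∘ ⇑(π1 * π2 * π3)) ∘ Equiv.swap .k1 (π2 (π1 b))) ∘ Equiv.swap .k0 (π1 a) =
        κ ∘ π1 := by
      rw [← hπ3, ← hπ2]
      funext d
      simp only [Function.comp_apply, Equiv.Perm.mul_apply, e33, e22]
    rw [e1] at h3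
    have h4 := H.has_swap h3 (a := c) (b := .kinf) (by
      simpa only [Function.comp_apply, hπ1, Equiv.swap_apply_left] using hi) (by
      simpa only [Function.comp_apply, hπ1, Equiv.swap_apply_right] using hc)
    rw [← hπ1] at h4
    convert h4 using 1
    funext d
    simp only [Function.comp_apply, e11]

theorem has_obtained {κ : Param N} {a b c : Idx N} (hab : a ≠ b) (hac : c ≠ a) (hbc : c ≠ b)
    (ha : IsHalfInteger (κ a)) (hb : IsHalfInteger (κ b)) (hi : κ .kinf ≠ 0)
    (hc : ∀ m : ℤ, κ c ≠ m) :
    ∃ (U : Set (Fin N → ℂ)) (q p : (Fin N → ℂ) → Fin N → ℂ),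
      IsAlgebraicSolution κ U q p ∧ ObtainedFromSeed κ U q p := by
  obtain ⟨π, h0, h1, h2, hπ⟩ := stepClosed_obtainedFromSeed.exists_perm κ hab (Ne.symm hac)
    (Ne.symm hbc) hi (fun h => hc 0 (by simpa using h))
  apply hπ
  obtain ⟨U, q, p, h, -⟩ := hasDihedral_half (κ := κ ∘ π) (by simpa [h0] using ha)
    (by simpa [h1] using hb) (by simpa [h2] using hc)
  exact ⟨U, q, p, h⟩

end NonInteger


/-! ### Solutions of Lauricella type -/

section Lauricella

open PowerSeries

/-- The coefficients of `F'` are the derivatives of the coefficients of `F`. -/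
def HasCoeffDerivAt (F : ℂ → ℂ⟦X⟧) (F' : ℂ⟦X⟧) (x : ℂ) : Prop :=
  ∀ n, HasDerivAt (fun z => coeff n (F z)) (coeff n F') x

/-- Formal power series in `X = z - 1`, differentiated coefficientwise in the parameter, stand for
contour integrals around `z = 1` and their differentiation under the integral sign. -/
theorem HasCoeffDerivAt.mul {F G : ℂ → ℂ⟦X⟧} {F' G' : ℂ⟦X⟧} {x : ℂ}
    (hF : HasCoeffDerivAt F F' x) (hG : HasCoeffDerivAt G G' x) :
    HasCoeffDerivAt (fun z => F z * G z) (F' * G x + F x * G') x := by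
  intro n
  simp only [coeff_mul, map_add]
  rw [← Finset.sum_add_distrib]
  exact HasDerivAt.fun_sum fun c _ => (hF c.1).fun_mul (hG c.2)

theorem hasCoeffDerivAt_const (F : ℂ⟦X⟧) (x : ℂ) : HasCoeffDerivAt (fun _ => F) 0 x :=
  fun n => by simpa using hasDerivAt_const x (coeff n F)

/-- The power series `1 - c + X`. -/
def lin (c : ℂ) : ℂ⟦X⟧ := C (1 - c) + X

/-- The power series `1 / (1 - c + X)`. -/
def linInv (c : ℂ) : ℂ⟦X⟧ := PowerSeries.mk fun n => (-1) ^ n / (1 - c) ^ (n + 1)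

theorem lin_mul_linInv {c : ℂ} (hc : c ≠ 1) : lin c * linInv c = 1 := by
  have h : 1 - c ≠ 0 := sub_ne_zero.2 (Ne.symm hc)
  ext n
  rw [lin, add_mul, map_add, coeff_C_mul, linInv, coeff_mk]
  cases n with
  | zero =>
    rw [coeff_zero_X_mul, coeff_zero_one]
    field_simp
    simp
  | succ n =>
    rw [coeff_succ_X_mul, coeff_mk, coeff_one, if_neg (by simp)]
    field_simp
    ring

theorem hasCoeffDerivAt_lin (c : ℂ) : HasCoeffDerivAt lin (-1) c := by
  intro n
  simp only [lin, map_add, coeff_C, map_neg, coeff_one]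
  split_ifs
  · exact ((hasDerivAt_id c).const_sub 1).add_const _
  · simpa using hasDerivAt_const c _

theorem hasCoeffDerivAt_linInv {c : ℂ} (hc : c ≠ 1) :
    HasCoeffDerivAt linInv (linInv c * linInv c) c := by
  have hd : ∀ n, DifferentiableAt ℂ (fun z => coeff n (linInv z)) c := by
    intro n
    have h : (1 - c) ^ (n + 1) ≠ 0 := pow_ne_zero _ (sub_ne_zero.2 (Ne.symm hc))
    simp only [linInv, coeff_mk]
    fun_prop (disch := assumption)
  have h1 : HasCoeffDerivAt linInv (PowerSeries.mk fun n => deriv (fun z => coeff n (linInv z)) c) c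
      := fun n => by rw [coeff_mk]; exact (hd n).hasDerivAt
  have h2 := (hasCoeffDerivAt_lin c).mul h1
  -- The derivative of the inverse series follows from differentiating `lin z * linInv z = 1`, valid
  -- for `z` near `c`.
  have h3 : -1 * linInv c + lin c *
      PowerSeries.mk (fun n => deriv (fun z => coeff n (linInv z)) c) = 0 := by
    ext n
    refine (h2 n).unique ?_
    refine (hasCoeffDerivAt_const 1 c n).congr_of_eventuallyEq ?_
    filter_upwards [isOpen_ne.mem_nhds hc] with z hz
    rw [lin_mul_linInv hz]
  have h4 : PowerSeries.mk (fun n => deriv (fun z => coeff n (linInv z)) c) =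
      linInv c * linInv c := by
    linear_combination linInv c * h3 - (PowerSeries.mk fun n =>
      deriv (fun z => coeff n (linInv z)) c) * lin_mul_linInv hc
  rwa [h4] at h1

/-- The power series `(1 - c + X) ^ (-n)`. -/
def linPow (n : ℤ) (c : ℂ) : ℂ⟦X⟧ := linInv c ^ n.toNat * lin c ^ (-n).toNat

theorem C_intCast_eq (n : ℤ) :
    (C (n : ℂ) : ℂ⟦X⟧) = (n.toNat : ℂ⟦X⟧) - ((-n).toNat : ℂ⟦X⟧) := by
  have : (n : ℂ) = ((n.toNat : ℕ) : ℂ) - (((-n).toNat : ℕ) : ℂ) := by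
    exact_mod_cast (by omega : n = (n.toNat : ℤ) - ((-n).toNat : ℤ))
  rw [this, map_sub, map_natCast, map_natCast]

theorem hasCoeffDerivAt_linPow (n : ℤ) {c : ℂ} (hc : c ≠ 1) :
    HasCoeffDerivAt (linPow n) (C (n : ℂ) * (linInv c * linPow n c)) c := by
  have h1 : ∀ a : ℕ, HasCoeffDerivAt (fun z => linInv z ^ a)
      ((a : ℂ⟦X⟧) * (linInv c * linInv c ^ a)) c := by
    intro a
    induction a with
    | zero => simpa using hasCoeffDerivAt_const 1 c
    | succ a ih =>
      simp only [pow_succ]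
      convert ih.mul (hasCoeffDerivAt_linInv hc) using 1
      push_cast
      ring
  have h2 : ∀ a : ℕ, HasCoeffDerivAt (fun z => lin z ^ a)
      (-(a : ℂ⟦X⟧) * (linInv c * lin c ^ a)) c := by
    intro a
    induction a with
    | zero => simpa using hasCoeffDerivAt_const 1 c
    | succ a ih =>
      simp only [pow_succ]
      convert ih.mul (hasCoeffDerivAt_lin c) using 1
      push_cast
      linear_combination (-lin c ^ a) * lin_mul_linInv hc
  have h3 := (h1 n.toNat).mul (h2 (-n).toNat)
  change HasCoeffDerivAt (fun z => linInv z ^ n.toNat * lin z ^ (-n).toNat) _ c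
  convert h3 using 1
  rw [C_intCast_eq, linPow]
  ring

theorem derivative_linInv {c : ℂ} (hc : c ≠ 1) :
    d⁄dX ℂ (linInv c) = -(linInv c * linInv c) := by
  have h := congrArg (d⁄dX ℂ) (lin_mul_linInv hc)
  have hl : d⁄dX ℂ (lin c) = 1 := by
    simp [lin, derivative_C]
  rw [Derivation.leibniz, hl] at h
  simp only [smul_eq_mul, Derivation.map_one_eq_zero] at h
  linear_combination linInv c * h - (d⁄dX ℂ (linInv c)) * lin_mul_linInv hc

theorem derivative_linPow (n : ℤ) {c : ℂ} (hc : c ≠ 1) :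
    d⁄dX ℂ (linPow n c) = -(C (n : ℂ) * (linInv c * linPow n c)) := by
  have hl : d⁄dX ℂ (lin c) = 1 := by
    simp [lin, derivative_C]
  have h1 : ∀ a : ℕ, d⁄dX ℂ (linInv c ^ a) = -((a : ℂ⟦X⟧) * (linInv c * linInv c ^ a)) := by
    intro a
    induction a with
    | zero => simp
    | succ a ih =>
      rw [pow_succ, Derivation.leibniz, ih, derivative_linInv hc]
      simp only [smul_eq_mul]
      push_cast
      ring
  have h2 : ∀ a : ℕ, d⁄dX ℂ (lin c ^ a) = (a : ℂ⟦X⟧) * (linInv c * lin c ^ a) := by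
    intro a
    induction a with
    | zero => simp
    | succ a ih =>
      rw [pow_succ, Derivation.leibniz, ih, hl]
      simp only [smul_eq_mul]
      push_cast
      linear_combination (-lin c ^ a) * lin_mul_linInv hc
  rw [linPow, Derivation.leibniz, h1, h2, C_intCast_eq]
  simp only [smul_eq_mul]
  ring

/-- The coefficients of the power series `(1 + X) ^ (-a)`. -/
def binCoeff (a : ℂ) : ℕ → ℂ
  | 0 => 1
  | n + 1 => -(a + n) / (n + 1) * binCoeff a n

theorem derivative_binCoeff (a : ℂ) :
    (1 + X) * d⁄dX ℂ (PowerSeries.mk (binCoeff a)) = -(C a * PowerSeries.mk (binCoeff a)) := by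
  have h : ∀ n : ℕ, (n : ℂ) + 1 ≠ 0 := fun n => Nat.cast_add_one_ne_zero n
  ext n
  rw [add_mul, one_mul, map_add, map_neg, coeff_C_mul, coeff_derivative, coeff_mk, coeff_mk]
  cases n with
  | zero =>
    rw [coeff_zero_X_mul]
    simp [binCoeff]
  | succ n =>
    have := h (n + 1)
    rw [coeff_succ_X_mul, coeff_derivative, coeff_mk,
      show binCoeff a (n + 1 + 1) = -(a + (n + 1 : ℕ)) / ((n + 1 : ℕ) + 1) * binCoeff a (n + 1)
        from rfl]
    push_cast at this ⊢
    field_simp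
    ring

/-- The power series `(1 + X) ^ (-a) ∏ (1 - s_j + X) ^ (-n_j)`. -/
def kernel (a : ℂ) (n : Fin N → ℤ) (s : Fin N → ℂ) : ℂ⟦X⟧ :=
  PowerSeries.mk (binCoeff a) * ∏ j, linPow (n j) (s j)

variable (a : ℂ) (n : Fin N → ℤ) {s : Fin N → ℂ}

theorem kernel_update (j : Fin N) (s : Fin N → ℂ) (x : ℂ) :
    kernel a n (Function.update s j x) = linPow (n j) x *
      (PowerSeries.mk (binCoeff a) * ∏ m ∈ Finset.univ.erase j, linPow (n m) (s m)) := by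
  rw [kernel, ← Finset.mul_prod_erase _ _ (Finset.mem_univ j), Function.update_self]
  rw [Finset.prod_congr rfl fun m hm => by
    rw [Function.update_of_ne (Finset.ne_of_mem_erase hm)]]
  ring

theorem hasCoeffDerivAt_kernel (hs : s ∈ config N) (j : Fin N) :
    HasCoeffDerivAt (fun x => kernel a n (Function.update s j x))
      (C (n j : ℂ) * (linInv (s j) * kernel a n s)) (s j) := by
  simp only [kernel_update]
  convert (hasCoeffDerivAt_linPow (n j) (hs.1 j).2).mul (hasCoeffDerivAt_const
    (PowerSeries.mk (binCoeff a) * ∏ m ∈ Finset.univ.erase j, linPow (n m) (s m)) (s j)) using 1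
  have := kernel_update a n j s (s j)
  rw [Function.update_eq_self] at this
  rw [this]
  ring

theorem linInv_mul_linInv (hs : s ∈ config N) {i j : Fin N} (hij : i ≠ j) :
    linInv (s i) * linInv (s j) = C (1 / (s i - s j)) * (linInv (s i) - linInv (s j)) := by
  have h : s i - s j ≠ 0 := sub_ne_zero.2 (hs.2 i j hij)
  have h1 := lin_mul_linInv (hs.1 i).2
  have h2 := lin_mul_linInv (hs.1 j).2
  have h3 : (C (1 / (s i - s j)) : ℂ⟦X⟧) * (lin (s j) - lin (s i)) = 1 := by
    simp only [lin]
    rw [add_sub_add_right_eq_sub, ← map_sub, ← map_mul, ← map_one (C (R := ℂ))]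
    congr 1
    field_simp
    ring
  linear_combination (-(linInv (s i) * linInv (s j))) * h3
    + C (1 / (s i - s j)) * linInv (s i) * h2 - C (1 / (s i - s j)) * linInv (s j) * h1

theorem one_add_X_mul_linInv (hs : s ∈ config N) (j : Fin N) :
    (1 + X) * linInv (s j) = 1 + C (s j) * linInv (s j) := by
  have h1 := lin_mul_linInv (hs.1 j).2
  simp only [lin, map_sub, map_one] at h1
  linear_combination h1

/-- Its coefficients are the contiguity relations of the hypergeometric integrals, in place of
integration by parts. -/
theorem derivative_kernel (hs : s ∈ config N) :
    (1 + X) * d⁄dX ℂ (kernel a n s) = -(C (a + ∑ j, (n j : ℂ)) * kernel a n s)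
      - ∑ j, C (n j * s j) * (linInv (s j) * kernel a n s) := by
  have h1 : ∀ t : Finset (Fin N), d⁄dX ℂ (∏ j ∈ t, linPow (n j) (s j)) =
      -((∑ j ∈ t, C (n j : ℂ) * linInv (s j)) * ∏ j ∈ t, linPow (n j) (s j)) := by
    intro t
    induction t using Finset.induction_on with
    | empty => simp
    | insert j t hj ih =>
      rw [Finset.prod_insert hj, Finset.sum_insert hj, Derivation.leibniz, ih,
        derivative_linPow _ (hs.1 j).2]
      simp only [smul_eq_mul]
      ring
  rw [kernel, Derivation.leibniz, h1]
  simp only [smul_eq_mul]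
  have h2 := derivative_binCoeff a
  have h3 : (1 + X) * ∑ j, C (n j : ℂ) * linInv (s j) =
      C (∑ j, (n j : ℂ)) + ∑ j, C (n j * s j) * linInv (s j) := by
    rw [Finset.mul_sum, map_sum, ← Finset.sum_add_distrib]
    refine Finset.sum_congr rfl fun j _ => ?_
    rw [map_mul]
    linear_combination C (n j : ℂ) * one_add_X_mul_linInv hs j
  have h4 : ∑ j, C (n j * s j) * (linInv (s j) * (PowerSeries.mk (binCoeff a) *
      ∏ j, linPow (n j) (s j))) = (∑ j, C (n j * s j) * linInv (s j)) *
        (PowerSeries.mk (binCoeff a) * ∏ j, linPow (n j) (s j)) := by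
    rw [Finset.sum_mul]
    exact Finset.sum_congr rfl fun j _ => by ring
  rw [h4, map_add]
  linear_combination (∏ j, linPow (n j) (s j)) * h2
    - PowerSeries.mk (binCoeff a) * (∏ j, linPow (n j) (s j)) * h3

end Lauricella


/-! ### Algebraic solutions with `p = 0` from the coefficients of the kernel -/

section LauricellaSolution

open PowerSeries

/-- The coefficients of the power series are holomorphic and algebraic functions of `s`. -/
def CoeffRegular (F : (Fin N → ℂ) → ℂ⟦X⟧) : Prop :=
  ∀ m, DifferentiableOn ℂ (fun s => coeff m (F s)) (config N) ∧
    IsAlgebraicFunction (config N) (fun s => coeff m (F s))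

theorem CoeffRegular.const (F : ℂ⟦X⟧) : CoeffRegular (N := N) fun _ => F :=
  fun _ => ⟨differentiableOn_const _, .const _⟩

theorem CoeffRegular.mul {F G : (Fin N → ℂ) → ℂ⟦X⟧} (hF : CoeffRegular F) (hG : CoeffRegular G) :
    CoeffRegular fun s => F s * G s := by
  intro m
  simp only [coeff_mul]
  exact ⟨DifferentiableOn.fun_sum fun c _ => (hF c.1).1.mul (hG c.2).1,
    .sum _ fun c _ => (hF c.1).2.mul (hG c.2).2⟩

theorem CoeffRegular.pow {F : (Fin N → ℂ) → ℂ⟦X⟧} (hF : CoeffRegular F) (a : ℕ) :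
    CoeffRegular fun s => F s ^ a := by
  induction a with
  | zero => simpa only [pow_zero] using CoeffRegular.const 1
  | succ a ih => simpa only [pow_succ] using ih.mul hF

theorem CoeffRegular.prod {ι : Type*} (t : Finset ι) {F : ι → (Fin N → ℂ) → ℂ⟦X⟧}
    (hF : ∀ i, CoeffRegular (F i)) : CoeffRegular fun s => ∏ i ∈ t, F i s := by
  classical
  induction t using Finset.induction_on with
  | empty => simpa only [Finset.prod_empty] using CoeffRegular.const 1
  | insert i t hi ih => simpa only [Finset.prod_insert hi] using (hF i).mul ih

theorem coeffRegular_lin (j : Fin N) : CoeffRegular fun s => lin (s j) := by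
  intro m
  simp only [lin, map_add, coeff_C]
  constructor
  · split_ifs
    · fun_prop
    · fun_prop
  · exact .add (.ite _ (fun _ => (IsAlgebraicFunction.const 1).sub (.coord j)) fun _ => .const 0)
      (.const _)

theorem coeffRegular_linInv (j : Fin N) : CoeffRegular fun s => linInv (s j) := by
  intro m
  simp only [linInv, coeff_mk]
  constructor
  · intro s hs
    have h : (1 - s j) ^ (m + 1) ≠ 0 := pow_ne_zero _ (sub_ne_zero.2 (Ne.symm (hs.1 j).2))
    refine DifferentiableAt.differentiableWithinAt ?_
    fun_prop (disch := assumption)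
  · refine (IsAlgebraicFunction.const _).div ?_
    generalize m + 1 = a
    induction a with
    | zero => simpa only [pow_zero] using IsAlgebraicFunction.const 1
    | succ a ih =>
      simpa only [pow_succ] using ih.mul ((IsAlgebraicFunction.const 1).sub (.coord j))

variable (a : ℂ) (n : Fin N → ℤ)

theorem coeffRegular_kernel : CoeffRegular (kernel a n) :=
  (CoeffRegular.const _).mul (.prod _ fun j =>
    ((coeffRegular_linInv j).pow _).mul ((coeffRegular_lin j).pow _))

/-- The coefficients of the power series `kernel a n s`. -/
def kernelCoeff (m : ℕ) (s : Fin N → ℂ) : ℂ := coeff m (kernel a n s)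

/-- The coefficients of the power series `kernel a n s / (1 - s_i + X)`. -/
def kernelCoeffDiv (i : Fin N) (m : ℕ) (s : Fin N → ℂ) : ℂ :=
  coeff m (linInv (s i) * kernel a n s)

/-- The coefficients of the power series `kernel a n s / (1 - s_i + X) ^ 2`. -/
def kernelCoeffDivSq (i : Fin N) (m : ℕ) (s : Fin N → ℂ) : ℂ :=
  coeff m (linInv (s i) * (linInv (s i) * kernel a n s))

variable {s : Fin N → ℂ}

theorem hasDerivAt_kernelCoeff (hs : s ∈ config N) (m : ℕ) (j : Fin N) :
    HasDerivAt (fun x => kernelCoeff a n m (Function.update s j x))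
      (n j * kernelCoeffDiv a n j m s) (s j) :=
  (hasCoeffDerivAt_kernel a n hs j m).congr_deriv (coeff_C_mul _ _ _)

theorem hasDerivAt_kernelCoeffDiv_of_ne (hs : s ∈ config N) (m : ℕ) {i j : Fin N} (hij : i ≠ j) :
    HasDerivAt (fun x => kernelCoeffDiv a n i m (Function.update s j x))
      (n j * ((kernelCoeffDiv a n i m s - kernelCoeffDiv a n j m s) / (s i - s j))) (s j) := by
  have h := ((hasCoeffDerivAt_const (linInv (s i)) (s j)).mul (hasCoeffDerivAt_kernel a n hs j)) m
  simp only [kernelCoeffDiv, Function.update_of_ne hij]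
  refine h.congr_deriv ?_
  rw [show 0 * kernel a n (Function.update s j (s j)) + linInv (s i) * (C (n j : ℂ) *
    (linInv (s j) * kernel a n s)) = C (n j : ℂ) * (linInv (s i) * linInv (s j) * kernel a n s) by
      ring, linInv_mul_linInv hs hij, coeff_C_mul, mul_assoc, coeff_C_mul, sub_mul, map_sub]
  ring

theorem hasDerivAt_kernelCoeffDiv_self (hs : s ∈ config N) (m : ℕ) (j : Fin N) :
    HasDerivAt (fun x => kernelCoeffDiv a n j m (Function.update s j x))
      ((n j + 1) * kernelCoeffDivSq a n j m s) (s j) := by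
  have h := ((hasCoeffDerivAt_linInv (hs.1 j).2).mul (hasCoeffDerivAt_kernel a n hs j)) m
  simp only [kernelCoeffDiv, Function.update_self]
  refine h.congr_deriv ?_
  rw [Function.update_eq_self, show linInv (s j) * linInv (s j) * kernel a n s + linInv (s j) *
    (C (n j : ℂ) * (linInv (s j) * kernel a n s)) = C ((n j : ℂ) + 1) * (linInv (s j) *
      (linInv (s j) * kernel a n s)) by rw [map_add, map_one]; ring, coeff_C_mul]
  rfl

theorem kernelCoeff_succ (hs : s ∈ config N) (m : ℕ) (j : Fin N) :
    kernelCoeff a n (m + 1) s =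
      (1 - s j) * kernelCoeffDiv a n j (m + 1) s + kernelCoeffDiv a n j m s := by
  have h : kernel a n s = lin (s j) * (linInv (s j) * kernel a n s) := by
    rw [← mul_assoc, lin_mul_linInv (hs.1 j).2, one_mul]
  simp only [kernelCoeff, kernelCoeffDiv]
  conv_lhs => rw [h, lin, add_mul, map_add, coeff_C_mul, coeff_succ_X_mul]

theorem coeff_one_add_X_mul_derivative (F : ℂ⟦X⟧) (m : ℕ) :
    coeff m ((1 + X) * d⁄dX ℂ F) = (m + 1) * coeff (m + 1) F + m * coeff m F := by
  rw [add_mul, one_mul, map_add, coeff_derivative]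
  cases m with
  | zero => rw [coeff_zero_X_mul]; simp
  | succ m =>
    rw [coeff_succ_X_mul, coeff_derivative]
    push_cast
    ring

theorem kernelCoeff_rec (hs : s ∈ config N) (m : ℕ) :
    (m + 1) * kernelCoeff a n (m + 1) s + m * kernelCoeff a n m s =
      -((a + ∑ j, (n j : ℂ)) * kernelCoeff a n m s)
        - ∑ j, n j * s j * kernelCoeffDiv a n j m s := by
  have h := congrArg (coeff m) (derivative_kernel a n hs)
  rw [coeff_one_add_X_mul_derivative] at h
  simp only [map_sub, map_neg, coeff_C_mul, map_sum] at h
  exact h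

theorem kernelCoeffDiv_rec (hs : s ∈ config N) (m : ℕ) (j : Fin N) :
    (m + 1) * kernelCoeffDiv a n j (m + 1) s + m * kernelCoeffDiv a n j m s =
      -kernelCoeffDiv a n j m s - (n j + 1) * s j * kernelCoeffDivSq a n j m s
        - (a + ∑ i, (n i : ℂ)) * kernelCoeffDiv a n j m s
        - ∑ i ∈ Finset.univ.erase j, n i * s i *
          ((kernelCoeffDiv a n j m s - kernelCoeffDiv a n i m s) / (s j - s i)) := by
  have h1 : (1 + X) * d⁄dX ℂ (linInv (s j) * kernel a n s) =
      -(linInv (s j) * kernel a n s)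
        - C ((n j + 1) * s j) * (linInv (s j) * (linInv (s j) * kernel a n s))
        - C (a + ∑ i, (n i : ℂ)) * (linInv (s j) * kernel a n s)
        - ∑ i ∈ Finset.univ.erase j, C (n i * s i) *
          (linInv (s j) * linInv (s i) * kernel a n s) := by
    have h2 := derivative_kernel a n hs
    rw [← Finset.add_sum_erase _ (fun i => C (n i * s i) * (linInv (s i) * kernel a n s))
      (Finset.mem_univ j)] at h2
    have h3 : linInv (s j) * ∑ i ∈ Finset.univ.erase j, C (n i * s i) *
        (linInv (s i) * kernel a n s) = ∑ i ∈ Finset.univ.erase j, C (n i * s i) *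
          (linInv (s j) * linInv (s i) * kernel a n s) := by
      rw [Finset.mul_sum]
      exact Finset.sum_congr rfl fun i _ => by ring
    rw [Derivation.leibniz, derivative_linInv (hs.1 j).2, ← h3]
    simp only [smul_eq_mul, map_mul, map_add, map_one] at h2 ⊢
    linear_combination linInv (s j) * h2 -
      linInv (s j) * kernel a n s * one_add_X_mul_linInv hs j
  have h := congrArg (coeff m) h1
  rw [coeff_one_add_X_mul_derivative] at h
  simp only [map_sub, map_neg, coeff_C_mul, map_sum] at h
  simp only [kernelCoeffDiv, kernelCoeffDivSq]
  rw [h]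
  congr 1
  refine Finset.sum_congr rfl fun i hi => ?_
  rw [linInv_mul_linInv hs (Finset.ne_of_mem_erase hi).symm, mul_assoc (C _), coeff_C_mul,
    sub_mul, map_sub]
  ring

/-- If the coefficient of order `m + 1` vanished identically, so would its derivatives. Then
`kernelCoeff_succ` gives `n_j kernelCoeffDiv_j = 0` at order `m`, and `kernelCoeff_rec` leaves `(a +
∑ n_j + m)` times the coefficient of order `m`. The constant coefficient has no zeros on `config N`.
-/
theorem exists_kernelCoeff_ne_zero (h : ∀ m : ℕ, a + ∑ j, (n j : ℂ) + m ≠ 0) (m : ℕ) :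
    ∃ s ∈ config N, kernelCoeff a n m s ≠ 0 := by
  induction m with
  | zero =>
    obtain ⟨U, t, ht⟩ := exists_sqrtBranch N
    obtain ⟨s, hs⟩ := ht.isConnected.1
    refine ⟨s, ht.subset_config hs, ?_⟩
    have h1 : ∀ j, 1 - s j ≠ 0 := fun j =>
      sub_ne_zero.2 (Ne.symm ((ht.subset_config hs).1 j).2)
    rw [kernelCoeff, kernel, coeff_zero_eq_constantCoeff_apply, map_mul, map_prod]
    refine mul_ne_zero ?_ (Finset.prod_ne_zero_iff.2 fun j _ => ?_)
    · rw [← coeff_zero_eq_constantCoeff_apply, coeff_mk]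
      exact one_ne_zero
    · rw [linPow, map_mul, map_pow, map_pow, ← coeff_zero_eq_constantCoeff_apply,
        ← coeff_zero_eq_constantCoeff_apply, linInv, lin, coeff_mk]
      refine mul_ne_zero (pow_ne_zero _ ?_) (pow_ne_zero _ ?_)
      · simpa using h1 j
      · simpa using h1 j
  | succ m ih =>
    obtain ⟨s, hs, h0⟩ := ih
    by_contra! hz
    apply h0
    have h1 : ∀ j, (n j : ℂ) * kernelCoeffDiv a n j m s = 0 := by
      intro j
      have h2 := deriv_eq_zero_of_const isOpen_config hz hs
        (hasDerivAt_kernelCoeff a n hs (m + 1) j)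
      have h3 := kernelCoeff_succ a n hs m j
      rw [hz s hs] at h3
      linear_combination -(n j : ℂ) * h3 - (1 - s j) * h2
    have h2 := kernelCoeff_rec a n hs m
    rw [hz s hs, Finset.sum_eq_zero (f := fun j => n j * s j * kernelCoeffDiv a n j m s)
      fun j _ => by linear_combination s j * h1 j] at h2
    exact (mul_eq_zero.1 (by linear_combination h2 :
      (a + ∑ j, (n j : ℂ) + m) * kernelCoeff a n m s = 0)).resolve_left (h m)

/-- The component `q` of the solution of Lauricella type. -/
def lauricellaQ (m : ℕ) (s : Fin N → ℂ) (i : Fin N) : ℂ :=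
  -(s i * n i * kernelCoeffDiv a n i m s) / ((m + 1) * kernelCoeff a n (m + 1) s)

/-- For `p = 0` the equations for `q` are of Riccati type. Writing `I_m` for the coefficients of the
kernel, `q_i = -s_i ∂_i I_m / ((m + 1) I_{m+1})` linearizes them; the off-diagonal equations need
only partial fractions and `kernelCoeff_succ`. -/
theorem lauricellaQ_field_of_ne {κ : Param N} (hα : alpha κ = 0) {m : ℕ} (hk : κ .kinf = m + 1)
    (hn : ∀ i, κ (.th i) = n i) (hs : s ∈ config N) (h0 : kernelCoeff a n (m + 1) s ≠ 0)
    {i j : Fin N} (hij : i ≠ j) :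
    HasDerivAt (fun x => lauricellaQ a n m (Function.update s j x) i)
      (fieldQ κ s (lauricellaQ a n m s) 0 i j) (s j) := by
  have hm : (m : ℂ) + 1 ≠ 0 := Nat.cast_add_one_ne_zero m
  have hd := (((hasDerivAt_kernelCoeffDiv_of_ne a n hs m hij).const_mul (s i * n i)).fun_neg).fun_div
    ((hasDerivAt_kernelCoeff a n hs (m + 1) j).const_mul ((m : ℂ) + 1))
    (by rw [Function.update_eq_self]; exact mul_ne_zero hm h0)
  simp only [lauricellaQ, Function.update_of_ne hij]
  refine hd.congr_deriv ?_
  have h1 := kernelCoeff_succ a n hs m j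
  have hj0 := (hs.1 j).1
  have hj1 : s j - 1 ≠ 0 := sub_ne_zero.2 (hs.1 j).2
  have hj1' : 1 - s j ≠ 0 := sub_ne_zero.2 (hs.1 j).2.symm
  have h2 : s i - s j ≠ 0 := sub_ne_zero.2 (hs.2 i j hij)
  have h2' : s j - s i ≠ 0 := sub_ne_zero.2 (hs.2 j i hij.symm)
  have h3 : kernelCoeffDiv a n j (m + 1) s =
      (kernelCoeff a n (m + 1) s - kernelCoeffDiv a n j m s) / (1 - s j) := by
    rw [h1]; field_simp; ring
  simp only [Function.update_eq_self, fieldQ, if_neg hij, spinC, spinH, Pi.zero_apply, mul_zero,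
    Finset.sum_const_zero, hα, hk, hn, coeffR, h3, lauricellaQ]
  generalize kernelCoeff a n (m + 1) s = I at *
  generalize kernelCoeffDiv a n i m s = A at *
  generalize kernelCoeffDiv a n j m s = B at *
  rw [show s j - s i = -(s i - s j) by ring, show 1 - s j = -(s j - 1) by ring]
  generalize hD : s i - s j = D at *
  have : s i = D + s j := by rw [← hD]; ring
  rw [this]
  field_simp
  ring

/-- In the diagonal direction the squared inverse factor appears; `kernelCoeffDiv_rec` eliminates
it. This uses the exponent `a = κ₀`, and `α = 0` expresses `κ₁`. -/
theorem lauricellaQ_field_self {κ : Param N} (hα : alpha κ = 0) {m : ℕ} (hk : κ .kinf = m + 1)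
    (hn : ∀ i, κ (.th i) = n i) (hs : s ∈ config N)
    (h0 : kernelCoeff (κ .k0) n (m + 1) s ≠ 0) (j : Fin N) :
    HasDerivAt (fun x => lauricellaQ (κ .k0) n m (Function.update s j x) j)
      (fieldQ κ s (lauricellaQ (κ .k0) n m s) 0 j j) (s j) := by
  have hm : (m : ℂ) + 1 ≠ 0 := Nat.cast_add_one_ne_zero m
  have hd := ((((hasDerivAt_id' (s j)).fun_mul (hasDerivAt_const (s j) (n j : ℂ))).fun_mul
    (hasDerivAt_kernelCoeffDiv_self (κ .k0) n hs m j)).fun_neg).fun_div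
    ((hasDerivAt_kernelCoeff (κ .k0) n hs (m + 1) j).const_mul ((m : ℂ) + 1))
    (by rw [Function.update_eq_self]; exact mul_ne_zero hm h0)
  simp only [lauricellaQ, Function.update_self]
  refine hd.congr_deriv ?_
  have h1 := kernelCoeff_succ (κ .k0) n hs m j
  have h4 := kernelCoeffDiv_rec (κ .k0) n hs m j
  have hj0 := (hs.1 j).1
  have hj1 : s j - 1 ≠ 0 := sub_ne_zero.2 (hs.1 j).2
  have hj1' : 1 - s j ≠ 0 := sub_ne_zero.2 (hs.1 j).2.symm
  have h3 : kernelCoeffDiv (κ .k0) n j (m + 1) s =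
      -(kernelCoeff (κ .k0) n (m + 1) s - kernelCoeffDiv (κ .k0) n j m s) / (s j - 1) := by
    rw [h1]; field_simp; ring
  have h5 := two_mul_alpha (κ := κ)
  simp only [hα, hk, hn] at h5
  rw [sum_univ_eq_add_erase _ j] at h4 h5
  -- The two interaction sums of the field are combined, since only together do they give the
  -- divided differences in `kernelCoeffDiv_rec`.
  have h6 : n j * (∑ i ∈ Finset.univ.erase j, coeffS s j i * lauricellaQ (κ .k0) n m s i)
      + lauricellaQ (κ .k0) n m s j * ∑ i ∈ Finset.univ.erase j, coeffR s j i * n i =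
      n j * s j / ((m + 1) * kernelCoeff (κ .k0) n (m + 1) s) *
      ((s j - 1) * ∑ i ∈ Finset.univ.erase j, n i * s i *
          ((kernelCoeffDiv (κ .k0) n j m s - kernelCoeffDiv (κ .k0) n i m s) / (s j - s i))
        - kernelCoeffDiv (κ .k0) n j m s * ∑ i ∈ Finset.univ.erase j, (n i : ℂ)) := by
    simp only [mul_sub, Finset.mul_sum, ← Finset.sum_add_distrib, ← Finset.sum_sub_distrib]
    refine Finset.sum_congr rfl fun i hi => ?_
    have h2 : s j - s i ≠ 0 := sub_ne_zero.2 (hs.2 j i (Finset.ne_of_mem_erase hi).symm)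
    simp only [coeffS, coeffR, lauricellaQ]
    rw [show s i - s j = -(s j - s i) by ring]
    generalize hD : s j - s i = D at *
    have : s i = s j - D := by rw [← hD]; ring
    rw [this]
    field_simp
    ring
  simp only [Function.update_eq_self, fieldQ, if_true, spinC, spinH, Pi.zero_apply, mul_zero,
    Finset.sum_const_zero, hα, hk, hn, zero_sub, mul_neg, Finset.sum_neg_distrib]
  rw [h3] at h4 ⊢
  have h7 : (n j + 1) * kernelCoeffDivSq (κ .k0) n j m s = 
      (n j + 1) * s j * kernelCoeffDivSq (κ .k0) n j m s / s j := by field_simp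
  rw [h7]
  generalize (n j + 1) * s j * kernelCoeffDivSq (κ .k0) n j m s = E at *
  generalize ∑ i ∈ Finset.univ.erase j, n i * s i *
    ((kernelCoeffDiv (κ .k0) n j m s - kernelCoeffDiv (κ .k0) n i m s) / (s j - s i)) = T at *
  generalize ∑ i ∈ Finset.univ.erase j, coeffS s j i * lauricellaQ (κ .k0) n m s i = T1 at *
  generalize ∑ i ∈ Finset.univ.erase j, coeffR s j i * n i = T2 at *
  generalize ∑ i ∈ Finset.univ.erase j, (n i : ℂ) = T3 at *
  simp only [lauricellaQ] at h6 ⊢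
  generalize kernelCoeff (κ .k0) n (m + 1) s = I at *
  generalize kernelCoeffDiv (κ .k0) n j m s = B at *
  have hE : E = -B - (κ .k0 + (n j + T3)) * B - T - m * B
    + (m + 1) * ((I - B) / (s j - 1)) := by linear_combination h4
  have hk1 : κ .k1 = 1 - κ .k0 - (m + 1) - (n j + T3) := by linear_combination h5
  rw [hE, hk1]
  have e1 : ∀ (A B' : ℂ), A - -(n j : ℂ) * T1 - -(B' * T2) = A + (n j * T1 + B' * T2) := by
    intros; ring
  rw [e1, h6]
  field_simp
  ring

/-- For `α = 0` the locus `p = 0` is invariant: `D` and all `f_k` vanish on it, and every other term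
of `fieldP` contains a factor `p`. -/
theorem isAlgebraicSolution_of_p_eq_zero {κ : Param N} (hα : alpha κ = 0) {U : Set (Fin N → ℂ)}
    {q : (Fin N → ℂ) → Fin N → ℂ} (hU : IsOpen U) (hc : IsConnected U) (hs : U ⊆ config N)
    (hq : ∀ i, DifferentiableOn ℂ (fun s => q s i) U)
    (ha : ∀ i, IsAlgebraicFunction U (fun s => q s i))
    (hf : ∀ s ∈ U, ∀ i j, HasDerivAt (fun x => q (Function.update s j x) i)
      (fieldQ κ s (q s) 0 i j) (s j)) :
    IsAlgebraicSolution κ U q (fun _ => 0) := by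
  refine ⟨⟨hU, hc, hs, differentiableOn_pi.2 hq, differentiableOn_const _, fun s hs i j => ?_,
    fun s hs i j => ?_⟩, ha, fun i => .const 0⟩
  · rw [deriv_hamiltonian_p]; exact hf s hs i j
  · rw [deriv_hamiltonian_q]
    refine (hasDerivAt_const (s j) (0 : ℂ)).congr_deriv ?_
    simp [fieldP, spinD, spinF, hα]

/-- A positive integer `κ_∞` makes the exponent of the integrand at `z = 1` a pole, so the integral
around it is a Taylor coefficient. As `κ₁` is not an integer, the factors `κ₀ + ∑ n_j + l` cannot
vanish, and the denominator is not identically zero. -/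
theorem exists_isAlgebraicSolution_lauricella {κ : Param N} (hα : alpha κ = 0) {m : ℕ}
    (hk : κ .kinf = m + 1) (hn : ∀ i, κ (.th i) = n i) (h1 : ∀ l : ℤ, κ .k1 ≠ l) :
    Has IsAlgebraicSolution κ := by
  have h5 := two_mul_alpha (κ := κ)
  simp only [hα, hk, hn] at h5
  obtain ⟨s, hs, h0⟩ := exists_kernelCoeff_ne_zero (κ .k0) n (fun l h => h1 (l - m)
    (by push_cast; linear_combination h5 - h)) (m + 1)
  have hreg : ∀ m, DifferentiableOn ℂ (kernelCoeff (κ .k0) n m) (config N) := fun m =>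
    (coeffRegular_kernel (κ .k0) n m).1
  have hd : ∀ i, CoeffRegular fun s => linInv (s i) * kernel (κ .k0) n s := fun i =>
    (coeffRegular_linInv i).mul (coeffRegular_kernel (κ .k0) n)
  have hne : {s | s ∈ config N ∧ kernelCoeff (κ .k0) n (m + 1) s ≠ 0} ∈ 𝓝 s :=
    Filter.inter_mem (isOpen_config.mem_nhds hs) (((hreg (m + 1)).continuousOn.continuousAt
      (isOpen_config.mem_nhds hs)).eventually_ne h0)
  obtain ⟨U, hU, hUo, hUc, -⟩ := exists_ball_subset hne
  have hm : (m : ℂ) + 1 ≠ 0 := Nat.cast_add_one_ne_zero m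
  refine ⟨U, lauricellaQ (κ .k0) n m, fun _ => 0, isAlgebraicSolution_of_p_eq_zero hα hUo hUc
    (fun s hs => (hU hs).1) (fun i => ?_) (fun i => ?_) fun s hs i j => ?_⟩
  · intro s hs
    have e1 : DifferentiableAt ℂ (fun s => kernelCoeffDiv (κ .k0) n i m s) s :=
      (hd i m).1.differentiableAt (isOpen_config.mem_nhds (hU hs).1)
    have e2 : DifferentiableAt ℂ (fun s => kernelCoeff (κ .k0) n (m + 1) s) s :=
      (hreg (m + 1)).differentiableAt (isOpen_config.mem_nhds (hU hs).1)
    have e3 : (m + 1) * kernelCoeff (κ .k0) n (m + 1) s ≠ 0 := mul_ne_zero hm (hU hs).2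
    refine DifferentiableAt.differentiableWithinAt ?_
    simp only [lauricellaQ]
    fun_prop (disch := assumption)
  · refine IsAlgebraicFunction.mono (U := config N) ?_ fun s hs => (hU hs).1
    exact ((((IsAlgebraicFunction.coord i).mul (.const _)).mul (hd i m).2).neg).div
      ((IsAlgebraicFunction.const _).mul (coeffRegular_kernel (κ .k0) n (m + 1)).2)
  · by_cases hij : i = j
    · subst hij
      exact lauricellaQ_field_self n hα hk hn (hU hs).1 (hU hs).2 i
    · exact lauricellaQ_field_of_ne (κ .k0) n hα hk hn (hU hs).1 (hU hs).2 hij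

theorem exists_isAlgebraicSolution_zero {κ : Param N} (hα : alpha κ = 0)
    (hn : ∀ i, κ (.th i) = 0) : Has IsAlgebraicSolution κ := by
  obtain ⟨U, t, ht⟩ := exists_sqrtBranch N
  refine ⟨U, fun _ => 0, fun _ => 0, isAlgebraicSolution_of_p_eq_zero hα ht.isOpen ht.isConnected
    ht.subset_config (fun i => differentiableOn_const _) (fun i => .const 0) fun s hs i j => ?_⟩
  refine (hasDerivAt_const (s j) (0 : ℂ)).congr_deriv ?_
  simp [fieldQ, spinH, hn]

end LauricellaSolution


/-! ### The case of integer parameters -/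

section Integer

/-- The parameter with the given components. -/
def mkParam (u v w : ℂ) (θ : Fin N → ℂ) : Param N
  | .k0 => u
  | .k1 => v
  | .kinf => w
  | .th i => θ i

variable {𝓕 : Param N → Set (Fin N → ℂ) → ((Fin N → ℂ) → Fin N → ℂ) →
    ((Fin N → ℂ) → Fin N → ℂ) → Prop}

theorem StepClosed.has_signs (H : StepClosed 𝓕) {κ κ' : Param N} (h : Has 𝓕 κ)
    (hs : ∀ a, κ' a = κ a ∨ κ' a = -κ a) : Has 𝓕 κ' := by
  have key : ∀ t : Finset (Idx N), Has 𝓕 (fun a => if a ∈ t then κ' a else κ a) := by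
    intro t
    induction t using Finset.induction_on with
    | empty => simpa using h
    | insert a t ha ih =>
      rcases hs a with h1 | h1
      · convert ih using 2 with b
        by_cases hb : b = a
        · subst hb; simp [ha, h1]
        · simp [hb]
      · convert H.has_refl ih a using 1
        funext b
        by_cases hb : b = a
        · subst hb; simp [ha, h1]
        · simp [hb]
  simpa using key Finset.univ

theorem StepClosed.has_one_sub (H : StepClosed 𝓕) {u v w : ℂ} {θ : Fin N → ℂ}
    (h : Has 𝓕 (mkParam (1 - u) (1 - v) w θ))
    (hr : ∀ (ε : ℤˣ) (η : Fin N → ℤˣ),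
      1 - u + (1 - v) + ((ε : ℤ) : ℂ) * w + ∑ i, ((η i : ℤ) : ℂ) * θ i ≠ 1) :
    Has 𝓕 (mkParam u v w θ) := by
  have h1 := one_sub_of_refl_tau (T := fun κ => ¬Resonant κ) (P := Has 𝓕)
    (fun κ a h => H.has_refl h a) (fun κ hT h => H.has_tau h hT)
    (κ := mkParam (1 - u) (1 - v) w θ) (fun ⟨ε, η, he⟩ => hr ε η he) h
  convert h1 using 1
  funext a
  cases a <;> simp [mkParam, setHalf]

/-- Both the parity of a signed sum and its bound by the unsigned sum are recorded; the exclusion of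
resonances uses the two. -/
theorem exists_signed_sum_eq {ι : Type*} (t : Finset ι) (η : ι → ℤˣ) (n : ι → ℕ) :
    ∃ d : ℕ, ∑ i ∈ t, (η i : ℤ) * n i = ((∑ i ∈ t, n i : ℕ) : ℤ) - 2 * d := by
  classical
  induction t using Finset.induction_on with
  | empty => exact ⟨0, by simp⟩
  | insert i t hi ih =>
    obtain ⟨d, hd⟩ := ih
    rw [Finset.sum_insert hi, Finset.sum_insert hi, hd]
    rcases Int.units_eq_one_or (η i) with h | h
    · exact ⟨d, by rw [h]; push_cast; ring⟩
    · exact ⟨d + n i, by rw [h]; push_cast; ring⟩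

theorem half_ne_int (y : ℕ) (l : ℤ) : (y : ℂ) + 1 / 2 ≠ l := by
  intro h
  have h1 : (2 : ℂ) * y + 1 = 2 * l := by linear_combination 2 * h
  have h2 : (2 : ℤ) * y + 1 = 2 * l := by exact_mod_cast h1
  omega

theorem StepClosed.has_swap_th (H : StepClosed 𝓕) {u v w : ℂ} {θ : Fin N → ℂ} (i : Fin N)
    (h : Has 𝓕 (mkParam u v w θ)) :
    Has 𝓕 (mkParam u (θ i) w (Function.update θ i v)) := by
  convert H.has_swap_of_ne h (a := .k1) (b := .th i) (by simp) (by simp) using 1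
  funext a
  cases a with
  | k0 => rw [Function.comp_apply, Equiv.swap_apply_of_ne_of_ne (by simp) (by simp)]; rfl
  | k1 => rw [Function.comp_apply, Equiv.swap_apply_left]; rfl
  | kinf => rw [Function.comp_apply, Equiv.swap_apply_of_ne_of_ne (by simp) (by simp)]; rfl
  | th l =>
    rw [Function.comp_apply]
    by_cases hl : l = i
    · subst hl
      rw [Equiv.swap_apply_right]
      simp [mkParam]
    · rw [Equiv.swap_apply_of_ne_of_ne (by simp) (by simpa using hl)]
      simp [mkParam, hl]

/-- The resonant parameters for which some sign of the resonance is positive. -/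
theorem has_of_alpha_eq_zero {u : ℂ} (y : ℕ) {k : ℤ} {n : Fin N → ℤ} (hk : k ≠ 0)
    (hα : alpha (mkParam u (y + 1 / 2) k fun i => (n i : ℂ)) = 0)
    (hpos : 0 < k ∨ ∃ i, 0 < n i) :
    Has IsAlgebraicSolution (mkParam u (y + 1 / 2) k fun i => (n i : ℂ)) := by
  rcases hpos with hk0 | ⟨i, hi⟩
  · obtain ⟨m, hm⟩ := Int.eq_ofNat_of_zero_le (show 0 ≤ k - 1 by omega)
    refine exists_isAlgebraicSolution_lauricella n hα (m := m) ?_ (fun i => rfl)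
      (half_ne_int y)
    have : k = m + 1 := by omega
    simp [mkParam, this]
  · obtain ⟨m, hm⟩ := Int.eq_ofNat_of_zero_le (show 0 ≤ n i - 1 by omega)
    -- A positive `θ_i` is treated by the Lauricella solution with `κ_∞` and `θ_i` exchanged;
    -- exchanging back is possible as both are nonzero.
    set κ : Param N := mkParam u (y + 1 / 2) k fun i => (n i : ℂ) with hκ
    have h : Has IsAlgebraicSolution (κ ∘ Equiv.swap .kinf (.th i)) := by
      refine exists_isAlgebraicSolution_lauricella (Function.update n i k) (m := m) ?_ ?_
        (fun l => ?_) (fun l => ?_)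
      · rw [← hα]
        exact alpha_perm κ _
      · have : n i = m + 1 := by omega
        rw [Function.comp_apply, Equiv.swap_apply_left]
        simp [hκ, mkParam, this]
      · rw [Function.comp_apply]
        by_cases hl : l = i
        · subst hl
          rw [Equiv.swap_apply_right]
          simp [hκ, mkParam]
        · rw [Equiv.swap_apply_of_ne_of_ne (by simp) (by simpa using hl)]
          simp [hκ, mkParam, hl]
      · rw [Function.comp_apply, Equiv.swap_apply_of_ne_of_ne (by simp) (by simp)]
        exact half_ne_int y l
    have h2 := stepClosed_isAlgebraicSolution.has_swap h (a := .kinf) (b := .th i) ?_ ?_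
    · convert h2 using 1
      funext a
      simp only [Function.comp_apply, Equiv.swap_apply_self]
    · rw [Function.comp_apply, Equiv.swap_apply_left]
      simpa [hκ, mkParam] using hi.ne'
    · rw [Function.comp_apply, Equiv.swap_apply_right]
      simpa [hκ, mkParam] using hk

/-- Truncated subtraction is intended: `1/2` is fixed by `z ↦ 1 - z`, and otherwise the shift lowers
the absolute value by one. -/
theorem one_sub_natCast_add_half (x : ℕ) :
    (1 - ((x : ℂ) + 1 / 2) = ((x - 1 : ℕ) : ℂ) + 1 / 2) ∨
      (1 - ((x : ℂ) + 1 / 2) = -(((x - 1 : ℕ) : ℂ) + 1 / 2)) := by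
  cases x with
  | zero => left; norm_num
  | succ x => right; push_cast; simp; ring

/-- Induction on `x + y + ∑ n_i`. Without resonance, `R_τ` reaches the parameter from `(x - 1, y -
1)`, which is smaller unless `x = y = 0`, the seed. A resonance reads `ε k + ∑ η_i n_i = x + y`, and
reversing its signs gives an equivalent parameter with `α = 0`. -/
theorem has_mkParam_half_half (x y : ℕ) {k : ℕ} (hk : k ≠ 0) (n : Fin N → ℕ) :
    Has IsAlgebraicSolution (mkParam (x + 1 / 2) (y + 1 / 2) k fun i => (n i : ℂ)) := by
  have H : StepClosed (N := N) IsAlgebraicSolution := stepClosed_isAlgebraicSolution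
  induction hM : x + y + ∑ i, n i using Nat.strong_induction_on generalizing x y n with
  | _ M ih =>
  by_cases h0 : x = 0 ∧ y = 0
  · obtain ⟨U, t, ht⟩ := exists_sqrtBranch N
    refine ⟨U, _, _, seed_isAlgebraicSolution ⟨?_, ?_, ?_⟩ ht⟩
    · simp [mkParam, h0.1]
    · simp [mkParam, h0.2]
    · simpa [mkParam] using hk
  by_cases hres : ∃ (ε : ℤˣ) (η : Fin N → ℤˣ), 1 - ((x : ℂ) + 1 / 2) + (1 - ((y : ℂ) + 1 / 2))
      + ((ε : ℤ) : ℂ) * (k : ℂ) + ∑ i, ((η i : ℤ) : ℂ) * (n i : ℂ) = 1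
  swap
  · push Not at hres
    refine H.has_one_sub (H.has_signs (ih (x - 1 + (y - 1) + ∑ i, n i) (by omega)
      (x - 1) (y - 1) n rfl) fun a => ?_) hres
    cases a with
    | k0 => exact one_sub_natCast_add_half x
    | k1 => exact one_sub_natCast_add_half y
    | _ => exact Or.inl rfl
  obtain ⟨ε, η, hres⟩ := hres
  have hα : alpha (mkParam (x + 1 / 2) (y + 1 / 2) ((-(ε * k) : ℤ) : ℂ)
      fun i => ((-(η i * n i) : ℤ) : ℂ)) = 0 := by
    simp only [alpha, mkParam]
    push_cast
    rw [Finset.sum_neg_distrib]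
    linear_combination 1 / 2 * hres
  have hsgn : Has IsAlgebraicSolution (mkParam (x + 1 / 2) (y + 1 / 2) ((-(ε * k) : ℤ) : ℂ)
      fun i => ((-(η i * n i) : ℤ) : ℂ)) →
      Has IsAlgebraicSolution (mkParam (x + 1 / 2) (y + 1 / 2) k fun i => (n i : ℂ)) := by
    refine fun h => H.has_signs h fun a => ?_
    cases a with
    | k0 => exact Or.inl rfl
    | k1 => exact Or.inl rfl
    | kinf => rcases Int.units_eq_one_or ε with h | h <;> simp [mkParam, h]
    | th i => rcases Int.units_eq_one_or (η i) with h | h <;> simp [mkParam, h]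
  have hk' : -((ε : ℤ) * k) ≠ 0 := neg_ne_zero.2 (mul_ne_zero ε.ne_zero (by exact_mod_cast hk))
  -- One positive exponent suffices for a Lauricella solution. Otherwise all terms of the resonance
  -- are nonnegative, so it is `k + ∑ n_i = x + y`.
  by_cases hpos : 0 < -((ε : ℤ) * k) ∨ ∃ i, 0 < -((η i : ℤ) * n i)
  · exact hsgn (has_of_alpha_eq_zero y hk' hα hpos)
  push Not at hpos
  have hε : (ε : ℤ) * k = k := by
    rcases Int.units_eq_one_or ε with h | h
    · simp [h]
    · have := hpos.1
      rw [h] at this ⊢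
      push_cast at this ⊢
      omega
  have hη : ∀ i, (η i : ℤ) * n i = n i := by
    intro i
    rcases Int.units_eq_one_or (η i) with h | h
    · simp [h]
    · have := hpos.2 i
      rw [h] at this ⊢
      push_cast at this ⊢
      omega
  have hsum : k + ∑ i, n i = x + y := by
    have e1 : ((ε : ℤ) : ℂ) * k = k := by exact_mod_cast hε
    have e2 : ∀ i, ((η i : ℤ) : ℂ) * n i = n i := fun i => by exact_mod_cast hη i
    simp only [e1, e2] at hres
    have : (k : ℂ) + ∑ i, (n i : ℂ) = x + y := by linear_combination hres
    exact_mod_cast this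
  by_cases hn : ∀ i, n i = 0
  · exact hsgn (exists_isAlgebraicSolution_zero hα fun i => by simp [mkParam, hn i])
  push Not at hn
  -- In the remaining case some `n_i` is positive. The step then lowers `κ₀` and `θ_i`: `θ_i` is
  -- exchanged with `κ₁`, so that `R_τ` acts on `x` and `n_i` while `y + 1/2` waits in the place of
  -- `θ_i`.
  obtain ⟨i, hi⟩ := hn
  have hupd : ∀ f : Fin N → ℕ, ∑ l, f l = f i + ∑ l ∈ Finset.univ.erase i, f l := fun f =>
    (Finset.add_sum_erase _ _ (Finset.mem_univ i)).symm
  have hrest : ∑ l ∈ Finset.univ.erase i, Function.update n i (n i - 1) l =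
      ∑ l ∈ Finset.univ.erase i, n l :=
    Finset.sum_congr rfl fun l hl => Function.update_of_ne (Finset.ne_of_mem_erase hl) _ _
  have hM' := hupd n
  have h1 := ih (x - 1 + y + ∑ l, Function.update n i (n i - 1) l) (by
    rw [hupd, hrest, Function.update_self]; omega) (x - 1) y (Function.update n i (n i - 1)) rfl
  have h2 := H.has_swap_th i h1
  have h3 : Has IsAlgebraicSolution (mkParam ((x : ℂ) + 1 / 2) (n i) k
      (Function.update (fun l => (n l : ℂ)) i (y + 1 / 2))) := by
    refine H.has_one_sub (H.has_signs h2 fun a => ?_) fun ε' η' => ?_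
    · cases a with
      | k0 => exact one_sub_natCast_add_half x
      | k1 =>
        right
        obtain ⟨m, hm⟩ := Nat.exists_eq_succ_of_ne_zero hi
        simp [mkParam, hm]
      | kinf => exact Or.inl rfl
      | th l =>
        left
        by_cases hl : l = i
        · subst hl; simp [mkParam]
        · simp [mkParam, hl]
    · intro he
      rw [sum_univ_eq_add_erase _ i, Function.update_self] at he
      rw [Finset.sum_congr rfl (g := fun l => ((η' l : ℤ) : ℂ) * (n l : ℂ)) fun l hl => by
        rw [Function.update_of_ne (Finset.ne_of_mem_erase hl)]] at he
      obtain ⟨d, hd⟩ := exists_signed_sum_eq (Finset.univ.erase i) η' n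
      have hd' : ∑ l ∈ Finset.univ.erase i, ((η' l : ℤ) : ℂ) * (n l : ℂ) =
          ((((∑ l ∈ Finset.univ.erase i, n l : ℕ) : ℤ) - 2 * d : ℤ) : ℂ) := by
        rw [← hd]; push_cast; rfl
      rw [hd'] at he
      generalize ∑ l ∈ Finset.univ.erase i, n l = r at *
      -- A resonance for the new pair contradicts `k + ∑ n_i = x + y`: by parity if `y + 1/2` enters
      -- with the sign +, and otherwise by size, since it would force `n_i = 0`.
      rcases Int.units_eq_one_or (η' i) with h | h <;>
        rcases Int.units_eq_one_or ε' with h' | h' <;> rw [h, h'] at he <;> push_cast at he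
      · have : (1 : ℤ) - x + (1 - n i) + k + y + (r - 2 * d) = 1 := by
          have : (1 : ℂ) - x + (1 - n i) + k + y + (r - 2 * d) = 1 := by linear_combination he
          exact_mod_cast this
        omega
      · have : (1 : ℤ) - x + (1 - n i) - k + y + (r - 2 * d) = 1 := by
          have : (1 : ℂ) - x + (1 - n i) - k + y + (r - 2 * d) = 1 := by linear_combination he
          exact_mod_cast this
        omega
      · have : (0 : ℤ) - x + (1 - n i) + k - y + (r - 2 * d) = 1 := by
          have : (0 : ℂ) - x + (1 - n i) + k - y + (r - 2 * d) = 1 := by linear_combination he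
          exact_mod_cast this
        omega
      · have : (0 : ℤ) - x + (1 - n i) - k - y + (r - 2 * d) = 1 := by
          have : (0 : ℂ) - x + (1 - n i) - k - y + (r - 2 * d) = 1 := by linear_combination he
          exact_mod_cast this
        omega
  have h4 := H.has_swap_th i h3
  simpa using h4

theorem IsHalfInteger.exists_nat {z : ℂ} (h : IsHalfInteger z) :
    ∃ x : ℕ, z = x + 1 / 2 ∨ z = -(x + 1 / 2) := by
  obtain ⟨m, rfl⟩ := h
  rcases Int.eq_nat_or_neg m with ⟨x, rfl | rfl⟩
  · exact ⟨x, by simp⟩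
  · cases x with
    | zero => exact ⟨0, by simp⟩
    | succ x => exact ⟨x, Or.inr (by push_cast; ring)⟩

theorem exists_nat_of_int {z : ℂ} (h : ∃ m : ℤ, z = m) : ∃ x : ℕ, z = x ∨ z = -x := by
  obtain ⟨m, rfl⟩ := h
  rcases Int.eq_nat_or_neg m with ⟨x, rfl | rfl⟩
  · exact ⟨x, by simp⟩
  · exact ⟨x, by simp⟩

theorem has_of_exists_ne_zero {κ : Param N} {a b c : Idx N} (hab : a ≠ b) (hac : a ≠ c)
    (hbc : b ≠ c) (ha : IsHalfInteger (κ a)) (hb : IsHalfInteger (κ b))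
    (hint : ∀ d, d ≠ a → d ≠ b → ∃ m : ℤ, κ d = m) (hi : κ .kinf ≠ 0) (hc : κ c ≠ 0) :
    Has IsAlgebraicSolution κ := by
  have H : StepClosed (N := N) IsAlgebraicSolution := stepClosed_isAlgebraicSolution
  obtain ⟨π, h0, h1, h2, hπ⟩ := H.exists_perm κ hab hac hbc hi hc
  apply hπ
  have hth : ∀ i, ∃ x : ℕ, κ (π (.th i)) = x ∨ κ (π (.th i)) = -x := fun i =>
    exists_nat_of_int (hint _ (by rw [← h0]; simp) (by rw [← h1]; simp))
  choose n hn using hth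
  obtain ⟨x, hx⟩ := ha.exists_nat
  obtain ⟨y, hy⟩ := hb.exists_nat
  obtain ⟨k, hk⟩ := exists_nat_of_int (hint c hac.symm hbc.symm)
  have hk0 : k ≠ 0 := by
    rintro rfl
    apply hc
    simpa using hk
  refine H.has_signs (has_mkParam_half_half x y hk0 n) fun d => ?_
  cases d with
  | k0 => rw [Function.comp_apply, h0]; exact hx
  | k1 => rw [Function.comp_apply, h1]; exact hy
  | kinf => rw [Function.comp_apply, h2]; exact hk
  | th i => exact hn i

/-- All integer components vanish here, so none can be moved to the place of `κ_∞`, which is itself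
a half-integer. For `x = y = 0` one has `α = 0` and `q = p = 0` is a solution. -/
theorem has_mkParam_half_zero_half (x y : ℕ) :
    Has IsAlgebraicSolution (mkParam (N := N) (x + 1 / 2) 0 (y + 1 / 2) fun _ => 0) := by
  have H : StepClosed (N := N) IsAlgebraicSolution := stepClosed_isAlgebraicSolution
  have hne : ∀ z : ℕ, (z : ℂ) + 1 / 2 ≠ 0 := fun z h => half_ne_int z 0 (by simpa using h)
  by_cases h0 : x = 0 ∧ y = 0
  · refine exists_isAlgebraicSolution_zero ?_ fun i => rfl
    simp [alpha, mkParam, h0.1, h0.2]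
    norm_num
  have key : ∀ x y : ℕ, ¬(x = 0 ∧ y = 0) → x ≠ y + 1 →
      Has IsAlgebraicSolution (mkParam (N := N) (x + 1 / 2) 0 (y + 1 / 2) fun _ => 0) := by
    intro x y h0 hxy
    -- Before `R_τ` the component `κ₁` equals `1 - 0 = 1`, a nonzero integer, so the earlier case
    -- applies to that parameter.
    refine H.has_one_sub ?_ fun ε η he => ?_
    · refine has_of_exists_ne_zero (a := .k0) (b := .kinf) (c := .k1) (by simp) (by simp) (by simp)
        ⟨-x, by simp [mkParam]; ring⟩ ⟨y, by simp [mkParam]⟩ (fun d h1 h2 => ?_) (hne y)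
        (by simp [mkParam])
      cases d with
      | k0 => exact absurd rfl h1
      | kinf => exact absurd rfl h2
      | k1 => exact ⟨1, by simp [mkParam]⟩
      | th i => exact ⟨0, by simp [mkParam]⟩
    · simp only [mul_zero, Finset.sum_const_zero] at he
      rcases Int.units_eq_one_or ε with h | h <;> rw [h] at he <;> push_cast at he
      · have : (y : ℂ) + 1 = x := by linear_combination he
        exact hxy (by exact_mod_cast this.symm)
      · have : (x : ℂ) + y = 0 := by linear_combination -he
        have : x + y = 0 := by exact_mod_cast this
        exact h0 (by omega)
  -- The resonance `x = y + 1` is asymmetric, and exchanging the two half-integers, both nonzero,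
  -- avoids it.
  by_cases hxy : x = y + 1
  · have h1 := H.has_swap (key y x (by omega) (by omega)) (a := .k0) (b := .kinf) (hne y) (hne x)
    convert h1 using 1
    funext a
    cases a with
    | k0 => rw [Function.comp_apply, Equiv.swap_apply_left]; rfl
    | kinf => rw [Function.comp_apply, Equiv.swap_apply_right]; rfl
    | k1 => rw [Function.comp_apply, Equiv.swap_apply_of_ne_of_ne (by simp) (by simp)]; rfl
    | th i => rw [Function.comp_apply, Equiv.swap_apply_of_ne_of_ne (by simp) (by simp)]; rfl
  · exact key x y h0 hxy

/-- If all components other than the two half-integers vanish, then `κ_∞ ≠ 0` must be one of these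
two, which leads to the preceding special case. -/
theorem has_of_half_int {κ : Param N} {a b : Idx N} (hab : a ≠ b) (ha : IsHalfInteger (κ a))
    (hb : IsHalfInteger (κ b)) (hint : ∀ d, d ≠ a → d ≠ b → ∃ m : ℤ, κ d = m)
    (hi : κ .kinf ≠ 0) : Has IsAlgebraicSolution κ := by
  have H : StepClosed (N := N) IsAlgebraicSolution := stepClosed_isAlgebraicSolution
  by_cases hc : ∃ c, a ≠ c ∧ b ≠ c ∧ κ c ≠ 0
  · obtain ⟨c, hac, hbc, hc⟩ := hc
    exact has_of_exists_ne_zero hab hac hbc ha hb hint hi hc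
  push Not at hc
  have key : ∀ a : Idx N, a ≠ .kinf → IsHalfInteger (κ a) → IsHalfInteger (κ .kinf) →
      (∀ c, a ≠ c → .kinf ≠ c → κ c = 0) → Has IsAlgebraicSolution κ := by
    intro a hai ha hk hz
    obtain ⟨x, hx⟩ := ha.exists_nat
    obtain ⟨y, hy⟩ := hk.exists_nat
    have h1 : Has IsAlgebraicSolution (κ ∘ Equiv.swap .k0 a) := by
      have hz' : ∀ c, c ≠ .k0 → c ≠ .kinf → κ (Equiv.swap .k0 a c) = 0 := by
        intro c h0 hi
        refine hz _ (fun h => h0 ?_) (fun h => hi ?_)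
        · rw [← (Equiv.swap .k0 a).injective.eq_iff, ← h, Equiv.swap_apply_left]
        · rw [← (Equiv.swap .k0 a).injective.eq_iff, ← h,
            Equiv.swap_apply_of_ne_of_ne (by simp) hai.symm]
      refine H.has_signs (has_mkParam_half_zero_half x y) fun c => ?_
      cases c with
      | k0 => rw [Function.comp_apply, Equiv.swap_apply_left]; exact hx
      | kinf =>
        rw [Function.comp_apply, Equiv.swap_apply_of_ne_of_ne (by simp) hai.symm]; exact hy
      | k1 => exact Or.inl (hz' _ (by simp) (by simp))
      | th i => exact Or.inl (hz' _ (by simp) (by simp))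
    have h2 := H.has_swap_k0 h1 hai
    convert h2 using 1
    funext c
    simp only [Function.comp_apply, Equiv.swap_apply_self]
  by_cases hai : a = .kinf
  · subst hai
    exact key b hab.symm hb ha fun c h1 h2 => hc c h2 h1
  by_cases hbi : b = .kinf
  · subst hbi
    exact key a hai ha hb hc
  · exact absurd (hc _ hai hbi) hi

end Integer

end

end Garnier

/-! ### The theorem, assembled from the non-integer and the integer case -/

theorem theorem3p1 (N : ℕ) (hN : 1 ≤ N) :
    (∀ κ : Garnier.Param N, Garnier.IsSeedParam κ →
      ∀ (U : Set (Fin N → ℂ)) (t : (Fin N → ℂ) → Fin N → ℂ), Garnier.IsSqrtBranch U t →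
        Garnier.IsAlgebraicSolution κ U
          (fun s => Garnier.seedQ κ (t s)) (fun s => Garnier.seedP κ (t s)) ∧
        Garnier.wordParam (Garnier.w0 N) κ = κ ∧
        ∀ s ∈ U,
          Garnier.WordRegular (Garnier.w0 N) κ
            ⟨Garnier.seedQ κ (t s), Garnier.seedP κ (t s), s⟩ ∧
          Garnier.wordAct (Garnier.w0 N) κ
              ⟨Garnier.seedQ κ (t s), Garnier.seedP κ (t s), s⟩ =
            ⟨Garnier.seedQ κ (t s), Garnier.seedP κ (t s), s⟩) ∧
    (∀ (κ : Garnier.Param N) (a b : Garnier.Idx N), a ≠ b →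
      Garnier.IsHalfInteger (κ a) → Garnier.IsHalfInteger (κ b) → κ .kinf ≠ 0 →
        (∃ (U : Set (Fin N → ℂ)) (q p : (Fin N → ℂ) → Fin N → ℂ),
          Garnier.IsAlgebraicSolution κ U q p) ∧
        ((∃ c, c ≠ a ∧ c ≠ b ∧ ∀ m : ℤ, κ c ≠ m) →
          ∃ (U : Set (Fin N → ℂ)) (q p : (Fin N → ℂ) → Fin N → ℂ),
            Garnier.IsAlgebraicSolution κ U q p ∧ Garnier.ObtainedFromSeed κ U q p)) := by
  refine ⟨fun κ hκ U t ht => ?_, fun κ a b hab ha hb hi => ⟨?_, fun ⟨c, hca, hcb, hc⟩ =>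
    Garnier.has_obtained hab hca hcb ha hb hi hc⟩⟩
  · have hf := fun s (hs : s ∈ U) =>
      Garnier.seed_fixed hκ (ht.subset_config hs) (ht.sq_eq s hs)
    obtain ⟨s, hs⟩ := ht.isConnected.1
    exact ⟨Garnier.seed_isAlgebraicSolution hκ ht, (hf s hs).1, fun s hs => (hf s hs).2⟩
  · by_cases h : ∃ c, c ≠ a ∧ c ≠ b ∧ ∀ m : ℤ, κ c ≠ m
    · obtain ⟨c, hca, hcb, hc⟩ := h
      obtain ⟨U, q, p, hs, -⟩ := Garnier.has_obtained hab hca hcb ha hb hi hc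
      exact ⟨U, q, p, hs⟩
    · push Not at h
      exact Garnier.has_of_half_int hab ha hb h hi
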